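/- Let $n\ge 2$, $\omega=(\omega_1,\dots,\omega_n)\in\mathbb R^n$, $A=\operatorname{diag}(i\omega_1,\dots,i\omega_n)$ and $s>0$. Write $|z|=\max_j|z_j|$ on $\mathbb C^n$, $D_1=\{z\in\mathbb C^n:|z|<1\}$, and $|\alpha|=\sum_i|\alpha_i|$ for $\alpha\in\mathbb Z^n$. Let $F:D_1\to\mathbb C^n$ be analytic with $F(z)=Az+f(z)$, $f(0)=0$, $Df(0)=0$. Assume that $A$ is non-resonant, i.e. $\alpha\cdot\omega\ne\omega_j$ for all $\alpha\in\mathbb N^n$ with $|\alpha|\ge2$ and all $j$, and that at least one of the following two conditions holds. (i) (Bruno-$s$ condition) There is a strictly increasing sequence $(p_k)_{k\ge0}$ of positive integers such that $$\limsup_{|\alpha|\to\infty,\ \alpha\in\mathbb N^n}\Big(2\sum_{m=0}^{\kappa(\alpha)}\frac{\log\Omega(p_{m+1})^{-1}}{p_m}-s\log|\alpha|\Big)<+\infty,$$ where $p_{\kappa(\alpha)}\le|\alpha|<p_{\kappa(\alpha)+1}$ and $\Omega(p)=\min\{|\alpha\cdot\omega-\omega_j|:1\le j\le n,\ \alpha\in\mathbb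 Z^n,\ 0<|\alpha|<p,\ \alpha\cdot\omega\neq\omega_j\}$. (ii) $n=2$, the number $x=-\omega_1/\omega_2$ is irrational, and $$\limsup_{N\to\infty}\Big(\sum_{j=0}^{k(N)}\frac{\log q_{j+1}}{q_j}-s\log N\Big)<+\infty,$$ where $(q_j)_{j\ge0}$ are the denominators of the convergents of the continued fraction of $x$ and $q_{k(N)}\le N<q_{k(N)+1}$. Then for all sufficiently small $0<r_{**}<1$ there exist positive constants $A_{**},B_{**},C_{**}$ such that for every $z_0\in\mathbb C^n$ with $0<|z_0|<r_{**}/2$ the solution $z(t;z_0)$ of $\frac{dz}{dt}=F(z)$, $z(0;z_0)=z_0$, exists in $D_1$, is unique, and satisfies $|z(t;z_0)|\le C_{**}r_{**}$ for all real $t$ with $$|t|\le T_*=A_{**}^{-1}\exp\Big\{B_{**}\big(r_{**}/|z_0|\big)^{1/s}\Big\}.$$ -/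

import Mathlib

open Filter

/-- The open unit polydisk `D₁ = {z ∈ ℂⁿ : |z_i| < 1 for all i}`. -/
def unitPolydisk (n : ℕ) : Set (Fin n → ℂ) :=
  {z | ∀ i, ‖z i‖ < 1}

/-- `diag(iω)` is non-resonant: `α · ω ≠ ω_j` for all `α ∈ ℕⁿ` with `|α| ≥ 2` and all `j`. -/
def NonResonant {n : ℕ} (ω : Fin n → ℝ) : Prop :=
  ∀ α : Fin n → ℕ, 2 ≤ ∑ i, α i → ∀ j, ∑ i, (α i : ℝ) * ω i ≠ ω j

/-- The small divisor function
`Ω(p) = min {|α · ω - ω_j| : 1 ≤ j ≤ n, α ∈ ℤⁿ, 0 < |α| < p, α · ω ≠ ω_j}`, with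
`|α| = ∑ |α_i|`. Vanishing divisors (such as `α = e_j`) do not count. The set is finite, and for
`p ≥ 2` and non-resonant `ω` it contains `|-2 ω_j|` (from `α = -e_j`), so the infimum is a positive
minimum. -/
noncomputable def smallDivisor {n : ℕ} (ω : Fin n → ℝ) (p : ℕ) : ℝ :=
  sInf {x : ℝ | ∃ (j : Fin n) (α : Fin n → ℤ), 0 < ∑ i, |α i| ∧ ∑ i, |α i| < (p : ℤ) ∧
    ∑ i, (α i : ℝ) * ω i ≠ ω j ∧ x = |∑ i, (α i : ℝ) * ω i - ω j|}

/-- The largest index `k` with `p k ≤ N`. For a nondecreasing unbounded sequence `p` with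
`p 0 ≤ N` this is the index determined by `p k ≤ N < p (k + 1)`. -/
noncomputable def lastIndex (p : ℕ → ℝ) (N : ℕ) : ℕ :=
  sSup {k : ℕ | p k ≤ N}

/-- The Bruno-`s` condition for `ω ∈ ℝⁿ`: for some increasing sequence of positive integers `p`,
`limsup_{|α| → ∞} (2 ∑_{m=0}^{κ(α)} log Ω(p_{m+1})⁻¹ / p_m - s log |α|) < +∞`, where
`p_{κ(α)} ≤ |α| < p_{κ(α)+1}`. -/
def BrunoS {n : ℕ} (ω : Fin n → ℝ) (s : ℝ) : Prop :=
  ∃ p : ℕ → ℕ, StrictMono p ∧ (∀ k, 0 < p k) ∧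
    limsup (fun α : Fin n → ℕ =>
      ((2 * ∑ m ∈ Finset.range (lastIndex (fun k => (p k : ℝ)) (∑ i, α i) + 1),
            Real.log (smallDivisor ω (p (m + 1)))⁻¹ / (p m : ℝ)
          - s * Real.log ((∑ i, α i : ℕ) : ℝ) : ℝ) : EReal))
      (comap (fun α : Fin n → ℕ => ∑ i, α i) atTop) < ⊤

/-- The denominator `q_k` of the `k`-th convergent of the continued fraction of `x`
(`q_0 = 1`, `q_1 = a_1`, ...). -/
noncomputable def convDenom (x : ℝ) (k : ℕ) : ℝ :=
  (GenContFract.of x).dens k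

/-- The continued fraction version of the Bruno-`s` condition for an irrational number `x`:
`limsup_{N → ∞} (∑_{j=0}^{k(N)} log q_{j+1} / q_j - s log N) < +∞`, where
`q_{k(N)} ≤ N < q_{k(N)+1}`. -/
def BrunoSContFract (x : ℝ) (s : ℝ) : Prop :=
  Irrational x ∧
    limsup (fun N : ℕ =>
      ((∑ j ∈ Finset.range (lastIndex (convDenom x) N + 1),
            Real.log (convDenom x (j + 1)) / convDenom x j
          - s * Real.log (N : ℝ) : ℝ) : EReal)) atTop < ⊤

/-- `z` is a solution on the time interval `J` of `dz/dt = F(z)`, `z(0) = z₀`, with values in the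
domain `D₁` of `F`. -/
def IsSolutionOn {n : ℕ} (F : (Fin n → ℂ) → (Fin n → ℂ)) (z₀ : Fin n → ℂ) (J : Set ℝ)
    (z : ℝ → Fin n → ℂ) : Prop :=
  z 0 = z₀ ∧ ∀ t ∈ J, z t ∈ unitPolydisk n ∧ HasDerivWithinAt z (F (z t)) J t

/-! ### Packings and weights -/

/-! The idea is to linearize `F` up to a degree `N` depending on `‖z₀‖`, by a polynomial change of
variables that is near the identity on a ball of radius of order `N ^ (-s)`, and to follow the
linear flow, which preserves the norm coordinatewise. The remainder vanishes to order `N + 1` and is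
bounded, so by the Schwarz lemma it is of size `exp (-N)` well inside that ball. Taking `N` of order
`‖z₀‖ ^ (-1 / s)` then gives the exponential time.

The arithmetic enters only through a weight `M` on multi-indices (`IsGevreyWeight`) that is
supermultiplicative, gains the inverse divisor each time a multi-index is split into two nonzero
parts, and grows at most like `K ^ |α| * |α| ^ (s |α|)`. In the `ℓ¹` norm with weight `t ^ |α| / M
α`, solving the homological equation for a nonlinear term loses nothing: the splitting of a product
pays for the divisor. The fixed-point iteration for the linearization thus stays in a fixed ball
(`weightedNorm_linearizationIterate_le`), uniformly in `N`.

The weight is the exponential of a sum over scales of `log` (inverse divisor) times the value of an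
optimal packing of `α` by multi-indices whose divisor is small at that scale
(`exists_isGevreyWeight`). Optimal packings are superadditive; if a small-divisor index beats every
packing by other such indices by one, splitting it gains one unit. Everything reduces to valuing
these indices by at most `c` times their degree.

Under condition (i) nested small-divisor indices differ in degree by about `p`, and `2 * degree / p
- 1` is such a value (`smallSet_packing`); hence the factor `2`. Under condition (ii) the relevant
lattice points of moderate height are exact multiples of a convergent, and this rigidity reduces the
cost to `1 / q` plus a summable error (`nearLine_packing`).

The dynamics are in `exists_solution_of_normalForm`, and `exists_longTime_solution` chooses `N`. -/

/-- The total values of the packings of `α` by elements of `S`. -/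
def packingValues {σ : Type*} (S : Set (σ →₀ ℕ)) (φ : (σ →₀ ℕ) → ℝ) (α : σ →₀ ℕ) : Set ℝ :=
  {x | ∃ l : Multiset (σ →₀ ℕ), (∀ γ ∈ l, γ ∈ S) ∧ l.sum ≤ α ∧ x = (l.map φ).sum}

/-- The largest total value of a packing of `α` by elements of `S`. -/
noncomputable def packing {σ : Type*} (S : Set (σ →₀ ℕ)) (φ : (σ →₀ ℕ) → ℝ) (α : σ →₀ ℕ) : ℝ :=
  sSup (packingValues S φ α)

section Packing

variable {σ : Type*} {S : Set (σ →₀ ℕ)} {φ : (σ →₀ ℕ) → ℝ} {c : ℝ}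

theorem zero_mem_packingValues (α : σ →₀ ℕ) : (0 : ℝ) ∈ packingValues S φ α :=
  ⟨0, by simp, by simp, by simp⟩

theorem degree_mono_of_le {α β : σ →₀ ℕ} (h : α ≤ β) : α.degree ≤ β.degree := by
  obtain ⟨γ, rfl⟩ := le_iff_exists_add.1 h
  simp

theorem sum_map_le_degree (hφ : ∀ γ ∈ S, φ γ ≤ c * γ.degree) (l : Multiset (σ →₀ ℕ))
    (hl : ∀ γ ∈ l, γ ∈ S) : (l.map φ).sum ≤ c * (l.sum.degree : ℝ) := by
  induction l using Multiset.induction with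
  | empty => simp
  | cons a l ih =>
    have h1 := hφ a (hl a (by simp))
    have h2 := ih fun γ hγ => hl γ (by simp [hγ])
    simp only [Multiset.map_cons, Multiset.sum_cons, map_add, Nat.cast_add]
    linarith

theorem le_of_mem_packingValues (hc : 0 ≤ c) (hφ : ∀ γ ∈ S, φ γ ≤ c * γ.degree) (α : σ →₀ ℕ)
    {x : ℝ} (hx : x ∈ packingValues S φ α) : x ≤ c * α.degree := by
  obtain ⟨l, hl, hle, rfl⟩ := hx
  refine (sum_map_le_degree hφ l hl).trans ?_
  have := degree_mono_of_le hle
  gcongr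

theorem packing_le (hc : 0 ≤ c) (hφ : ∀ γ ∈ S, φ γ ≤ c * γ.degree) (α : σ →₀ ℕ) :
    packing S φ α ≤ c * α.degree :=
  csSup_le ⟨0, zero_mem_packingValues α⟩ fun _ hx => le_of_mem_packingValues hc hφ α hx

theorem le_packing (hc : 0 ≤ c) (hφ : ∀ γ ∈ S, φ γ ≤ c * γ.degree) (α : σ →₀ ℕ)
    {x : ℝ} (hx : x ∈ packingValues S φ α) : x ≤ packing S φ α :=
  le_csSup ⟨_, fun _ hx => le_of_mem_packingValues hc hφ α hx⟩ hx

theorem packing_add_le_of_forall {α β : σ →₀ ℕ} {y : ℝ}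
    (h : ∀ a ∈ packingValues S φ α, ∀ b ∈ packingValues S φ β, a + b ≤ y) :
    packing S φ α + packing S φ β ≤ y := by
  have h1 : ∀ a ∈ packingValues S φ α, packing S φ β ≤ y - a := fun a ha =>
    csSup_le ⟨0, zero_mem_packingValues β⟩ fun b hb => by linarith [h a ha b hb]
  have h2 : packing S φ α ≤ y - packing S φ β :=
    csSup_le ⟨0, zero_mem_packingValues α⟩ fun a ha => by linarith [h1 a ha]
  linarith

theorem packing_add_le (hc : 0 ≤ c) (hφ : ∀ γ ∈ S, φ γ ≤ c * γ.degree) (α β : σ →₀ ℕ) :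
    packing S φ α + packing S φ β ≤ packing S φ (α + β) := by
  refine packing_add_le_of_forall ?_
  rintro _ ⟨l, hl, hle, rfl⟩ _ ⟨l', hl', hle', rfl⟩
  refine le_packing hc hφ _ ⟨l + l', ?_, ?_, by simp⟩
  · intro γ hγ
    rcases Multiset.mem_add.1 hγ with h | h
    exacts [hl γ h, hl' γ h]
  · simpa using add_le_add hle hle'

/-- If `α` belongs to `S` and beats every packing of `α` by other elements of `S` by at least `1`,
then splitting `α` into two proper parts loses at least `1`. -/
theorem packing_add_succ_le (hc : 0 ≤ c) (hφ : ∀ γ ∈ S, φ γ ≤ c * γ.degree) {α β : σ →₀ ℕ}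
    (hα : α ≠ 0) (hβ : β ≠ 0) (hS : α + β ∈ S)
    (hpack : ∀ l : Multiset (σ →₀ ℕ), (∀ γ ∈ l, γ ∈ S ∧ γ ≠ α + β) → l.sum ≤ α + β →
      (l.map φ).sum + 1 ≤ φ (α + β)) :
    packing S φ α + packing S φ β + 1 ≤ packing S φ (α + β) := by
  have key : packing S φ α + packing S φ β ≤ φ (α + β) - 1 := by
    refine packing_add_le_of_forall ?_
    rintro _ ⟨l, hl, hle, rfl⟩ _ ⟨l', hl', hle', rfl⟩
    have := hpack (l + l') ?_ (by simpa using add_le_add hle hle')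
    · simp only [Multiset.map_add, Multiset.sum_add] at this
      linarith
    -- Neither half can contain `α + β` itself, because the other part is nonzero.
    · intro γ hγ
      rcases Multiset.mem_add.1 hγ with h | h
      · refine ⟨hl γ h, ?_⟩
        rintro rfl
        have h2 := (Multiset.single_le_sum (fun _ _ => zero_le) _ h).trans hle
        exact hβ (by simpa using h2)
      · refine ⟨hl' γ h, ?_⟩
        rintro rfl
        have h2 := (Multiset.single_le_sum (fun _ _ => zero_le) _ h).trans hle'
        exact hα (by simpa using h2)
  have h2 : φ (α + β) ≤ packing S φ (α + β) :=
    le_packing hc hφ _ ⟨{α + β}, by simpa using hS, by simp, by simp⟩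
  linarith

theorem packing_eq_zero {α : σ →₀ ℕ} (h : ∀ γ ∈ S, α.degree < γ.degree) :
    packing S φ α = 0 := by
  have : packingValues S φ α = {0} := by
    refine Set.Subset.antisymm ?_ (by simpa using zero_mem_packingValues α)
    rintro _ ⟨l, hl, hle, rfl⟩
    rcases Multiset.empty_or_exists_mem l with rfl | ⟨γ, hγ⟩
    · simp
    · have h2 := (Multiset.single_le_sum (fun _ _ => zero_le) _ hγ).trans hle
      exact absurd (degree_mono_of_le h2) (not_le.2 (h γ (hl γ hγ)))
  simp [packing, this]

end Packing

/-- `M` is a weight compensating the small divisors `1 / Δ` with at most `s`-Gevrey growth. -/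
structure IsGevreyWeight {σ : Type*} (Δ : (σ →₀ ℕ) → ℝ) (s : ℝ) (M : (σ →₀ ℕ) → ℝ) : Prop where
  pos : ∀ α, 0 < M α
  mul_le : ∀ α β, M α * M β ≤ M (α + β)
  divisor_mul_le : ∀ α β, α ≠ 0 → β ≠ 0 → Δ (α + β) * (M α * M β) ≤ M (α + β)
  growth : ∃ K : ℝ, 1 ≤ K ∧ ∀ α, α ≠ 0 →
    M α ≤ K ^ α.degree * (α.degree : ℝ) ^ (s * (α.degree : ℝ))

/-- Abstract form of the Siegel–Bruno counting argument. `S k` holds the indices whose divisor is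
small at scale `k`, `ℓ k` is the logarithmic cost of leaving that scale, and `c k` bounds the
packing density. The logarithm of the weight is a sum of `ℓ k` times packings, so superadditivity
gives `mul_le`, the unit gain on `S k` gives the divisor inequality, and the density gives the
growth. -/
theorem exists_isGevreyWeight {σ : Type*} {Δ : (σ →₀ ℕ) → ℝ} {s : ℝ}
    (S : ℕ → Set (σ →₀ ℕ)) (φ : ℕ → (σ →₀ ℕ) → ℝ) (ℓ c : ℕ → ℝ) (κ : ℕ → ℕ) (c₀ C : ℝ)
    (hc₀ : 0 ≤ c₀) (hℓ : ∀ k, 0 ≤ ℓ k) (hc : ∀ k, 0 ≤ c k) (hκ : Monotone κ)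
    (hΔpos : ∀ α, 2 ≤ α.degree → 0 < Δ α)
    (hφ : ∀ k, ∀ γ ∈ S k, φ k γ ≤ c k * γ.degree)
    (hpack : ∀ k, ∀ α ∈ S k, ∀ l : Multiset (σ →₀ ℕ), (∀ γ ∈ l, γ ∈ S k ∧ γ ≠ α) → l.sum ≤ α →
      (l.map (φ k)).sum + 1 ≤ φ k α)
    (hS : ∀ N k, κ N ≤ k → ∀ γ ∈ S k, N < γ.degree)
    (hΔ0 : ∀ α, 2 ≤ α.degree → α ∉ S 0 → Real.log (Δ α) ≤ c₀)
    (hΔ : ∀ k α, 2 ≤ α.degree → α ∉ S (k + 1) → Real.log (Δ α) ≤ c₀ + ℓ k)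
    (hgrow : ∀ N : ℕ, 1 ≤ N → ∑ k ∈ Finset.range (κ N), ℓ k * c k ≤ s * Real.log N + C) :
    ∃ M, IsGevreyWeight Δ s M := by
  set g : ℕ → (σ →₀ ℕ) → ℝ := fun k => packing (S k) (φ k) with hg
  have g0 : ∀ k α, κ α.degree ≤ k → g k α = 0 := fun k α h =>
    packing_eq_zero fun γ hγ => hS _ _ h γ hγ
  have gadd : ∀ k α β, g k α + g k β ≤ g k (α + β) := fun k => packing_add_le (hc k) (hφ k)
  set G : (σ →₀ ℕ) → ℝ := fun α => ∑ k ∈ Finset.range (κ α.degree), ℓ k * g k α with hG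
  have hGext : ∀ α m, κ α.degree ≤ m → G α = ∑ k ∈ Finset.range m, ℓ k * g k α := by
    intro α m hm
    refine Finset.sum_subset (by simpa using hm) ?_
    intro k _ hk
    rw [g0 k α (by simpa using hk), mul_zero]
  have hGsplit : ∀ α β, G α + G β =
      ∑ k ∈ Finset.range (κ (α + β).degree), ℓ k * (g k α + g k β) := by
    intro α β
    rw [hGext α (κ (α + β).degree) (hκ (by simp)), hGext β (κ (α + β).degree) (hκ (by simp)),
      ← Finset.sum_add_distrib]
    simp only [mul_add]
  have hGadd : ∀ α β, G α + G β ≤ G (α + β) := by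
    intro α β
    rw [hGsplit]
    exact Finset.sum_le_sum fun k _ => mul_le_mul_of_nonneg_left (gadd k α β) (hℓ k)
  have hGsucc : ∀ α β, α ≠ 0 → β ≠ 0 → ∀ k, α + β ∈ S k → ℓ k + (G α + G β) ≤ G (α + β) := by
    intro α β hα hβ k hk
    have hkmem : k ∈ Finset.range (κ (α + β).degree) := by
      rw [Finset.mem_range]
      by_contra h
      exact lt_irrefl _ (hS _ k (not_lt.1 h) _ hk)
    rw [hGsplit]
    simp only [hG]
    rw [← Finset.add_sum_erase _ _ hkmem, ← Finset.add_sum_erase _ _ hkmem, ← add_assoc]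
    refine add_le_add ?_
      (Finset.sum_le_sum fun k _ => mul_le_mul_of_nonneg_left (gadd k α β) (hℓ k))
    have := packing_add_succ_le (hc k) (hφ k) hα hβ hk (hpack k _ hk)
    have h2 := mul_le_mul_of_nonneg_left this (hℓ k)
    simp only [hg]
    linarith
  have hdeg : ∀ α : σ →₀ ℕ, α ≠ 0 → 1 ≤ α.degree := fun α h =>
    Nat.one_le_iff_ne_zero.2 (by rwa [Ne, Finsupp.degree_eq_zero_iff])
  -- The `- 1` makes each splitting gain one extra `c₀`, which pays for the part of the divisor
  -- common to all scales.
  refine ⟨fun α => Real.exp (c₀ * ((α.degree : ℝ) - 1) + G α), fun α => Real.exp_pos _, ?_, ?_, ?_⟩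
  · intro α β
    rw [← Real.exp_add]
    refine Real.exp_le_exp.2 ?_
    have := hGadd α β
    simp only [map_add, Nat.cast_add]
    linarith
  · intro α β hα hβ
    have h2 : 2 ≤ (α + β).degree := by
      have := hdeg α hα
      have := hdeg β hβ
      simp only [map_add]
      omega
    rw [← Real.exp_add, ← Real.exp_log (hΔpos _ h2), ← Real.exp_add]
    refine Real.exp_le_exp.2 ?_
    -- Only the first scale that misses `α + β` matters: its index bounds the divisor, and
    -- membership at the preceding scale supplies the gain `ℓ k`.
    have hex : ∃ k, α + β ∉ S k :=
      ⟨κ (α + β).degree, fun h => lt_irrefl _ (hS _ _ le_rfl _ h)⟩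
    classical
    have hfind := Nat.find_spec hex
    have key : Real.log (Δ (α + β)) + (G α + G β) ≤ c₀ + G (α + β) := by
      rcases hk : Nat.find hex with _ | k
      · rw [hk] at hfind
        linarith [hΔ0 _ h2 hfind, hGadd α β]
      · rw [hk] at hfind
        have hmem : α + β ∈ S k := by
          by_contra h
          have := Nat.find_min' hex h
          omega
        linarith [hΔ k _ h2 hfind, hGsucc α β hα hβ k hmem]
    simp only [map_add, Nat.cast_add] at *
    linarith
  · refine ⟨Real.exp (c₀ + |C|), Real.one_le_exp (by positivity), fun α hα => ?_⟩
    have hd := hdeg α hα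
    have hd' : (0 : ℝ) < α.degree := by exact_mod_cast hd
    rw [← Real.exp_nat_mul, Real.rpow_def_of_pos hd', ← Real.exp_add]
    refine Real.exp_le_exp.2 ?_
    have h1 : G α ≤ (∑ k ∈ Finset.range (κ α.degree), ℓ k * c k) * α.degree := by
      rw [Finset.sum_mul]
      refine Finset.sum_le_sum fun k _ => ?_
      rw [mul_assoc]
      exact mul_le_mul_of_nonneg_left (packing_le (hc k) (hφ k) α) (hℓ k)
    have h2 := mul_le_mul_of_nonneg_right (hgrow _ hd) hd'.le
    have h3 : C * α.degree ≤ |C| * α.degree := by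
      gcongr
      exact le_abs_self C
    nlinarith

/-! ### Small divisors and the growth conditions -/

/-- The divisor `α · ω - ω_j`. -/
noncomputable def divisor {n : ℕ} (ω : Fin n → ℝ) (α : Fin n →₀ ℕ) (j : Fin n) : ℝ :=
  ∑ i, (α i : ℝ) * ω i - ω j

/-- The largest inverse divisor `1 / |α · ω - ω_j|`. -/
noncomputable def invDivisor {n : ℕ} (ω : Fin n → ℝ) (α : Fin n →₀ ℕ) : ℝ :=
  ⨆ j, |divisor ω α j|⁻¹

theorem NonResonant.divisor_ne_zero {n : ℕ} {ω : Fin n → ℝ} (hω : NonResonant ω) {α : Fin n →₀ ℕ}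
    (hα : 2 ≤ α.degree) (j : Fin n) : divisor ω α j ≠ 0 := by
  rw [Finsupp.degree_eq_sum] at hα
  exact sub_ne_zero.2 (hω _ hα j)

theorem NonResonant.ne_zero {n : ℕ} {ω : Fin n → ℝ} (hω : NonResonant ω) (j : Fin n) :
    ω j ≠ 0 := by
  intro h
  refine hω (Pi.single j 2) (by simp) j ?_
  rw [Finset.sum_eq_single j]
  · simp [h]
  · intro i _ hi
    simp [hi]
  · simp

theorem inv_abs_divisor_le {n : ℕ} (ω : Fin n → ℝ) (α : Fin n →₀ ℕ) (j : Fin n) :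
    |divisor ω α j|⁻¹ ≤ invDivisor ω α :=
  le_ciSup (f := fun j => |divisor ω α j|⁻¹) (Set.finite_range _).bddAbove j

theorem NonResonant.invDivisor_pos {n : ℕ} [NeZero n] {ω : Fin n → ℝ} (hω : NonResonant ω)
    {α : Fin n →₀ ℕ} (hα : 2 ≤ α.degree) : 0 < invDivisor ω α :=
  (inv_pos.2 (abs_pos.2 (hω.divisor_ne_zero hα 0))).trans_le (inv_abs_divisor_le ω α 0)

theorem NonResonant.log_invDivisor_le {n : ℕ} [NeZero n] {ω : Fin n → ℝ} (hω : NonResonant ω)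
    {α : Fin n →₀ ℕ} (hα : 2 ≤ α.degree) {c : ℝ} (h : ∀ j, Real.exp (-c) ≤ |divisor ω α j|) :
    Real.log (invDivisor ω α) ≤ c := by
  rw [Real.log_le_iff_le_exp (hω.invDivisor_pos hα)]
  refine ciSup_le fun j => ?_
  rw [inv_le_comm₀ ((Real.exp_pos _).trans_le (h j)) (Real.exp_pos _), ← Real.exp_neg]
  exact h j

theorem le_lastIndex {p : ℕ → ℝ} {N : ℕ} (hp : {k : ℕ | p k ≤ N}.Finite) {k : ℕ} (hk : p k ≤ N) :
    k ≤ lastIndex p N :=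
  le_csSup hp.bddAbove hk

theorem lastIndex_mono {p : ℕ → ℝ} (hp : ∀ N : ℕ, {k : ℕ | p k ≤ N}.Finite) :
    Monotone (lastIndex p) := by
  intro N N' h
  rcases Set.eq_empty_or_nonempty {k : ℕ | p k ≤ N} with he | hne
  · simp [lastIndex, he]
  · refine csSup_le hne fun k hk => le_lastIndex (hp N') (le_trans hk ?_)
    exact_mod_cast h

theorem exists_eventually_le_of_limsup_lt_top {ι : Type*} {l : Filter ι} {u : ι → ℝ}
    (h : limsup (fun i => (u i : EReal)) l < ⊤) : ∃ C : ℝ, ∀ᶠ i in l, u i ≤ C := by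
  obtain ⟨C, hC, -⟩ := EReal.lt_iff_exists_real_btwn.1 h
  refine ⟨C, (eventually_lt_of_limsup_lt hC).mono fun i hi => ?_⟩
  exact_mod_cast hi.le

/-- The partial sums have nonnegative terms and increase with `N`, so one late value bounds all
earlier ones. -/
theorem exists_forall_sum_le {p x : ℕ → ℝ} {s C : ℝ} (hs : 0 ≤ s)
    (hp : ∀ N : ℕ, {k : ℕ | p k ≤ N}.Finite) (hx : ∀ k, 0 ≤ x k)
    (h : ∀ᶠ N : ℕ in atTop,
      ∑ k ∈ Finset.range (lastIndex p N + 1), x k ≤ s * Real.log N + C) :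
    ∃ C', ∀ N : ℕ, 1 ≤ N →
      ∑ k ∈ Finset.range (lastIndex p N + 1), x k ≤ s * Real.log N + C' := by
  obtain ⟨N₀, hN₀⟩ := eventually_atTop.1 h
  have hlog : ∀ N : ℕ, 1 ≤ N → 0 ≤ s * Real.log N := fun N hN =>
    mul_nonneg hs (Real.log_nonneg (by exact_mod_cast hN))
  have hlog' := hlog (N₀ + 1) (by omega)
  refine ⟨C + s * Real.log (N₀ + 1 : ℕ), fun N hN => ?_⟩
  rcases le_total (N₀ + 1) N with h1 | h1
  · linarith [hN₀ N (by omega)]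
  · have h2 : ∑ k ∈ Finset.range (lastIndex p N + 1), x k ≤
        ∑ k ∈ Finset.range (lastIndex p (N₀ + 1) + 1), x k := by
      refine Finset.sum_le_sum_of_subset_of_nonneg ?_ fun k _ _ => hx k
      have := lastIndex_mono hp h1
      simpa using this
    linarith [hN₀ (N₀ + 1) (by omega), hlog N hN]

/-- The logarithms in the Bruno sum are negative while the small divisors exceed `1`, but packing
costs must be nonnegative. Positive parts change the sum by a bounded amount when only finitely many
terms are negative, and vanish when no term is positive. -/
theorem exists_sum_max_zero_le {x : ℕ → ℝ} (hx : (∀ k, x k ≤ 0) ∨ ∃ k₀, ∀ k, k₀ ≤ k → 0 ≤ x k) :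
    ∃ C, 0 ≤ C ∧ ∀ m, ∑ k ∈ Finset.range m, max 0 (x k) ≤
      max 0 (∑ k ∈ Finset.range m, x k + C) := by
  rcases hx with hx | ⟨k₀, hk₀⟩
  · exact ⟨0, le_rfl, fun m => by simp [hx]⟩
  · refine ⟨∑ k ∈ Finset.range k₀, |x k|, by positivity, fun m => le_max_of_le_right ?_⟩
    have h1 : ∑ k ∈ Finset.range m, (max 0 (x k) - x k) ≤ ∑ k ∈ Finset.range k₀, |x k| := by
      calc ∑ k ∈ Finset.range m, (max 0 (x k) - x k)
          ≤ ∑ k ∈ Finset.range m, if k ∈ Finset.range k₀ then |x k| else 0 := by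
            refine Finset.sum_le_sum fun k _ => ?_
            split_ifs with h
            · rcases le_total 0 (x k) with h' | h'
              · simp [h']
              · simp [h', abs_of_nonpos h']
            · simp [hk₀ k (by simpa using h)]
        _ ≤ ∑ k ∈ Finset.range k₀, |x k| := by
            rw [← Finset.sum_filter]
            refine Finset.sum_le_sum_of_subset_of_nonneg ?_ fun k _ _ => abs_nonneg _
            intro k hk
            exact (Finset.mem_filter.1 hk).2
    rw [Finset.sum_sub_distrib] at h1
    linarith

/-! ### The weight of the Bruno condition in `ℂⁿ` -/

theorem smallDivisor_le {n : ℕ} (ω : Fin n → ℝ) (p : ℕ) (j : Fin n) (α : Fin n → ℤ)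
    (h0 : 0 < ∑ i, |α i|) (hp : ∑ i, |α i| < (p : ℤ)) (hne : ∑ i, (α i : ℝ) * ω i ≠ ω j) :
    smallDivisor ω p ≤ |∑ i, (α i : ℝ) * ω i - ω j| := by
  refine csInf_le ⟨0, ?_⟩ ⟨j, α, h0, hp, hne, rfl⟩
  rintro x ⟨j, α, -, -, -, rfl⟩
  positivity

theorem smallDivisor_pos {n : ℕ} [NeZero n] {ω : Fin n → ℝ} (hω : NonResonant ω) {p : ℕ}
    (hp : 2 ≤ p) : 0 < smallDivisor ω p := by
  set X := {x : ℝ | ∃ (j : Fin n) (α : Fin n → ℤ), 0 < ∑ i, |α i| ∧ ∑ i, |α i| < (p : ℤ) ∧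
    ∑ i, (α i : ℝ) * ω i ≠ ω j ∧ x = |∑ i, (α i : ℝ) * ω i - ω j|} with hX
  have hfin : X.Finite := by
    have hbox : (Set.univ ×ˢ Set.Icc (fun _ : Fin n => -(p : ℤ)) (fun _ => (p : ℤ)) :
        Set (Fin n × (Fin n → ℤ))).Finite := Set.finite_univ.prod (Set.finite_Icc _ _)
    refine (hbox.image fun q : Fin n × (Fin n → ℤ) =>
      |∑ i, (q.2 i : ℝ) * ω i - ω q.1|).subset ?_
    rintro x ⟨j, α, -, h2, -, rfl⟩
    refine ⟨(j, α), ⟨trivial, ?_⟩, rfl⟩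
    have hb : ∀ i, |α i| ≤ p := fun i =>
      (Finset.single_le_sum (f := fun i => |α i|) (fun i _ => abs_nonneg (α i))
        (Finset.mem_univ i)).trans h2.le
    exact ⟨fun i => (abs_le.1 (hb i)).1, fun i => (abs_le.1 (hb i)).2⟩
  have hne : X.Nonempty := by
    refine ⟨_, 0, -Pi.single 0 1, ?_, ?_, ?_, rfl⟩
    · rw [Finset.sum_eq_single 0] <;> simp +contextual
    · rw [Finset.sum_eq_single 0]
      · simp only [Pi.neg_apply, Pi.single_eq_same, abs_neg, abs_one]
        exact_mod_cast hp
      · simp +contextual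
      · simp
    · rw [Finset.sum_eq_single 0]
      · have h0 := hω.ne_zero 0
        simp only [Pi.neg_apply, Pi.single_eq_same]
        intro h
        apply h0
        push_cast at h
        linarith
      · simp +contextual
      · simp
  obtain ⟨j, α, -, -, h3, h4⟩ := hne.csInf_mem hfin
  change 0 < sInf X
  rw [h4]
  exact abs_pos.2 (sub_ne_zero.2 h3)

theorem smallDivisor_anti {n : ℕ} [NeZero n] {ω : Fin n → ℝ} (hω : NonResonant ω) {p q : ℕ}
    (hp : 2 ≤ p) (hpq : p ≤ q) : smallDivisor ω q ≤ smallDivisor ω p := by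
  refine le_csInf ?_ ?_
  · by_contra h
    rw [Set.not_nonempty_iff_eq_empty] at h
    have := smallDivisor_pos hω hp
    rw [smallDivisor, h] at this
    simp at this
  · rintro x ⟨j, α, h1, h2, h3, rfl⟩
    exact smallDivisor_le ω q j α h1 (h2.trans_le (by exact_mod_cast hpq)) h3

/-- The multi-indices with a divisor below a quarter of `Ω(p)`. -/
def smallSet {n : ℕ} (ω : Fin n → ℝ) (p : ℕ) : Set (Fin n →₀ ℕ) :=
  {α | 2 ≤ α.degree ∧ ∃ j, |divisor ω α j| < smallDivisor ω p / 4}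

theorem le_degree_of_mem_smallSet {n : ℕ} {ω : Fin n → ℝ} (hω : NonResonant ω) {p : ℕ}
    [NeZero n] (hp : 2 ≤ p) {α : Fin n →₀ ℕ} (hα : α ∈ smallSet ω p) : p ≤ α.degree := by
  obtain ⟨h2, j, hj⟩ := hα
  by_contra h
  have hs : ∑ i, |((α i : ℕ) : ℤ)| = (α.degree : ℤ) := by
    rw [Finsupp.degree_eq_sum]
    simp
  have := smallDivisor_le ω p j (fun i => (α i : ℤ)) (by rw [hs]; omega) (by rw [hs]; omega)
    (by simpa [divisor, sub_eq_zero] using hω.divisor_ne_zero h2 j)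
  have h3 := smallDivisor_pos hω hp
  simp only [divisor, Int.cast_natCast] at *
  linarith

/-- The difference of the two small divisors is the divisor of `α - β + e_i`, a nonzero number below
`Ω(p)`; hence that index has degree at least `p`. -/
theorem degree_gap_of_mem_smallSet {n : ℕ} {ω : Fin n → ℝ} (hω : NonResonant ω) {p : ℕ}
    [NeZero n] (hp : 2 ≤ p) {α β : Fin n →₀ ℕ} (hα : α ∈ smallSet ω p) (hβ : β ∈ smallSet ω p)
    (hle : β ≤ α) (hne : β ≠ α) : p ≤ α.degree - β.degree + 1 := by
  obtain ⟨γ, rfl⟩ := le_iff_exists_add.1 hle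
  have hγ : 1 ≤ γ.degree := by
    refine Nat.one_le_iff_ne_zero.2 ?_
    rw [Ne, Finsupp.degree_eq_zero_iff]
    rintro rfl
    simp at hne
  obtain ⟨h2, j, hj⟩ := hα
  obtain ⟨h2', i, hi⟩ := hβ
  by_contra h
  set δ : Fin n →₀ ℕ := γ + Finsupp.single i 1 with hδ
  have hdeg : δ.degree = γ.degree + 1 := by simp [hδ]
  have hdeg2 : δ.degree < p := by
    simp only [map_add] at h
    omega
  have hs : ∑ i, |((δ i : ℕ) : ℤ)| = (δ.degree : ℤ) := by
    rw [Finsupp.degree_eq_sum]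
    simp
  have hd2 : 2 ≤ δ.degree := by omega
  have h3 := smallDivisor_le ω p j (fun i => (δ i : ℤ)) (by rw [hs]; omega) (by rw [hs]; omega)
    (by simpa [divisor, sub_eq_zero] using hω.divisor_ne_zero hd2 j)
  have h4 := smallDivisor_pos hω hp
  have h5 : ∑ k, (((δ k : ℕ) : ℤ) : ℝ) * ω k - ω j = divisor ω (β + γ) j - divisor ω β i := by
    simp only [divisor, hδ, Finsupp.add_apply, Nat.cast_add, add_mul, Finset.sum_add_distrib,
      Int.cast_natCast, Int.cast_add]
    rw [show ∑ x, ((Finsupp.single i 1 : Fin n →₀ ℕ) x : ℝ) * ω x = ω i by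
      rw [Finset.sum_eq_single i] <;> simp +contextual [eq_comm]]
    ring
  rw [h5] at h3
  have h6 := abs_sub (divisor ω (β + γ) j) (divisor ω β i)
  linarith

/-- The number of summands decides. With none, `|α| ≥ p` suffices; with one, the degree gap is at
least `p - 1 ≥ p / 2`; with two or more, the subtracted ones already give the gain. -/
theorem smallSet_packing {n : ℕ} {ω : Fin n → ℝ} (hω : NonResonant ω) {p : ℕ}
    [NeZero n] (hp : 2 ≤ p) {α : Fin n →₀ ℕ} (hα : α ∈ smallSet ω p)
    (l : Multiset (Fin n →₀ ℕ)) (hl : ∀ γ ∈ l, γ ∈ smallSet ω p ∧ γ ≠ α) (hle : l.sum ≤ α) :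
    (l.map fun γ => 2 * (γ.degree : ℝ) / p - 1).sum + 1 ≤ 2 * (α.degree : ℝ) / p - 1 := by
  have hp0 : (0 : ℝ) < p := by positivity
  have hsum : ∀ l : Multiset (Fin n →₀ ℕ), (l.map fun γ => 2 * (γ.degree : ℝ) / p - 1).sum =
      2 * (l.sum.degree : ℝ) / p - Multiset.card l := by
    intro l
    induction l using Multiset.induction with
    | empty => simp
    | cons a l ih =>
      simp only [Multiset.map_cons, Multiset.sum_cons, map_add, Nat.cast_add, Multiset.card_cons,
        ih, Nat.cast_one]
      ring
  have hdeg : (l.sum.degree : ℝ) ≤ α.degree := by exact_mod_cast degree_mono_of_le hle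
  rw [hsum]
  rcases hcard : Multiset.card l with _ | _ | m
  · rw [Multiset.card_eq_zero] at hcard
    subst hcard
    have h1 : (p : ℝ) ≤ α.degree := by exact_mod_cast le_degree_of_mem_smallSet hω hp hα
    have h2 : 2 ≤ 2 * (α.degree : ℝ) / p := by
      rw [le_div_iff₀ hp0]
      linarith
    simp only [Multiset.sum_zero, map_zero, Nat.cast_zero, mul_zero, zero_div]
    linarith
  · obtain ⟨γ, rfl⟩ := Multiset.card_eq_one.1 hcard
    obtain ⟨hγ, hne⟩ := hl γ (by simp)
    have hle' : γ ≤ α := by simpa using hle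
    have h1 := degree_gap_of_mem_smallSet hω hp hα hγ hle' hne
    have h2 := degree_mono_of_le hle'
    have h3 : p + 2 * γ.degree ≤ 2 * α.degree := by omega
    have h4 : (p : ℝ) + 2 * γ.degree ≤ 2 * α.degree := by exact_mod_cast h3
    have h5 : 1 + 2 * (γ.degree : ℝ) / p ≤ 2 * (α.degree : ℝ) / p := by
      rw [le_div_iff₀ hp0, add_mul, div_mul_cancel₀ _ hp0.ne']
      linarith
    simp only [Multiset.sum_singleton]
    push_cast
    linarith
  · have h1 : 2 * (l.sum.degree : ℝ) / p ≤ 2 * (α.degree : ℝ) / p := by gcongr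
    push_cast
    have : (0 : ℝ) ≤ m := by positivity
    linarith

theorem BrunoS.exists_isGevreyWeight {n : ℕ} [NeZero n] {ω : Fin n → ℝ} {s : ℝ} (hs : 0 < s)
    (hω : NonResonant ω) (h : BrunoS ω s) : ∃ M, IsGevreyWeight (invDivisor ω) s M := by
  obtain ⟨p, hmono, hpos, hlim⟩ := h
  have hp2 : ∀ k, 2 ≤ p (k + 1) := fun k => by
    have := hmono (Nat.succ_pos k)
    have := hpos 0
    simp only [Nat.succ_eq_add_one] at *
    omega
  have hfin : ∀ N : ℕ, {k : ℕ | (p k : ℝ) ≤ N}.Finite := by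
    intro N
    refine (Set.finite_Iic N).subset fun k hk => ?_
    have h1 : p k ≤ N := by exact_mod_cast (hk : (p k : ℝ) ≤ N)
    exact (hmono.id_le k).trans h1
  set L : ℕ → ℝ := fun m => Real.log (smallDivisor ω (p (m + 1)))⁻¹ with hL
  have hLmono : Monotone L := by
    refine monotone_nat_of_le_succ fun m => ?_
    simp only [hL, Real.log_inv, neg_le_neg_iff]
    exact Real.log_le_log (smallDivisor_pos hω (hp2 _))
      (smallDivisor_anti hω (hp2 _) (hmono.monotone (by omega)))
  obtain ⟨C₁, hC₁⟩ := exists_eventually_le_of_limsup_lt_top hlim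
  have hC₁' : ∀ᶠ N : ℕ in atTop, ∑ m ∈ Finset.range (lastIndex (fun k => (p k : ℝ)) N + 1),
      2 * L m / p m ≤ s * Real.log N + C₁ := by
    obtain ⟨t, ht, hsub⟩ := Filter.mem_comap.1 hC₁
    filter_upwards [ht] with N hN
    -- The expression depends on `α` only through `|α|`, so one multi-index per degree recovers the
    -- bound in `N`.
    have hmem : (Pi.single 0 N : Fin n → ℕ) ∈ (fun α : Fin n → ℕ => ∑ i, α i) ⁻¹' t := by
      simpa using hN
    have := hsub hmem
    simp only [Set.mem_ofPred_eq, Finset.sum_pi_single', Finset.mem_univ, if_true] at this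
    rw [Finset.mul_sum] at this
    simp only [hL]
    calc _ = ∑ i ∈ Finset.range (lastIndex (fun k => (p k : ℝ)) N + 1),
          2 * (Real.log (smallDivisor ω (p (i + 1)))⁻¹ / (p i : ℝ)) :=
          Finset.sum_congr rfl fun i _ => by ring
      _ ≤ _ := by linarith
  -- `L` is monotone, so it changes sign at most once.
  have hsign : (∀ k, 2 * L k / p k ≤ 0) ∨ ∃ k₀, ∀ k, k₀ ≤ k → 0 ≤ 2 * L k / (p k : ℝ) := by
    by_cases hc : ∃ k₀, 0 ≤ L k₀
    · obtain ⟨k₀, hk₀⟩ := hc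
      refine Or.inr ⟨k₀, fun k hk => ?_⟩
      have := hk₀.trans (hLmono hk)
      positivity
    · push Not at hc
      refine Or.inl fun k => div_nonpos_of_nonpos_of_nonneg ?_ (by positivity)
      linarith [hc k]
  obtain ⟨C₂, hC₂0, hC₂⟩ := exists_sum_max_zero_le hsign
  have hev : ∀ᶠ N : ℕ in atTop, ∑ m ∈ Finset.range (lastIndex (fun k => (p k : ℝ)) N + 1),
      max 0 (2 * L m / p m) ≤ s * Real.log N + (|C₁| + C₂) := by
    filter_upwards [hC₁', eventually_ge_atTop 1] with N hN hN1
    refine (hC₂ _).trans (max_le ?_ ?_)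
    · have : 0 ≤ Real.log (N : ℝ) := Real.log_nonneg (by exact_mod_cast hN1)
      positivity
    · linarith [le_abs_self C₁]
  obtain ⟨C, hC⟩ := exists_forall_sum_le hs.le hfin (fun k => le_max_left _ _) hev
  have hdiv : ∀ k α, 2 ≤ α.degree → α ∉ smallSet ω (p (k + 1)) →
      Real.log (invDivisor ω α) ≤ Real.log 4 + max 0 (L k) := by
    intro k α hα hmem
    refine hω.log_invDivisor_le hα fun j => ?_
    simp only [smallSet, Set.mem_ofPred_eq, not_and, not_exists, not_lt] at hmem
    refine le_trans ?_ (hmem hα j)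
    have h1 := smallDivisor_pos hω (hp2 k)
    rw [neg_add, Real.exp_add, Real.exp_neg (Real.log 4), Real.exp_log (by norm_num)]
    have : Real.exp (-max 0 (L k)) ≤ smallDivisor ω (p (k + 1)) := by
      rw [← Real.le_log_iff_exp_le h1]
      have := le_max_right 0 (L k)
      simp only [hL, Real.log_inv] at this ⊢
      linarith
    linarith
  -- Scales start at `p 1`, which is at least `2`, whereas `p 0` may be `1`. The term `m = 0` of the
  -- Bruno sum is absorbed in `c₀`, and scale `k` corresponds to the term `m = k + 1`.
  refine _root_.exists_isGevreyWeight (fun k => smallSet ω (p (k + 1)))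
    (fun k γ => 2 * (γ.degree : ℝ) / (p (k + 1) : ℕ) - 1) (fun k => max 0 (L (k + 1)))
    (fun k => 2 / (p (k + 1) : ℝ)) (lastIndex fun k => (p k : ℝ)) (Real.log 4 + max 0 (L 0)) C
    ?_ (fun k => le_max_left _ _) (fun k => by positivity) (lastIndex_mono hfin)
    (fun α hα => hω.invDivisor_pos hα) ?_ ?_ ?_ (fun α hα hmem => hdiv 0 α hα hmem) ?_ ?_
  · have := Real.log_nonneg (show (1 : ℝ) ≤ 4 by norm_num)
    positivity
  · intro k γ _
    have : 2 * (γ.degree : ℝ) / (p (k + 1) : ℕ) = 2 / (p (k + 1) : ℝ) * γ.degree := by ring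
    linarith
  · intro k α hα l hl hle
    exact smallSet_packing hω (hp2 k) hα l hl hle
  · intro N k hk γ hγ
    have h1 := le_degree_of_mem_smallSet hω (hp2 k) hγ
    by_contra h
    have h2 : (p (k + 1) : ℝ) ≤ N := by
      have : p (k + 1) ≤ N := by omega
      exact_mod_cast this
    have := le_lastIndex (p := fun k => (p k : ℝ)) (hfin N) h2
    omega
  · intro k α hα hmem
    have := hdiv (k + 1) α hα hmem
    have h0 := le_max_left 0 (L 0)
    linarith
  · intro N hN
    refine le_trans ?_ (hC N hN)
    rw [Finset.sum_range_succ']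
    have h0 : 0 ≤ max 0 (2 * L 0 / (p 0 : ℝ)) := le_max_left _ _
    refine le_add_of_le_of_nonneg (Finset.sum_le_sum fun k _ => ?_) h0
    rw [max_mul_of_nonneg _ _ (by positivity)]
    refine max_le_max (by simp) (le_of_eq (by ring))

/-! ### Continued fractions -/

/-- The properties of the numerators `P` and denominators `Q` of the convergents of an irrational
number that are used for the small divisors. -/
structure IsConvergentSeq (x : ℝ) (P Q : ℕ → ℤ) : Prop where
  one_le : ∀ k, 1 ≤ Q k
  mono : ∀ k, Q k ≤ Q (k + 1)
  add_le : ∀ k, Q k + Q (k + 1) ≤ Q (k + 2)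
  det : ∀ k, P k * Q (k + 1) - Q k * P (k + 1) = (-1) ^ (k + 1)
  sign : ∀ k, 0 < (-1) ^ k * (Q k * x - P k)

theorem Irrational.exists_isConvergentSeq {x : ℝ} (hx : Irrational x) :
    ∃ P Q : ℕ → ℤ, IsConvergentSeq x P Q ∧ ∀ k, convDenom x k = Q k := by
  set g := GenContFract.of x with hg
  have hterm : ∀ k, ¬ g.TerminatedAt k := by
    intro k hk
    obtain ⟨q, hq⟩ := (GenContFract.terminates_iff_rat x).1 ⟨k, hk⟩
    exact hx ⟨q, hq.symm⟩
  have hs : ∀ k, ∃ b : ℤ, 1 ≤ b ∧ g.s.get? k = some ⟨1, b⟩ := by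
    intro k
    obtain ⟨gp, hgp⟩ := Option.ne_none_iff_exists'.1 (hterm k)
    obtain ⟨h1, b, hb⟩ := GenContFract.of_partNum_eq_one_and_exists_int_partDen_eq hgp
    have h2 := GenContFract.of_one_le_get?_partDen (GenContFract.partDen_eq_s_b hgp)
    refine ⟨b, ?_, ?_⟩
    · rw [hb] at h2
      exact_mod_cast h2
    · rw [hgp, ← h1, ← hb]
  choose b hb1 hbs using hs
  have hden : ∀ k, g.dens (k + 2) = b (k + 1) * g.dens (k + 1) + g.dens k := fun k => by
    simpa using GenContFract.dens_recurrence (hbs (k + 1)) rfl rfl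
  have hnum : ∀ k, g.nums (k + 2) = b (k + 1) * g.nums (k + 1) + g.nums k := fun k => by
    simpa using GenContFract.nums_recurrence (hbs (k + 1)) rfl rfl
  have hint : ∀ k, (∃ p q : ℤ, g.nums k = p ∧ g.dens k = q) ∧
      ∃ p q : ℤ, g.nums (k + 1) = p ∧ g.dens (k + 1) = q := by
    intro k
    induction k with
    | zero =>
      refine ⟨⟨⌊x⌋, 1, ?_, by simp⟩, ⟨b 0 * ⌊x⌋ + 1, b 0, ?_, ?_⟩⟩
      · rw [GenContFract.zeroth_num_eq_h, hg, GenContFract.of_h_eq_floor]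
      · rw [zero_add, GenContFract.first_num_eq (hbs 0), hg, GenContFract.of_h_eq_floor]
        simp
      · rw [zero_add, GenContFract.first_den_eq (hbs 0)]
    | succ k ih =>
      refine ⟨ih.2, ?_⟩
      obtain ⟨⟨p, q, hp, hq⟩, p', q', hp', hq'⟩ := ih
      refine ⟨b (k + 1) * p' + p, b (k + 1) * q' + q, ?_, ?_⟩
      · rw [hnum, hp, hp']
        push_cast
        rfl
      · rw [hden, hq, hq']
        push_cast
        rfl
  choose P Q hP hQ using fun k => (hint k).1
  have hQ1 : ∀ k, 1 ≤ Q k := by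
    intro k
    have h1 := GenContFract.succ_nth_fib_le_of_nth_den (v := x) (n := k) (Or.inr (hterm _))
    have h2 : (1 : ℝ) ≤ Nat.fib (k + 1) := by
      exact_mod_cast Nat.fib_pos.2 (Nat.succ_pos k)
    have h3 := h2.trans h1
    rw [← hg, hQ] at h3
    exact_mod_cast h3
  refine ⟨P, Q, ⟨hQ1, ?_, ?_, ?_, ?_⟩, hQ⟩
  · intro k
    have := GenContFract.of_den_mono (v := x) (n := k)
    rw [← hg, hQ, hQ] at this
    exact_mod_cast this
  · intro k
    have h1 : (Q (k + 2) : ℝ) = b (k + 1) * Q (k + 1) + Q k := by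
      rw [← hQ, ← hQ, ← hQ, hden]
    have h2 : Q (k + 2) = b (k + 1) * Q (k + 1) + Q k := by exact_mod_cast h1
    nlinarith [hQ1 (k + 1), hb1 (k + 1)]
  · intro k
    have := (SimpContFract.of x).determinant (hterm k)
    change g.nums k * g.dens (k + 1) - g.dens k * g.nums (k + 1) = _ at this
    rw [hP, hP, hQ, hQ] at this
    exact_mod_cast this
  · intro k
    have hstream : ∃ ifp, GenContFract.IntFractPair.stream x k = some ifp ∧ ifp.fr ≠ 0 := by
      have h1 : GenContFract.IntFractPair.stream x (k + 1) ≠ none :=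
        (not_congr GenContFract.of_terminatedAt_n_iff_succ_nth_intFractPair_stream_eq_none).1
          (hterm k)
      obtain ⟨ifp, hifp⟩ := Option.ne_none_iff_exists'.1 h1
      obtain ⟨ifp', h2, h3, -⟩ :=
        GenContFract.IntFractPair.succ_nth_stream_eq_some_iff.1 hifp
      exact ⟨ifp', h2, h3⟩
    obtain ⟨ifp, hifp, hfr⟩ := hstream
    -- The exact error formula for a convergent: its denominator `Q k * y` is positive, so the error
    -- has the sign `(-1) ^ k`.
    have h1 := GenContFract.sub_convs_eq hifp
    simp only [hfr, if_false] at h1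
    have hfr0 : 0 < ifp.fr :=
      lt_of_le_of_ne (GenContFract.IntFractPair.nth_stream_fr_nonneg hifp) (Ne.symm hfr)
    have hQ0 : (0 : ℝ) < Q k := by exact_mod_cast hQ1 k
    have hB : ((GenContFract.of x).contsAux (k + 1)).b = Q k := hQ k
    have hpB : 0 ≤ ((GenContFract.of x).contsAux k).b := GenContFract.zero_le_of_contsAux_b
    rw [hB, ← hg, GenContFract.conv_eq_num_div_den, hP, hQ] at h1
    set y := ifp.fr⁻¹ * (Q k : ℝ) + ((GenContFract.of x).contsAux k).b with hy
    have hy0 : 0 < y := by positivity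
    have h2 : (Q k : ℝ) * x - P k = (-1) ^ k / y := by
      have h3 : x = (P k : ℝ) / Q k + (-1) ^ k / (Q k * y) := by linarith
      rw [h3]
      field_simp
      ring
    rw [h2, ← mul_div_assoc, ← mul_pow]
    simp [hy0]

namespace IsConvergentSeq

variable {x : ℝ} {P Q : ℕ → ℤ}

theorem cast_pos (h : IsConvergentSeq x P Q) (k : ℕ) : (0 : ℝ) < Q k := by
  exact_mod_cast h.one_le k

theorem two_le (h : IsConvergentSeq x P Q) (k : ℕ) : 2 ≤ Q (k + 2) := by
  linarith [h.add_le k, h.one_le k, h.one_le (k + 1)]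

theorem abs_eq (h : IsConvergentSeq x P Q) (k : ℕ) :
    |Q k * x - P k| = (-1) ^ k * (Q k * x - P k) := by
  have := h.sign k
  rcases neg_one_pow_eq_or ℝ k with h1 | h1 <;> rw [h1] at this ⊢
  · rw [one_mul] at *
    exact abs_of_pos this
  · rw [abs_of_neg] <;> linarith

/-- Consecutive errors have opposite signs, so the determinant identity becomes a sum of absolute
values without cancellation. Both bounds on the approximation error follow from it. -/
theorem mul_abs_add (h : IsConvergentSeq x P Q) (k : ℕ) :
    Q (k + 1) * |Q k * x - P k| + Q k * |Q (k + 1) * x - P (k + 1)| = 1 := by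
  have h1 : (P k * Q (k + 1) - Q k * P (k + 1) : ℝ) = (-1) ^ (k + 1) := by exact_mod_cast h.det k
  rw [h.abs_eq, h.abs_eq]
  have h2 : ((-1 : ℝ)) ^ k * (-1) ^ k = 1 := by rw [← mul_pow]; simp
  rw [pow_succ] at h1 ⊢
  linear_combination (-(-1) ^ k) * h1 + h2

theorem abs_le (h : IsConvergentSeq x P Q) (k : ℕ) : |Q k * x - P k| ≤ 1 / Q (k + 1) := by
  rw [le_div_iff₀ (h.cast_pos _)]
  have h1 := h.mul_abs_add k
  have h2 := h.cast_pos k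
  nlinarith [abs_nonneg (Q (k + 1) * x - P (k + 1))]

theorem le_abs (h : IsConvergentSeq x P Q) (k : ℕ) : 1 / (2 * Q (k + 1)) ≤ |Q k * x - P k| := by
  have h1 := h.mul_abs_add k
  have h2 := h.abs_le (k + 1)
  have h3 : (Q k : ℝ) + Q (k + 1) ≤ Q (k + 2) := by exact_mod_cast h.add_le k
  have h4 : (Q k : ℝ) ≤ Q (k + 1) := by exact_mod_cast h.mono k
  have hk := h.cast_pos k
  have hk1 := h.cast_pos (k + 1)
  have hk2 := h.cast_pos (k + 2)
  have h5 : Q k * |Q (k + 1) * x - P (k + 1)| ≤ 1 / 2 := by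
    calc Q k * |Q (k + 1) * x - P (k + 1)| ≤ Q k * (1 / Q (k + 1 + 1)) := by gcongr
      _ ≤ 1 / 2 := by
        rw [mul_one_div, div_le_div_iff₀ hk2 (by norm_num)]
        linarith
  rw [div_le_iff₀ (by positivity)]
  linarith

/-- Integers `m` below the next denominator give no better approximation than the convergent. -/
theorem le_abs_of_abs_lt (h : IsConvergentSeq x P Q) (k : ℕ) {m b : ℤ} (hm : m ≠ 0)
    (hlt : |m| < Q (k + 1)) : 1 / (2 * Q (k + 1)) ≤ |m * x - b| := by
  refine (h.le_abs k).trans ?_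
  set ε : ℤ := (-1) ^ (k + 1) with hε
  have hε2 : ε * ε = 1 := by rw [hε, ← mul_pow]; simp
  have hdet : P k * Q (k + 1) - Q k * P (k + 1) = ε := h.det k
  -- Two consecutive convergents form a basis of `ℤ²`; `u` and `v` are the coordinates of `(m, b)`
  -- in it. The bound on `|m|` forces `u ≠ 0` and `u * v ≤ 0`. As the errors alternate in sign, the
  -- two contributions to `m * x - b` then add up.
  set u : ℤ := ε * (b * Q (k + 1) - m * P (k + 1)) with hu
  set v : ℤ := ε * (m * P k - b * Q k) with hv
  have hm' : m = u * Q k + v * Q (k + 1) := by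
    rw [hu, hv]
    linear_combination (-m) * hε2 - ε * m * hdet
  have hb' : b = u * P k + v * P (k + 1) := by
    rw [hu, hv]
    linear_combination (-b) * hε2 - ε * b * hdet
  have hq := h.one_le k
  have hq1 := h.one_le (k + 1)
  have hu0 : u ≠ 0 := by
    intro h0
    rw [h0, zero_mul, zero_add] at hm'
    have hv0 : v ≠ 0 := by
      rintro h1
      exact hm (by rw [hm', h1, zero_mul])
    rw [hm', abs_mul, abs_of_pos (by linarith : 0 < Q (k + 1))] at hlt
    nlinarith [Int.one_le_abs hv0]
  have huv : u * v ≤ 0 := by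
    by_contra hc
    push Not at hc
    rcases pos_and_pos_or_neg_and_neg_of_mul_pos hc with ⟨h1, h2⟩ | ⟨h1, h2⟩
    · have := le_abs_self m
      nlinarith
    · have := neg_abs_le m
      nlinarith
  have hs := h.sign k
  have hs1 := h.sign (k + 1)
  have hexp : (m : ℝ) * x - b = u * (Q k * x - P k) + v * (Q (k + 1) * x - P (k + 1)) := by
    rw [hm', hb']
    push_cast
    ring
  have hab : ∀ a c : ℝ, 0 ≤ a * c → |a| ≤ |a + c| := by
    intro a c hac
    rw [← sq_le_sq]
    nlinarith [sq_nonneg c]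
  rw [hexp]
  refine le_trans ?_ (hab _ _ ?_)
  · rw [abs_mul]
    have : (1 : ℝ) ≤ |(u : ℝ)| := by exact_mod_cast Int.one_le_abs hu0
    nlinarith [abs_nonneg (Q k * x - P k)]
  · have h1 : 0 < -((Q k * x - P k) * (Q (k + 1) * x - P (k + 1))) := by
      have h2 := mul_pos hs hs1
      have h3 : ((-1 : ℝ)) ^ k * (-1) ^ k = 1 := by rw [← mul_pow]; simp
      calc (0 : ℝ) < _ := h2
        _ = -(((-1 : ℝ)) ^ k * (-1) ^ k * ((Q k * x - P k) * (Q (k + 1) * x - P (k + 1)))) := by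
          rw [pow_succ]; ring
        _ = _ := by rw [h3, one_mul]
    have h2 : (u * v : ℝ) ≤ 0 := by exact_mod_cast huv
    nlinarith

/-- Good approximations with small denominator are multiples of the convergent. -/
theorem exists_eq_mul (h : IsConvergentSeq x P Q) (k : ℕ) {m b : ℤ} (hm : 0 ≤ m)
    (hlt : 4 * m < Q (k + 2)) (happ : |m * x - b| < 1 / (4 * Q (k + 1))) :
    ∃ t : ℤ, 0 ≤ t ∧ m = t * Q (k + 1) ∧ b = t * P (k + 1) := by
  have hq := h.one_le (k + 1)
  have hq' := h.cast_pos (k + 1)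
  have hq2' := h.cast_pos (k + 2)
  -- Subtracting `t` times the convergent costs at most `t / Q (k + 2)`, which `4 * m < Q (k + 2)`
  -- keeps small. A nonzero remainder would then approximate too well for its size.
  set t := m / Q (k + 1) with ht
  set r := m % Q (k + 1) with hr
  have hmt : m = t * Q (k + 1) + r := by rw [ht, hr]; exact (Int.ediv_mul_add_emod m _).symm
  have hr0 : 0 ≤ r := Int.emod_nonneg _ (by omega)
  have hrq : r < Q (k + 1) := Int.emod_lt_of_pos _ (by omega)
  have ht0 : 0 ≤ t := Int.ediv_nonneg hm (by omega)
  have ht0' : (0 : ℝ) ≤ t := by exact_mod_cast ht0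
  have hsmall : |(r : ℝ) * x - ((b - t * P (k + 1) : ℤ) : ℝ)| < 1 / (2 * Q (k + 1)) := by
    have h1 : (r : ℝ) * x - ((b - t * P (k + 1) : ℤ) : ℝ) =
        (m * x - b) - t * (Q (k + 1) * x - P (k + 1)) := by
      rw [hmt]
      push_cast
      ring
    rw [h1]
    have h2 := h.abs_le (k + 1)
    have h3 : |(t : ℝ) * (Q (k + 1) * x - P (k + 1))| ≤ 1 / (4 * Q (k + 1)) := by
      rw [abs_mul, abs_of_nonneg ht0']
      calc (t : ℝ) * |Q (k + 1) * x - P (k + 1)| ≤ t * (1 / Q (k + 2)) := by gcongr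
        _ ≤ 1 / (4 * Q (k + 1)) := by
          rw [mul_one_div, div_le_div_iff₀ hq2' (by positivity)]
          have h4 : t * (4 * Q (k + 1)) ≤ 1 * Q (k + 2) := by nlinarith
          exact_mod_cast h4
    have h4 := abs_sub (m * x - b) (t * (Q (k + 1) * x - P (k + 1)))
    have h5 : 1 / (2 * (Q (k + 1) : ℝ)) = 1 / (4 * Q (k + 1)) + 1 / (4 * Q (k + 1)) := by
      field_simp; norm_num
    linarith
  have hr00 : r = 0 := by
    by_contra hne
    have := h.le_abs_of_abs_lt k (b := b - t * P (k + 1)) hne (by rwa [abs_of_nonneg hr0])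
    linarith
  refine ⟨t, ht0, by rw [hmt, hr00]; ring, ?_⟩
  rw [hr00] at hsmall
  have h1 : |((b - t * P (k + 1) : ℤ) : ℝ)| < 1 := by
    rw [Int.cast_zero, zero_mul, zero_sub, abs_neg] at hsmall
    refine hsmall.trans_le ?_
    rw [div_le_one (by positivity)]
    have : (1 : ℝ) ≤ Q (k + 1) := by exact_mod_cast hq
    linarith
  have h2 : |b - t * P (k + 1)| < 1 := by exact_mod_cast h1
  have := Int.abs_lt_one_iff.1 h2
  linarith

end IsConvergentSeq

/-! ### The weight of the continued fraction condition in `ℂ²` -/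

namespace IsConvergentSeq

variable {x : ℝ} {P Q : ℕ → ℤ}

/-- The coordinates of `α - e_j`. -/
def shifted (α : Fin 2 →₀ ℕ) (j i : Fin 2) : ℤ := α i - if i = j then 1 else 0

/-- The multi-indices `α` for which some `α - e_j` is within `1 / (16 q)` of the resonant line. -/
def nearLine (x : ℝ) (q : ℤ) : Set (Fin 2 →₀ ℕ) :=
  {α | 2 ≤ α.degree ∧ ∃ j, |shifted α j 0 * x - shifted α j 1| < 1 / (16 * q)}

open Classical in
/-- An index `j` for which `α - e_j` is near the resonant line. -/
noncomputable def nearIndex (x : ℝ) (q : ℤ) (α : Fin 2 →₀ ℕ) : Fin 2 :=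
  if |shifted α 0 0 * x - shifted α 0 1| < 1 / (16 * q) then 0 else 1

/-- The first coordinate of `α - e_j` for `j = nearIndex α`. -/
noncomputable def height (x : ℝ) (q : ℤ) (α : Fin 2 →₀ ℕ) : ℤ := shifted α (nearIndex x q α) 0

theorem near_nearIndex {q : ℤ} {α : Fin 2 →₀ ℕ} (hα : α ∈ nearLine x q) :
    |height x q α * x - shifted α (nearIndex x q α) 1| < 1 / (16 * q) := by
  obtain ⟨-, j, hj⟩ := hα
  simp only [height, nearIndex]
  split_ifs with h
  · exact h
  · fin_cases j
    · exact absurd hj h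
    · exact hj

theorem degree_eq (α : Fin 2 →₀ ℕ) : α.degree = α 0 + α 1 := by
  rw [Finsupp.degree_eq_sum, Fin.sum_univ_two]

theorem height_le (q : ℤ) (α : Fin 2 →₀ ℕ) : height x q α ≤ α 0 := by
  simp only [height, shifted]
  split_ifs <;> omega

theorem le_height_add_one (q : ℤ) (α : Fin 2 →₀ ℕ) : (α 0 : ℤ) ≤ height x q α + 1 := by
  simp only [height, shifted]
  split_ifs <;> omega

theorem height_le_degree (q : ℤ) (α : Fin 2 →₀ ℕ) : height x q α ≤ α.degree := by
  rw [degree_eq]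
  have := height_le (x := x) q α
  omega

/-- The bound `-1 ≤ m` is what is available for heights and their differences, since subtracting
`e_j` can lower a coordinate by one; `2 ≤ Q (k + 1)` excludes `m = -1`. -/
theorem eq_zero_or_le (h : IsConvergentSeq x P Q) (k : ℕ) {m b : ℤ} (hm : -1 ≤ m)
    (hq : 2 ≤ Q (k + 1)) (happ : |m * x - b| < 1 / (4 * Q (k + 1))) :
    (m = 0 ∧ b = 0) ∨ Q (k + 1) ≤ m := by
  have hq' := h.cast_pos (k + 1)
  have hq1 : (1 : ℝ) ≤ Q (k + 1) := by exact_mod_cast h.one_le (k + 1)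
  by_cases h0 : m = 0
  · left
    refine ⟨h0, ?_⟩
    rw [h0, Int.cast_zero, zero_mul, zero_sub, abs_neg] at happ
    have h1 : |(b : ℝ)| < 1 := by
      refine happ.trans_le ?_
      rw [div_le_one (by positivity)]
      linarith
    exact Int.abs_lt_one_iff.1 (by exact_mod_cast h1)
  · right
    by_contra hlt
    have h1 := h.le_abs_of_abs_lt k (b := b) h0 (by rw [abs_lt]; omega)
    have h2 : 1 / (4 * (Q (k + 1) : ℝ)) ≤ 1 / (2 * Q (k + 1)) := by gcongr; norm_num
    linarith

theorem inv_sixteen_lt {q : ℝ} (hq : 0 < q) :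
    1 / (16 * q) < 1 / (4 * q) ∧ 1 / (16 * q) + 1 / (16 * q) < 1 / (4 * q) := by
  have h1 : 1 / (16 * q) = 1 / 16 * (1 / q) := by field_simp
  have h2 : 1 / (4 * q) = 1 / 4 * (1 / q) := by field_simp
  have h3 : 0 < 1 / q := by positivity
  rw [h1, h2]
  constructor <;> linarith

/-- The only other possibility is `α - e_j = 0`, which the degree excludes. -/
theorem le_height (h : IsConvergentSeq x P Q) (k : ℕ) (hq : 2 ≤ Q (k + 1)) {α : Fin 2 →₀ ℕ}
    (hα : α ∈ nearLine x (Q (k + 1))) : Q (k + 1) ≤ height x (Q (k + 1)) α := by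
  have h1 := near_nearIndex hα
  have h2 := (inv_sixteen_lt (h.cast_pos (k + 1))).1
  have hge : -1 ≤ height x (Q (k + 1)) α := by
    have := le_height_add_one (x := x) (Q (k + 1)) α
    omega
  refine (h.eq_zero_or_le k hge hq (h1.trans h2)).resolve_left ?_
  rintro ⟨h3, h4⟩
  have h5 := hα.1
  rw [degree_eq] at h5
  simp only [height, shifted] at h3 h4
  generalize nearIndex x (Q (k + 1)) α = j at h3 h4
  fin_cases j <;> simp at h3 h4 <;> omega

theorem exists_eq_mul_of_nearLine (h : IsConvergentSeq x P Q) (k : ℕ) (hq : 2 ≤ Q (k + 1))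
    {α : Fin 2 →₀ ℕ} (hα : α ∈ nearLine x (Q (k + 1)))
    (hlt : 4 * height x (Q (k + 1)) α < Q (k + 2)) :
    ∃ t : ℤ, 1 ≤ t ∧ height x (Q (k + 1)) α = t * Q (k + 1) ∧
      shifted α (nearIndex x (Q (k + 1)) α) 1 = t * P (k + 1) := by
  have h0 := h.le_height k hq hα
  obtain ⟨t, ht0, ht1, ht2⟩ := h.exists_eq_mul k (by omega) hlt
    ((near_nearIndex hα).trans (inv_sixteen_lt (h.cast_pos (k + 1))).1)
  refine ⟨t, ?_, ht1, ht2⟩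
  by_contra hc
  have : t = 0 := by omega
  rw [this, zero_mul] at ht1
  omega

theorem near_sub {q : ℤ} {α γ : Fin 2 →₀ ℕ} (hα : α ∈ nearLine x q) (hγ : γ ∈ nearLine x q) :
    |((height x q α - height x q γ : ℤ) : ℝ) * x -
      ((shifted α (nearIndex x q α) 1 - shifted γ (nearIndex x q γ) 1 : ℤ) : ℝ)| <
      1 / (16 * q) + 1 / (16 * q) := by
  have h1 := near_nearIndex hα
  have h2 := near_nearIndex hγ
  have h3 := abs_sub (height x q α * x - shifted α (nearIndex x q α) 1)
    (height x q γ * x - shifted γ (nearIndex x q γ) 1)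
  push_cast
  calc _ = _ := by congr 1; ring
    _ ≤ _ := h3
    _ < _ := add_lt_add h1 h2

/-- The difference of two points near the line is near it too. If it vanished, `α - e_j = γ - e_i`,
which together with `γ ≤ α` gives `γ = α`. -/
theorem height_gap (h : IsConvergentSeq x P Q) (k : ℕ) (hq : 2 ≤ Q (k + 1)) {α γ : Fin 2 →₀ ℕ}
    (hα : α ∈ nearLine x (Q (k + 1))) (hγ : γ ∈ nearLine x (Q (k + 1))) (hle : γ ≤ α)
    (hne : γ ≠ α) : Q (k + 1) ≤ height x (Q (k + 1)) α - height x (Q (k + 1)) γ := by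
  have hle0 := hle 0
  have hle1 := hle 1
  have hge : -1 ≤ height x (Q (k + 1)) α - height x (Q (k + 1)) γ := by
    have h1 := le_height_add_one (x := x) (Q (k + 1)) α
    have h2 := height_le (x := x) (Q (k + 1)) γ
    omega
  refine (h.eq_zero_or_le k hge hq
    ((near_sub hα hγ).trans (inv_sixteen_lt (h.cast_pos (k + 1))).2)).resolve_left ?_
  rintro ⟨h3, h4⟩
  apply hne
  simp only [height, shifted] at h3 h4
  generalize nearIndex x (Q (k + 1)) α = j at h3 h4
  generalize nearIndex x (Q (k + 1)) γ = i at h3 h4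
  ext a
  fin_cases j <;> fin_cases i <;> fin_cases a <;> simp at h3 h4 ⊢ <;> omega

theorem exists_eq_mul_of_gap (h : IsConvergentSeq x P Q) (k : ℕ) (hq : 2 ≤ Q (k + 1))
    {α γ : Fin 2 →₀ ℕ} (hα : α ∈ nearLine x (Q (k + 1))) (hγ : γ ∈ nearLine x (Q (k + 1)))
    (hle : γ ≤ α) (hne : γ ≠ α)
    (hlt : 4 * (height x (Q (k + 1)) α - height x (Q (k + 1)) γ) < Q (k + 2)) :
    ∃ t : ℤ, 1 ≤ t ∧ height x (Q (k + 1)) α - height x (Q (k + 1)) γ = t * Q (k + 1) ∧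
      shifted α (nearIndex x (Q (k + 1)) α) 1 - shifted γ (nearIndex x (Q (k + 1)) γ) 1 =
        t * P (k + 1) := by
  have h0 := h.height_gap k hq hα hγ hle hne
  obtain ⟨t, ht0, ht1, ht2⟩ := h.exists_eq_mul k (by omega) hlt
    ((near_sub hα hγ).trans (inv_sixteen_lt (h.cast_pos (k + 1))).2)
  refine ⟨t, ?_, ht1, ht2⟩
  by_contra hc
  have : t = 0 := by omega
  rw [this, zero_mul] at ht1
  omega

/-- The sum of multi-indices of small height near the line. -/
theorem exists_sum_eq (h : IsConvergentSeq x P Q) (k : ℕ) (hq : 2 ≤ Q (k + 1))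
    (l : Multiset (Fin 2 →₀ ℕ))
    (hl : ∀ γ ∈ l, γ ∈ nearLine x (Q (k + 1)) ∧ 4 * height x (Q (k + 1)) γ < Q (k + 2)) :
    ∃ t n₀ n₁ : ℤ, 0 ≤ n₀ ∧ 0 ≤ n₁ ∧ n₀ + n₁ = Multiset.card l ∧
      (l.map (height x (Q (k + 1)))).sum = t * Q (k + 1) ∧
      (l.sum 0 : ℤ) = t * Q (k + 1) + n₀ ∧ (l.sum 1 : ℤ) = t * P (k + 1) + n₁ := by
  induction l using Multiset.induction with
  | empty => exact ⟨0, 0, 0, by simp⟩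
  | cons a l ih =>
    obtain ⟨t, n₀, n₁, h0, h1, hn, hs, hs0, hs1⟩ := ih fun γ hγ => hl γ (by simp [hγ])
    obtain ⟨ha, hlt⟩ := hl a (by simp)
    obtain ⟨u, -, hu1, hu2⟩ := h.exists_eq_mul_of_nearLine k hq ha hlt
    have e0 : (a 0 : ℤ) = height x (Q (k + 1)) a +
        if (0 : Fin 2) = nearIndex x (Q (k + 1)) a then 1 else 0 := by
      simp only [height, shifted]; ring
    have e1 : (a 1 : ℤ) = shifted a (nearIndex x (Q (k + 1)) a) 1 +
        if (1 : Fin 2) = nearIndex x (Q (k + 1)) a then 1 else 0 := by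
      simp only [shifted]; ring
    generalize nearIndex x (Q (k + 1)) a = j at e0 e1 hu2
    refine ⟨u + t, n₀ + (if (0 : Fin 2) = j then 1 else 0),
      n₁ + (if (1 : Fin 2) = j then 1 else 0), ?_, ?_, ?_, ?_, ?_, ?_⟩
    · split_ifs <;> omega
    · split_ifs <;> omega
    · rw [Multiset.card_cons]
      fin_cases j <;> simp <;> omega
    · rw [Multiset.map_cons, Multiset.sum_cons, hs, hu1]
      ring
    · rw [Multiset.sum_cons, Finsupp.add_apply, Nat.cast_add, hs0, e0, hu1]
      ring
    · rw [Multiset.sum_cons, Finsupp.add_apply, Nat.cast_add, hs1, e1, hu2]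
      ring

/-- A packing of `t (q, p) + (w₀, w₁)` by multi-indices of small height near the line has total
height at most `t q`, with equality only for few summands. -/
theorem sum_height_le (h : IsConvergentSeq x P Q) (k : ℕ) (hq : 2 ≤ Q (k + 1))
    (l : Multiset (Fin 2 →₀ ℕ))
    (hl : ∀ γ ∈ l, γ ∈ nearLine x (Q (k + 1)) ∧ 4 * height x (Q (k + 1)) γ < Q (k + 2))
    {t w₀ w₁ : ℤ} (hw : w₀ ≤ 1) (h0 : (l.sum 0 : ℤ) ≤ t * Q (k + 1) + w₀)
    (h1 : (l.sum 1 : ℤ) ≤ t * P (k + 1) + w₁) :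
    (l.map (height x (Q (k + 1)))).sum + Q (k + 1) ≤ t * Q (k + 1) ∨
      ((l.map (height x (Q (k + 1)))).sum = t * Q (k + 1) ∧ (Multiset.card l : ℤ) ≤ w₀ + w₁) := by
  obtain ⟨u, n₀, n₁, hn0, hn1, hn, hs, hs0, hs1⟩ := h.exists_sum_eq k hq l hl
  rw [hs]
  rw [hs0] at h0
  rw [hs1] at h1
  -- One multiple too many would overshoot the first coordinate by at least `Q (k + 1) ≥ 2 > w₀`.
  -- When `u = t`, only the unit vectors remain to be compared, and they bound the number of
  -- summands.
  have hut : u ≤ t := by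
    by_contra hc
    have : (t + 1) * Q (k + 1) ≤ u * Q (k + 1) := by
      apply mul_le_mul_of_nonneg_right <;> omega
    linarith
  rcases hut.lt_or_eq with hlt | rfl
  · left
    have : (u + 1) * Q (k + 1) ≤ t * Q (k + 1) := by
      apply mul_le_mul_of_nonneg_right <;> omega
    linarith
  · right
    refine ⟨rfl, ?_⟩
    linarith

/-- The relative excess in the packing estimate. -/
noncomputable def excess (q q' : ℤ) : ℝ := 6 * q / max (q : ℝ) (q' / 4)

open Classical in
/-- The value of a multi-index in the packing estimate. -/
noncomputable def lineValue (x : ℝ) (q q' : ℤ) (γ : Fin 2 →₀ ℕ) : ℝ :=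
  if 4 * height x q γ < q' then (height x q γ : ℝ) / q
  else (1 + excess q q') * (height x q γ / q) - ((1 + excess q q') / 2 + 1)

theorem excess_nonneg {q q' : ℤ} (hq : 0 < q) : 0 ≤ excess q q' := by
  have : (0 : ℝ) < q := by exact_mod_cast hq
  have h2 : (0 : ℝ) < max (q : ℝ) (q' / 4) := lt_max_of_lt_left this
  unfold excess
  positivity

theorem excess_le {q q' : ℤ} (hq : 0 < q) : excess q q' ≤ 6 := by
  have : (0 : ℝ) < q := by exact_mod_cast hq
  have h2 : (0 : ℝ) < max (q : ℝ) (q' / 4) := lt_max_of_lt_left this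
  rw [excess, div_le_iff₀ h2]
  linarith [le_max_left (q : ℝ) (q' / 4)]

/-- The excess contributes only `log q' / q'` per scale, which is summable by `sum_log_div_le`. -/
theorem excess_div_le {q q' : ℤ} (hq : 0 < q) (hq' : 0 < q') : excess q q' / q ≤ 24 / q' := by
  have h0 : (0 : ℝ) < q := by exact_mod_cast hq
  have h0' : (0 : ℝ) < q' := by exact_mod_cast hq'
  have h2 : (0 : ℝ) < max (q : ℝ) (q' / 4) := lt_max_of_lt_left h0
  have h3 : excess q q' / q = 6 / max (q : ℝ) (q' / 4) := by
    rw [excess]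
    field_simp
  rw [h3, div_le_div_iff₀ h2 h0']
  linarith [le_max_right (q : ℝ) (q' / 4)]

theorem six_le_excess_mul {q q' m : ℤ} (hq : 0 < q) (hm : q ≤ m) (hm' : q' ≤ 4 * m) :
    6 ≤ excess q q' * (m / q) := by
  have h0 : (0 : ℝ) < q := by exact_mod_cast hq
  have h1 : (q : ℝ) ≤ m := by exact_mod_cast hm
  have h1' : (q' : ℝ) ≤ 4 * m := by exact_mod_cast hm'
  have h2 : (0 : ℝ) < max (q : ℝ) (q' / 4) := lt_max_of_lt_left h0
  have h3 : excess q q' * (m / q) = 6 * m / max (q : ℝ) (q' / 4) := by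
    rw [excess]
    field_simp
  rw [h3, le_div_iff₀ h2]
  have : max (q : ℝ) (q' / 4) ≤ m := max_le h1 (by linarith)
  linarith

theorem lineValue_le {q q' : ℤ} (hq : 0 < q) {γ : Fin 2 →₀ ℕ} (hγ : 0 ≤ height x q γ) :
    lineValue x q q' γ ≤ (1 + excess q q') / q * γ.degree := by
  have h0 : (0 : ℝ) < q := by exact_mod_cast hq
  have h1 : (height x q γ : ℝ) ≤ γ.degree := by exact_mod_cast height_le_degree (x := x) q γ
  have h2 : (0 : ℝ) ≤ height x q γ := by exact_mod_cast hγ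
  have h3 := excess_nonneg (q' := q') hq
  have h4 : (height x q γ : ℝ) / q ≤ γ.degree / q := by gcongr
  have h5 : (0 : ℝ) ≤ height x q γ / q := by positivity
  have h6 : (1 + excess q q') / q * γ.degree = (1 + excess q q') * (γ.degree / q) := by ring
  rw [h6, lineValue]
  split_ifs <;> nlinarith

theorem sum_height_le_apply (q : ℤ) (l : Multiset (Fin 2 →₀ ℕ)) :
    (l.map (height x q)).sum ≤ l.sum 0 := by
  induction l using Multiset.induction with
  | empty => simp
  | cons a l ih =>
    have := height_le (x := x) q a
    rw [Multiset.map_cons, Multiset.sum_cons, Multiset.sum_cons, Finsupp.add_apply, Nat.cast_add]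
    omega

theorem sum_lineValue_of_small {q q' : ℤ} (l : Multiset (Fin 2 →₀ ℕ))
    (hl : ∀ γ ∈ l, 4 * height x q γ < q') :
    (l.map (lineValue x q q')).sum = ((l.map (height x q)).sum : ℝ) / q := by
  induction l using Multiset.induction with
  | empty => simp
  | cons a l ih =>
    rw [Multiset.map_cons, Multiset.sum_cons, Multiset.map_cons, Multiset.sum_cons,
      ih fun γ hγ => hl γ (by simp [hγ]), lineValue, if_pos (hl a (by simp))]
    push_cast
    ring

open Classical in
theorem sum_lineValue_le {q q' : ℤ} (hq : 0 < q) (l : Multiset (Fin 2 →₀ ℕ))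
    (hl : ∀ γ ∈ l, 0 ≤ height x q γ) :
    (l.map (lineValue x q q')).sum ≤ (1 + excess q q') * ((l.map (height x q)).sum / q) -
      Multiset.card (l.filter fun γ => ¬ 4 * height x q γ < q') * ((1 + excess q q') / 2 + 1) := by
  induction l using Multiset.induction with
  | empty => simp
  | cons a l ih =>
    have ih' := ih fun γ hγ => hl γ (by simp [hγ])
    have h0 : (0 : ℝ) < q := by exact_mod_cast hq
    have ha : (0 : ℝ) ≤ height x q a := by exact_mod_cast hl a (by simp)
    have ha' : (0 : ℝ) ≤ height x q a / q := by positivity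
    have he := excess_nonneg (q' := q') hq
    rw [Multiset.map_cons, Multiset.sum_cons, Multiset.map_cons, Multiset.sum_cons]
    by_cases hc : 4 * height x q a < q'
    · rw [Multiset.filter_cons_of_neg _ (by simpa using hc), lineValue, if_pos hc,
        Int.cast_add, add_div, mul_add]
      nlinarith
    · rw [Multiset.filter_cons_of_pos (p := fun γ => ¬ 4 * height x q γ < q') _ hc, lineValue,
        if_neg hc, Multiset.card_cons, Int.cast_add, add_div (height x q a : ℝ), mul_add,
        Nat.cast_add, Nat.cast_one]
      linarith

/-- Below height `q' / 4`, points near the line are exact multiples of the convergent `(q, p)`: a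
packing either wastes a whole multiple, hence one unit of `height / q`, or has too few summands.
Above it, coordinates can be lost to rounding, and the slightly steeper slope `1 + excess` with a
constant deduction covers this. The proof splits according to the number of high summands. -/
theorem nearLine_packing (h : IsConvergentSeq x P Q) (k : ℕ) (hq : 2 ≤ Q (k + 1))
    {α : Fin 2 →₀ ℕ} (hα : α ∈ nearLine x (Q (k + 1))) (l : Multiset (Fin 2 →₀ ℕ))
    (hl : ∀ γ ∈ l, γ ∈ nearLine x (Q (k + 1)) ∧ γ ≠ α) (hle : l.sum ≤ α) :
    (l.map (lineValue x (Q (k + 1)) (Q (k + 2)))).sum + 1 ≤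
      lineValue x (Q (k + 1)) (Q (k + 2)) α := by
  classical
  set q := Q (k + 1) with hqdef
  set q' := Q (k + 2) with hq'def
  have hq0 : 0 < q := by omega
  have hqR : (2 : ℝ) ≤ q := by exact_mod_cast hq
  have hqR0 : (0 : ℝ) < q := by linarith
  have hle0 : (l.sum 0 : ℤ) ≤ α 0 := by exact_mod_cast hle 0
  have hle1 : (l.sum 1 : ℤ) ≤ α 1 := by exact_mod_cast hle 1
  have hmem : ∀ γ ∈ l, γ ≤ α := fun γ hγ =>
    (Multiset.single_le_sum (fun _ _ => zero_le) _ hγ).trans hle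
  have hgap : ∀ γ ∈ l, q ≤ height x q α - height x q γ := fun γ hγ =>
    h.height_gap k hq hα (hl γ hγ).1 (hmem γ hγ) (hl γ hγ).2
  have hpos : ∀ γ ∈ l, 0 ≤ height x q γ := fun γ hγ => by
    have : q ≤ height x q γ := h.le_height k hq (hl γ hγ).1
    omega
  have hαq : q ≤ height x q α := h.le_height k hq hα
  have he := excess_nonneg (q' := q') hq0
  have he6 := excess_le (q' := q') hq0
  have hsum : (l.map (height x q)).sum ≤ height x q α + 1 :=
    (sum_height_le_apply q l).trans (hle0.trans (le_height_add_one q α))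
  have hsumR : ((l.map (height x q)).sum : ℝ) ≤ height x q α + 1 := by exact_mod_cast hsum
  have hinv : 1 / (q : ℝ) ≤ 1 / 2 := by gcongr
  by_cases hsm : 4 * height x q α < q'
  · have hlsm : ∀ γ ∈ l, 4 * height x q γ < q' := fun γ hγ => by
      have := hgap γ hγ
      omega
    rw [sum_lineValue_of_small l hlsm, lineValue, if_pos hsm]
    obtain ⟨t, ht1, ht2, ht3⟩ := h.exists_eq_mul_of_nearLine k hq hα hsm
    suffices hkey : (l.map (height x q)).sum + q ≤ height x q α by
      have hkeyR : ((l.map (height x q)).sum : ℝ) + q ≤ height x q α := by exact_mod_cast hkey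
      rw [div_add_one hqR0.ne']
      gcongr
    have e0 : (α 0 : ℤ) = t * q + if (0 : Fin 2) = nearIndex x q α then 1 else 0 := by
      rw [← ht2]; simp only [height, shifted]; ring
    have e1 : (α 1 : ℤ) = t * P (k + 1) + if (1 : Fin 2) = nearIndex x q α then 1 else 0 := by
      rw [← ht3]; simp only [shifted]; ring
    rcases h.sum_height_le k hq l (fun γ hγ => ⟨(hl γ hγ).1, hlsm γ hγ⟩) (t := t)
      (w₀ := if (0 : Fin 2) = nearIndex x q α then 1 else 0)
      (w₁ := if (1 : Fin 2) = nearIndex x q α then 1 else 0) (by split_ifs <;> omega)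
      (by rw [← hqdef]; omega) (by omega) with hcase | ⟨hcase, hcard⟩
    · rw [ht2]
      exact hcase
    · have hcard1 : Multiset.card l ≤ 1 := by
        generalize nearIndex x q α = j at hcard
        fin_cases j <;> simp at hcard <;> omega
      rw [← hqdef, ← ht2] at hcase
      interval_cases hcl : Multiset.card l
      · rw [Multiset.card_eq_zero.1 hcl] at hcase ⊢
        simp only [Multiset.map_zero, Multiset.sum_zero] at hcase ⊢
        omega
      · obtain ⟨γ, rfl⟩ := Multiset.card_eq_one.1 hcl
        have h1 := hgap γ (by simp)
        rw [Multiset.map_singleton, Multiset.sum_singleton] at hcase ⊢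
        omega
  · have hbig := six_le_excess_mul (q' := q') hq0 hαq (by omega)
    have hone : (1 : ℝ) ≤ height x q α / q := by
      rw [le_div_iff₀ hqR0]
      exact_mod_cast (by simpa using hαq)
    rw [lineValue, if_neg hsm]
    rcases hcard : Multiset.card (l.filter fun γ => ¬ 4 * height x q γ < q') with _ | _ | r
    -- No high summand: the requirement is `excess * (height / q) ≥ 3 + excess / 2`. The left side
    -- is at least `6` and `excess ≤ 6`; this fixes the constant in `excess`.
    · have hlsm : ∀ γ ∈ l, 4 * height x q γ < q' := by
        intro γ hγ
        by_contra hc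
        have := (Multiset.mem_filter (p := fun γ => ¬ 4 * height x q γ < q')).2 ⟨hγ, hc⟩
        rw [Multiset.card_eq_zero.1 hcard] at this
        simp at this
      rw [sum_lineValue_of_small l hlsm]
      have h1 : ((l.map (height x q)).sum : ℝ) / q ≤ height x q α / q + 1 / q := by
        rw [← add_div]
        gcongr
      nlinarith
    -- One high summand `γ`: the deductions cancel, and the low summands are packed into the
    -- difference `d`. If `d` is low, rigidity applies again, with unit-vector contributions
    -- cancelling in total; if `d` is high, the excess is enough.
    · obtain ⟨γ, hγ⟩ := Multiset.card_eq_one.1 hcard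
      have hγmem : γ ∈ l ∧ ¬ 4 * height x q γ < q' := by
        rw [← Multiset.mem_filter (p := fun γ => ¬ 4 * height x q γ < q'), hγ]
        simp
      set l' := l.filter fun γ => 4 * height x q γ < q' with hl'
      have hsplit : l = γ ::ₘ l' := by
        have := Multiset.filter_add_not (fun γ => ¬ 4 * height x q γ < q') l
        simp only [not_not] at this
        rw [hγ] at this
        rw [← this, hl']
        rfl
      have hl'sm : ∀ β ∈ l', β ∈ nearLine x q ∧ 4 * height x q β < q' := fun β hβ => by
        rw [hl', Multiset.mem_filter] at hβ
        exact ⟨(hl β hβ.1).1, hβ.2⟩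
      have hgapγ := hgap γ hγmem.1
      rw [hsplit, Multiset.map_cons, Multiset.sum_cons,
        sum_lineValue_of_small l' fun β hβ => (hl'sm β hβ).2, lineValue, if_neg hγmem.2]
      set d := height x q α - height x q γ with hd
      have hdR : (height x q α : ℝ) = height x q γ + d := by
        rw [hd]; push_cast; ring
      have hdq : (1 : ℝ) ≤ d / q := by
        rw [le_div_iff₀ hqR0]
        exact_mod_cast (by simpa using hgapγ)
      suffices hkey : ((l'.map (height x q)).sum : ℝ) / q + 1 ≤ (1 + excess q q') * (d / q) by
        rw [hdR, add_div (height x q γ : ℝ), mul_add]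
        linarith
      rw [hsplit, Multiset.sum_cons, Finsupp.add_apply, Nat.cast_add] at hle0 hle1
      by_cases hdsm : 4 * d < q'
      · obtain ⟨t, ht1, ht2, ht3⟩ := h.exists_eq_mul_of_gap k hq hα (hl γ hγmem.1).1
          (hmem γ hγmem.1) (hl γ hγmem.1).2 hdsm
        have hkeyZ : (l'.map (height x q)).sum + q ≤ d := by
          have e0 : (α 0 : ℤ) - γ 0 = t * q + ((if (0 : Fin 2) = nearIndex x q α then 1 else 0) -
              if (0 : Fin 2) = nearIndex x q γ then 1 else 0) := by
            rw [← ht2]; simp only [height, shifted]; ring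
          have e1 : (α 1 : ℤ) - γ 1 = t * P (k + 1) +
              ((if (1 : Fin 2) = nearIndex x q α then 1 else 0) -
              if (1 : Fin 2) = nearIndex x q γ then 1 else 0) := by
            rw [← ht3]; simp only [shifted]; ring
          rcases h.sum_height_le k hq l' hl'sm (t := t)
            (w₀ := (if (0 : Fin 2) = nearIndex x q α then 1 else 0) -
              if (0 : Fin 2) = nearIndex x q γ then 1 else 0)
            (w₁ := (if (1 : Fin 2) = nearIndex x q α then 1 else 0) -
              if (1 : Fin 2) = nearIndex x q γ then 1 else 0) (by split_ifs <;> omega)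
            (by rw [← hqdef]; omega) (by omega) with hcase | ⟨hcase, hcard'⟩
          · rw [hd, ht2]
            exact hcase
          · have hcard0 : Multiset.card l' = 0 := by
              generalize nearIndex x q α = j at hcard'
              generalize nearIndex x q γ = i at hcard'
              fin_cases j <;> fin_cases i <;> simp at hcard' ⊢ <;> exact hcard'
            rw [Multiset.card_eq_zero.1 hcard0]
            simpa using hgapγ
        have hkeyR : ((l'.map (height x q)).sum : ℝ) + q ≤ d := by exact_mod_cast hkeyZ
        have : ((l'.map (height x q)).sum : ℝ) / q + 1 ≤ d / q := by
          rw [div_add_one hqR0.ne']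
          gcongr
        nlinarith
      · have hbigd := six_le_excess_mul (q' := q') hq0 hgapγ (by omega)
        have h1 : (l'.map (height x q)).sum ≤ d + 1 := by
          have := sum_height_le_apply (x := x) q l'
          have := le_height_add_one (x := x) q α
          have := height_le (x := x) q γ
          omega
        have h1R : ((l'.map (height x q)).sum : ℝ) ≤ d + 1 := by exact_mod_cast h1
        have h2 : ((l'.map (height x q)).sum : ℝ) / q ≤ d / q + 1 / q := by
          rw [← add_div]
          gcongr
        rw [add_mul, one_mul]
        linarith
    -- Two or more high summands: the second deduction pays both for the rounding, at most `(1 +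
    -- excess) / 2`, and for the required unit.
    · have h1 := sum_lineValue_le (q' := q') hq0 l hpos
      rw [hcard] at h1
      have h2 : ((l.map (height x q)).sum : ℝ) / q ≤ height x q α / q + 1 / q := by
        rw [← add_div]
        gcongr
      have h3 : (1 + excess q q') * (((l.map (height x q)).sum : ℝ) / q) ≤
          (1 + excess q q') * (height x q α / q) + (1 + excess q q') / 2 := by
        calc _ ≤ (1 + excess q q') * (height x q α / q + 1 / 2) := by gcongr; linarith
          _ = _ := by ring
      have h4 : (0 : ℝ) ≤ r * ((1 + excess q q') / 2 + 1) := by positivity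
      have h5 : ((r + 1 + 1 : ℕ) : ℝ) * ((1 + excess q q') / 2 + 1) =
          r * ((1 + excess q q') / 2 + 1) + 2 * ((1 + excess q q') / 2 + 1) := by
        push_cast
        ring
      rw [h5] at h1
      linarith

/-- Denominators at least double every two steps, so `1 / √(Q k)` decays geometrically, with ratio
`81 / 100 = (9 / 10) ^ 2` over two steps; and `log q / q ≤ 2 / √q`. -/
theorem sum_log_div_le (h : IsConvergentSeq x P Q) (m : ℕ) :
    ∑ k ∈ Finset.range m, Real.log (Q k) / Q k ≤ 40 := by
  have hb : ∀ k, 1 / √(Q k : ℝ) ≤ 2 * (9 / 10) ^ k := by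
    have hstep : ∀ k, 1 / √(Q (k + 2) : ℝ) ≤ 81 / 100 * (1 / √(Q k : ℝ)) := by
      intro k
      have h1 : Q k ≤ Q (k + 1) := h.mono k
      have h2 := h.add_le k
      have h3 : (2 : ℝ) * Q k ≤ Q (k + 2) := by exact_mod_cast (by linarith : 2 * Q k ≤ Q (k + 2))
      have h4 : 0 < √(Q k : ℝ) := Real.sqrt_pos.2 (h.cast_pos k)
      have h5 : 100 / 81 * √(Q k : ℝ) ≤ √(Q (k + 2) : ℝ) := by
        refine Real.le_sqrt_of_sq_le ?_
        rw [mul_pow, Real.sq_sqrt (h.cast_pos k).le]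
        have := h.cast_pos k
        nlinarith
      calc 1 / √(Q (k + 2) : ℝ) ≤ 1 / (100 / 81 * √(Q k : ℝ)) := by gcongr
        _ = _ := by field_simp
    have hle1 : ∀ k, 1 / √(Q k : ℝ) ≤ 1 := by
      intro k
      have : (1 : ℝ) ≤ √(Q k : ℝ) := by
        rw [Real.one_le_sqrt]
        exact_mod_cast h.one_le k
      rw [div_le_one (by linarith)]
      exact this
    intro k
    induction k using Nat.twoStepInduction with
    | zero => linarith [hle1 0]
    | one => linarith [hle1 1]
    | more k ih _ =>
      refine (hstep k).trans ?_
      rw [pow_add]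
      linarith
  have hgeom : ∑ k ∈ Finset.range m, (9 / 10 : ℝ) ^ k ≤ 10 := by
    rw [geom_sum_eq (by norm_num)]
    have : (0 : ℝ) ≤ (9 / 10 : ℝ) ^ m := by positivity
    rw [div_le_iff_of_neg (by norm_num)]
    linarith
  calc ∑ k ∈ Finset.range m, Real.log (Q k) / Q k
      ≤ ∑ k ∈ Finset.range m, 4 * (9 / 10 : ℝ) ^ k := by
        refine Finset.sum_le_sum fun k _ => ?_
        have h0 := h.cast_pos k
        have h4 : 0 < √(Q k : ℝ) := Real.sqrt_pos.2 h0
        have h1 : Real.log (Q k) ≤ 2 * √(Q k : ℝ) := by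
          have h2 : Real.log (Q k) = 2 * Real.log (√(Q k : ℝ)) := by
            rw [Real.log_sqrt h0.le]; ring
          have := Real.log_le_self h4.le
          linarith
        have h2 : Real.log (Q k) / Q k ≤ 2 * (1 / √(Q k : ℝ)) := by
          rw [div_le_iff₀ h0]
          have h3 : 2 * (1 / √(Q k : ℝ)) * Q k = 2 * √(Q k : ℝ) := by
            nth_rewrite 2 [← Real.mul_self_sqrt h0.le]
            field_simp
          rw [h3]
          exact h1
        linarith [hb k]
    _ = 4 * ∑ k ∈ Finset.range m, (9 / 10 : ℝ) ^ k := by rw [Finset.mul_sum]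
    _ ≤ 40 := by linarith

end IsConvergentSeq

open IsConvergentSeq in
theorem abs_divisor_eq {ω : Fin 2 → ℝ} (h1 : ω 1 ≠ 0) (α : Fin 2 →₀ ℕ) (j : Fin 2) :
    |divisor ω α j| = |ω 1| * |shifted α j 0 * (-ω 0 / ω 1) - shifted α j 1| := by
  rw [← abs_mul, ← abs_neg]
  congr 1
  simp only [divisor, Fin.sum_univ_two, shifted]
  fin_cases j <;> simp <;> field_simp <;> ring

open IsConvergentSeq in
theorem BrunoSContFract.exists_isGevreyWeight {ω : Fin 2 → ℝ} {s : ℝ} (hs : 0 < s)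
    (hω : NonResonant ω) (h : BrunoSContFract (-ω 0 / ω 1) s) :
    ∃ M, IsGevreyWeight (invDivisor ω) s M := by
  obtain ⟨hirr, hlim⟩ := h
  set x := -ω 0 / ω 1 with hx
  obtain ⟨P, Q, hPQ, hQ⟩ := hirr.exists_isConvergentSeq
  have hω1 : 0 < |ω 1| := abs_pos.2 (hω.ne_zero 1)
  have hQ1 : ∀ k, (1 : ℝ) ≤ Q k := fun k => by exact_mod_cast hPQ.one_le k
  have hlogQ : ∀ k, 0 ≤ Real.log (Q k) := fun k => Real.log_nonneg (hQ1 k)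
  have hfin : ∀ N : ℕ, {k : ℕ | convDenom x k ≤ N}.Finite := by
    intro N
    have hk : ∀ k : ℕ, (k : ℤ) ≤ Q k + 1 := by
      intro k
      induction k using Nat.twoStepInduction with
      | zero => have := hPQ.one_le 0; omega
      | one => have := hPQ.one_le 1; omega
      | more k ih1 ih2 =>
        have := hPQ.add_le k
        have := hPQ.one_le k
        push_cast at *
        omega
    refine (Set.finite_Iic (N + 1)).subset fun k hk' => ?_
    have h1 : (Q k : ℝ) ≤ N := by rw [← hQ]; exact hk'
    have h2 : Q k ≤ N := by exact_mod_cast h1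
    have := hk k
    simp only [Set.mem_Iic]
    omega
  obtain ⟨C₁, hC₁⟩ := exists_eventually_le_of_limsup_lt_top hlim
  simp only [hQ] at hC₁
  obtain ⟨C, hC⟩ := exists_forall_sum_le (p := convDenom x)
    (x := fun j => Real.log (Q (j + 1)) / Q j) (C := C₁) hs.le hfin
    (fun k => div_nonneg (hlogQ _) (hPQ.cast_pos k).le)
    (hC₁.mono fun N hN => by linarith)
  have hdiv : ∀ k α, 2 ≤ α.degree → α ∉ nearLine x (Q k) →
      Real.log (invDivisor ω α) ≤ |Real.log (|ω 1| / 16)| + Real.log (Q k) := by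
    intro k α hα hmem
    refine hω.log_invDivisor_le hα fun j => ?_
    simp only [nearLine, Set.mem_ofPred_eq, not_and, not_exists, not_lt] at hmem
    have h1 := hmem hα j
    have h0 := hPQ.cast_pos k
    rw [abs_divisor_eq (hω.ne_zero 1), ← hx]
    have h2 : |ω 1| * (1 / (16 * Q k)) ≤ |ω 1| * |shifted α j 0 * x - shifted α j 1| := by gcongr
    refine le_trans ?_ h2
    rw [neg_add, Real.exp_add, Real.exp_neg (Real.log (Q k)), Real.exp_log h0]
    have h3 : Real.exp (-|Real.log (|ω 1| / 16)|) ≤ |ω 1| / 16 := by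
      rw [← Real.le_log_iff_exp_le (by positivity)]
      exact neg_abs_le _
    calc _ ≤ |ω 1| / 16 * (Q k : ℝ)⁻¹ := by gcongr
      _ = _ := by field_simp
  have hq2 : ∀ k, 2 ≤ Q (k + 1 + 1) := fun k => hPQ.two_le k
  have hq0 : ∀ k, 0 < Q k := fun k => by have := hPQ.one_le k; omega
  -- Scales start at `Q 2`, the first denominator certain to be at least `2`. This shifts the cutoff
  -- to `lastIndex - 1` and leaves the two initial terms of the sum unused.
  refine _root_.exists_isGevreyWeight (fun k => nearLine x (Q (k + 2)))
    (fun k => lineValue x (Q (k + 2)) (Q (k + 3))) (fun k => Real.log (Q (k + 3)))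
    (fun k => (1 + excess (Q (k + 2)) (Q (k + 3))) / Q (k + 2))
    (fun N => lastIndex (convDenom x) N - 1) (|Real.log (|ω 1| / 16)| + Real.log (Q 2))
    (C + 24 * 40) ?_ (fun k => hlogQ _) ?_ ?_ (fun α hα => hω.invDivisor_pos hα) ?_ ?_ ?_
    (fun α hα hmem => hdiv 2 α hα hmem) ?_ ?_
  · have := hlogQ 2
    positivity
  · intro k
    have := excess_nonneg (q' := Q (k + 3)) (hq0 (k + 2))
    have := hPQ.cast_pos (k + 2)
    positivity
  · intro N N' hN
    exact Nat.sub_le_sub_right (lastIndex_mono hfin hN) 1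
  · intro k γ hγ
    have := hPQ.le_height (k + 1) (hq2 k) hγ
    have := hq0 (k + 2)
    exact lineValue_le this (by linarith)
  · intro k α hα l hl hle
    exact hPQ.nearLine_packing (k + 1) (hq2 k) hα l hl hle
  · intro N k hk γ hγ
    have h1 := hPQ.le_height (k + 1) (hq2 k) hγ
    have h2 := height_le_degree (x := x) (Q (k + 1 + 1)) γ
    by_contra hc
    have h3 : Q (k + 2) ≤ N := by
      have : Q (k + 2) ≤ γ.degree := h1.trans h2
      omega
    have h4 : convDenom x (k + 2) ≤ N := by
      rw [hQ]
      exact_mod_cast h3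
    have := le_lastIndex (hfin N) h4
    omega
  · intro k α hα hmem
    have := hdiv (k + 3) α hα hmem
    have := hlogQ 2
    linarith
  · intro N hN
    set m := lastIndex (convDenom x) N - 1 with hm
    have h1 : ∀ k, Real.log (Q (k + 3)) * ((1 + excess (Q (k + 2)) (Q (k + 3))) / Q (k + 2)) ≤
        Real.log (Q (k + 2 + 1)) / Q (k + 2) + 24 * (Real.log (Q (k + 3)) / Q (k + 3)) := by
      intro k
      have h2 := mul_le_mul_of_nonneg_left (excess_div_le (hq0 (k + 2)) (hq0 (k + 3)))
        (hlogQ (k + 3))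
      calc _ = Real.log (Q (k + 3)) / Q (k + 2) +
            Real.log (Q (k + 3)) * (excess (Q (k + 2)) (Q (k + 3)) / Q (k + 2)) := by ring
        _ ≤ Real.log (Q (k + 3)) / Q (k + 2) + Real.log (Q (k + 3)) * (24 / Q (k + 3)) := by
          linarith
        _ = _ := by ring
    have h2 : ∑ k ∈ Finset.range m, Real.log (Q (k + 3)) / Q (k + 3) ≤ 40 := by
      refine le_trans ?_ (hPQ.sum_log_div_le (m + 3))
      rw [Finset.sum_range_succ', Finset.sum_range_succ', Finset.sum_range_succ']
      have := div_nonneg (hlogQ 0) (hPQ.cast_pos 0).le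
      have := div_nonneg (hlogQ 1) (hPQ.cast_pos 1).le
      have := div_nonneg (hlogQ 2) (hPQ.cast_pos 2).le
      simp only [zero_add, Nat.reduceAdd, add_assoc] at *
      linarith
    have h3 : ∑ k ∈ Finset.range m, Real.log (Q (k + 2 + 1)) / Q (k + 2) ≤
        s * Real.log N + C := by
      refine le_trans ?_ (hC N hN)
      rcases Nat.eq_zero_or_pos m with h0 | h0
      · rw [h0, Finset.sum_range_zero]
        exact Finset.sum_nonneg fun k _ => div_nonneg (hlogQ _) (hPQ.cast_pos k).le
      · have h4 : lastIndex (convDenom x) N + 1 = m + 2 := by omega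
        rw [h4, Finset.sum_range_succ', Finset.sum_range_succ']
        have := div_nonneg (hlogQ (0 + 1)) (hPQ.cast_pos 0).le
        have := div_nonneg (hlogQ (0 + 1 + 1)) (hPQ.cast_pos (0 + 1)).le
        linarith
    calc _ ≤ ∑ k ∈ Finset.range m, (Real.log (Q (k + 2 + 1)) / Q (k + 2) +
          24 * (Real.log (Q (k + 3)) / Q (k + 3))) := Finset.sum_le_sum fun k _ => h1 k
      _ = ∑ k ∈ Finset.range m, Real.log (Q (k + 2 + 1)) / Q (k + 2) +
          24 * ∑ k ∈ Finset.range m, Real.log (Q (k + 3)) / Q (k + 3) := by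
        rw [Finset.sum_add_distrib, Finset.mul_sum]
      _ ≤ _ := by linarith

/-! ### Weighted norms of polynomials -/

section WeightedNorm

open MvPolynomial

variable {σ : Type*} {w w₁ w₂ : (σ →₀ ℕ) → ℝ}

/-- The `ℓ¹` norm of the coefficients with weight `w`. -/
noncomputable def weightedNorm (w : (σ →₀ ℕ) → ℝ) (p : MvPolynomial σ ℂ) : ℝ :=
  ∑ α ∈ p.support, ‖coeff α p‖ * w α

theorem weightedNorm_eq_sum {p : MvPolynomial σ ℂ} {s : Finset (σ →₀ ℕ)} (h : p.support ⊆ s) :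
    weightedNorm w p = ∑ α ∈ s, ‖coeff α p‖ * w α := by
  refine Finset.sum_subset h fun α _ hα => ?_
  rw [notMem_support_iff.1 hα, norm_zero, zero_mul]

theorem weightedNorm_nonneg (hw : ∀ α, 0 ≤ w α) (p : MvPolynomial σ ℂ) : 0 ≤ weightedNorm w p :=
  Finset.sum_nonneg fun α _ => mul_nonneg (norm_nonneg _) (hw α)

theorem weightedNorm_add_le (hw : ∀ α, 0 ≤ w α) (p q : MvPolynomial σ ℂ) :
    weightedNorm w (p + q) ≤ weightedNorm w p + weightedNorm w q := by
  classical
  rw [weightedNorm_eq_sum (support_add (p := p) (q := q)),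
    weightedNorm_eq_sum (p := p) Finset.subset_union_left,
    weightedNorm_eq_sum (p := q) Finset.subset_union_right, ← Finset.sum_add_distrib]
  refine Finset.sum_le_sum fun α _ => ?_
  rw [← add_mul, coeff_add]
  exact mul_le_mul_of_nonneg_right (norm_add_le _ _) (hw α)

theorem weightedNorm_sum_le (hw : ∀ α, 0 ≤ w α) {ι : Type*} (s : Finset ι)
    (p : ι → MvPolynomial σ ℂ) : weightedNorm w (∑ i ∈ s, p i) ≤ ∑ i ∈ s, weightedNorm w (p i) := by
  classical
  induction s using Finset.induction_on with
  | empty => simp [weightedNorm]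
  | insert a s ha ih =>
    rw [Finset.sum_insert ha, Finset.sum_insert ha]
    exact (weightedNorm_add_le hw _ _).trans (by linarith)

theorem weightedNorm_monomial_le (α : σ →₀ ℕ) (a : ℂ) :
    weightedNorm w (monomial α a) ≤ ‖a‖ * w α := by
  classical
  rw [weightedNorm_eq_sum (s := {α}) support_monomial_subset]
  simp

theorem weightedNorm_X_le (i : σ) :
    weightedNorm w (X i) ≤ w (Finsupp.single i 1) := by
  refine (weightedNorm_monomial_le (Finsupp.single i 1) 1).trans ?_
  simp

/-- Three weights and a condition on the supports only, so that the weight of the product may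
include the inverse divisor when both factors vanish at the origin. -/
theorem weightedNorm_mul_le (hw : ∀ α, 0 ≤ w α) {p q : MvPolynomial σ ℂ}
    (h : ∀ α ∈ p.support, ∀ β ∈ q.support, w (α + β) ≤ w₁ α * w₂ β) :
    weightedNorm w (p * q) ≤ weightedNorm w₁ p * weightedNorm w₂ q := by
  rw [MvPolynomial.mul_def]
  simp only [Finsupp.sum]
  refine (weightedNorm_sum_le hw _ _).trans ?_
  rw [weightedNorm, Finset.sum_mul]
  refine Finset.sum_le_sum fun α hα => ?_
  refine (weightedNorm_sum_le hw _ _).trans ?_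
  rw [weightedNorm, Finset.mul_sum]
  refine Finset.sum_le_sum fun β hβ => ?_
  refine (weightedNorm_monomial_le _ _).trans ?_
  rw [norm_mul]
  calc _ ≤ ‖coeff α p‖ * ‖coeff β q‖ * (w₁ α * w₂ β) :=
        mul_le_mul_of_nonneg_left (h α hα β hβ) (by positivity)
    _ = _ := by ring

theorem weightedNorm_C_mul_le (a : ℂ) (p : MvPolynomial σ ℂ) :
    weightedNorm w (C a * p) ≤ ‖a‖ * weightedNorm w p := by
  classical
  have hsub : (C a * p).support ⊆ p.support := by
    intro α hα
    rw [mem_support_iff, coeff_C_mul] at hα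
    exact mem_support_iff.2 (right_ne_zero_of_mul hα)
  rw [weightedNorm_eq_sum hsub, weightedNorm, Finset.mul_sum]
  refine Finset.sum_le_sum fun α _ => le_of_eq ?_
  rw [coeff_C_mul, norm_mul]
  ring

/-- Multiply the coefficients by `d`. -/
noncomputable def coeffMultiplier (d : (σ →₀ ℕ) → ℂ) (p : MvPolynomial σ ℂ) : MvPolynomial σ ℂ :=
  ∑ α ∈ p.support, monomial α (d α * coeff α p)

theorem coeff_coeffMultiplier (d : (σ →₀ ℕ) → ℂ) (p : MvPolynomial σ ℂ) (α : σ →₀ ℕ) :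
    coeff α (coeffMultiplier d p) = d α * coeff α p := by
  classical
  simp only [coeffMultiplier, coeff_sum, coeff_monomial, Finset.sum_ite_eq']
  split_ifs with h
  · rfl
  · rw [notMem_support_iff.1 h, mul_zero]

theorem weightedNorm_coeffMultiplier_le (hw : ∀ α, 0 ≤ w α) {d : (σ →₀ ℕ) → ℂ}
    (hd : ∀ α, ‖d α‖ * w α ≤ w₁ α) (p : MvPolynomial σ ℂ) :
    weightedNorm w (coeffMultiplier d p) ≤ weightedNorm w₁ p := by
  refine (weightedNorm_sum_le hw _ _).trans (Finset.sum_le_sum fun α _ => ?_)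
  refine (weightedNorm_monomial_le _ _).trans ?_
  rw [norm_mul]
  nlinarith [hd α, norm_nonneg (coeff α p)]

theorem weightedNorm_prod_le (hw : ∀ α, 0 ≤ w α) (hmul : ∀ α β, w (α + β) ≤ w α * w β) {y : ℝ}
    (m : ℕ) (p : Fin (m + 1) → MvPolynomial σ ℂ) (hp : ∀ i, weightedNorm w (p i) ≤ y) :
    weightedNorm w (∏ i, p i) ≤ y ^ (m + 1) := by
  induction m with
  | zero => simpa using hp 0
  | succ m ih =>
    rw [Fin.prod_univ_succ, pow_succ']
    refine (weightedNorm_mul_le hw fun α _ β _ => hmul α β).trans ?_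
    have h0 := weightedNorm_nonneg hw (p 0)
    exact mul_le_mul (hp 0) (ih _ fun i => hp i.succ) (weightedNorm_nonneg hw _) (h0.trans (hp 0))

end WeightedNorm

/-! ### The order of a polynomial at the origin -/

section Order

open MvPolynomial

variable {σ : Type*}

/-- All coefficients of degree less than `d` vanish. -/
def VanishesToOrder (d : ℕ) (p : MvPolynomial σ ℂ) : Prop := ∀ α, α.degree < d → coeff α p = 0

theorem VanishesToOrder.mono {d e : ℕ} {p : MvPolynomial σ ℂ} (h : VanishesToOrder d p)
    (hed : e ≤ d) : VanishesToOrder e p := fun α hα => h α (hα.trans_le hed)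

theorem VanishesToOrder.add {d : ℕ} {p q : MvPolynomial σ ℂ} (hp : VanishesToOrder d p)
    (hq : VanishesToOrder d q) : VanishesToOrder d (p + q) := fun α hα => by
  rw [coeff_add, hp α hα, hq α hα, add_zero]

theorem VanishesToOrder.sum {d : ℕ} {ι : Type*} {s : Finset ι} {p : ι → MvPolynomial σ ℂ}
    (hp : ∀ i ∈ s, VanishesToOrder d (p i)) : VanishesToOrder d (∑ i ∈ s, p i) := fun α hα => by
  rw [coeff_sum]
  exact Finset.sum_eq_zero fun i hi => hp i hi α hα

theorem VanishesToOrder.mul {d e : ℕ} {p q : MvPolynomial σ ℂ} (hp : VanishesToOrder d p)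
    (hq : VanishesToOrder e q) : VanishesToOrder (d + e) (p * q) := fun α hα => by
  classical
  rw [coeff_mul]
  refine Finset.sum_eq_zero fun x hx => ?_
  rw [Finset.HasAntidiagonal.mem_antidiagonal] at hx
  rw [← hx, map_add] at hα
  rcases lt_or_ge x.1.degree d with h | h
  · rw [hp _ h, zero_mul]
  · rw [hq _ (by omega), mul_zero]

theorem VanishesToOrder.C_mul {d : ℕ} {p : MvPolynomial σ ℂ} (hp : VanishesToOrder d p) (a : ℂ) :
    VanishesToOrder d (C a * p) := fun α hα => by
  rw [coeff_C_mul, hp α hα, mul_zero]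

theorem VanishesToOrder.coeffMultiplier {d : ℕ} {p : MvPolynomial σ ℂ} (hp : VanishesToOrder d p)
    (e : (σ →₀ ℕ) → ℂ) : VanishesToOrder d (coeffMultiplier e p) := fun α hα => by
  rw [coeff_coeffMultiplier, hp α hα, mul_zero]

theorem VanishesToOrder.prod (m : ℕ) {p : Fin m → MvPolynomial σ ℂ}
    (hp : ∀ i, VanishesToOrder 1 (p i)) : VanishesToOrder m (∏ i, p i) := by
  induction m with
  | zero => exact fun α hα => absurd hα (Nat.not_lt_zero _)
  | succ m ih =>
    rw [Fin.prod_univ_succ]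
    exact ((hp 0).mul (ih fun i => hp i.succ)).mono (by omega)

theorem VanishesToOrder.prod_sub_prod {d : ℕ} (m : ℕ) {p q : Fin (m + 1) → MvPolynomial σ ℂ}
    (hp : ∀ i, VanishesToOrder 1 (p i)) (hq : ∀ i, VanishesToOrder 1 (q i))
    (hpq : ∀ i, VanishesToOrder d (p i - q i)) :
    VanishesToOrder (d + m) (∏ i, p i - ∏ i, q i) := by
  induction m with
  | zero => simpa using hpq 0
  | succ m ih =>
    rw [Fin.prod_univ_succ, Fin.prod_univ_succ (f := q)]
    have h1 := (hpq 0).mul (VanishesToOrder.prod (m + 1) fun i => hp i.succ)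
    have h2 := (hq 0).mul (ih (fun i => hp i.succ) (fun i => hq i.succ) fun i => hpq i.succ)
    have h3 : p 0 * ∏ i : Fin (m + 1), p i.succ - q 0 * ∏ i : Fin (m + 1), q i.succ =
        (p 0 - q 0) * ∏ i : Fin (m + 1), p i.succ +
          q 0 * (∏ i : Fin (m + 1), p i.succ - ∏ i : Fin (m + 1), q i.succ) := by ring
    rw [h3]
    exact h1.add (h2.mono (by omega))

end Order

/-! ### The polynomial linearization -/

section Linearization

open MvPolynomial

variable {n : ℕ}

/-- The composition of the homogeneous terms of degrees `2, …, N` with coefficients `c` and the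
polynomial map `h`. -/
noncomputable def compTerms (N : ℕ) (c : (m : ℕ) → (Fin m → Fin n) → Fin n → ℂ)
    (h : Fin n → MvPolynomial (Fin n) ℂ) (j : Fin n) : MvPolynomial (Fin n) ℂ :=
  ∑ m ∈ Finset.Icc 2 N, ∑ i : Fin m → Fin n, C (c m i j) * ∏ k, h (i k)

open Classical in
/-- The inverse of the homological operator, truncated to the degrees `2, …, N`. -/
noncomputable def homologicalInverse (ω : Fin n → ℝ) (N : ℕ) (j : Fin n) (α : Fin n →₀ ℕ) : ℂ :=
  if 2 ≤ α.degree ∧ α.degree ≤ N then (Complex.I * divisor ω α j)⁻¹ else 0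

/-- One step of the iteration that produces the linearization. -/
noncomputable def linearizationStep (ω : Fin n → ℝ) (N : ℕ)
    (c : (m : ℕ) → (Fin m → Fin n) → Fin n → ℂ) (h : Fin n → MvPolynomial (Fin n) ℂ)
    (j : Fin n) : MvPolynomial (Fin n) ℂ :=
  X j + coeffMultiplier (homologicalInverse ω N j) (compTerms N c h j)

/-- The iterates of `linearizationStep`, starting from the identity. -/
noncomputable def linearizationIterate (ω : Fin n → ℝ) (N : ℕ)
    (c : (m : ℕ) → (Fin m → Fin n) → Fin n → ℂ) : ℕ → Fin n → MvPolynomial (Fin n) ℂ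
  | 0 => X
  | r + 1 => linearizationStep ω N c (linearizationIterate ω N c r)

theorem vanishesToOrder_X (j : Fin n) : VanishesToOrder 1 (X j : MvPolynomial (Fin n) ℂ) := by
  intro α hα
  have h0 : α = 0 := by
    rw [← Finsupp.degree_eq_zero_iff]
    omega
  simp [h0]

theorem vanishesToOrder_coeffMultiplier_homologicalInverse (ω : Fin n → ℝ) (N : ℕ) (j : Fin n)
    (p : MvPolynomial (Fin n) ℂ) :
    VanishesToOrder 2 (coeffMultiplier (homologicalInverse ω N j) p) := by
  intro α hα
  rw [coeff_coeffMultiplier, homologicalInverse, if_neg (by omega), zero_mul]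

theorem vanishesToOrder_linearizationStep (ω : Fin n → ℝ) (N : ℕ)
    (c : (m : ℕ) → (Fin m → Fin n) → Fin n → ℂ) (h : Fin n → MvPolynomial (Fin n) ℂ) (j : Fin n) :
    VanishesToOrder 1 (linearizationStep ω N c h j) :=
  (vanishesToOrder_X j).add
    ((vanishesToOrder_coeffMultiplier_homologicalInverse ω N j _).mono (by omega))

theorem vanishesToOrder_linearizationIterate (ω : Fin n → ℝ) (N : ℕ)
    (c : (m : ℕ) → (Fin m → Fin n) → Fin n → ℂ) (r : ℕ) (j : Fin n) :
    VanishesToOrder 1 (linearizationIterate ω N c r j) := by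
  cases r with
  | zero => exact vanishesToOrder_X j
  | succ r => exact vanishesToOrder_linearizationStep ω N c _ j

theorem coeffMultiplier_sub (d : (Fin n →₀ ℕ) → ℂ) (p q : MvPolynomial (Fin n) ℂ) :
    coeffMultiplier d p - coeffMultiplier d q = coeffMultiplier d (p - q) := by
  ext α
  simp only [coeff_sub, coeff_coeffMultiplier]
  ring

theorem vanishesToOrder_compTerms_sub {d N : ℕ} {c : (m : ℕ) → (Fin m → Fin n) → Fin n → ℂ}
    {g h : Fin n → MvPolynomial (Fin n) ℂ} (hg : ∀ i, VanishesToOrder 1 (g i))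
    (hh : ∀ i, VanishesToOrder 1 (h i)) (hgh : ∀ i, VanishesToOrder d (g i - h i)) (j : Fin n) :
    VanishesToOrder (d + 1) (compTerms N c g j - compTerms N c h j) := by
  simp only [compTerms]
  rw [← Finset.sum_sub_distrib]
  refine VanishesToOrder.sum fun m hm => ?_
  rw [← Finset.sum_sub_distrib]
  refine VanishesToOrder.sum fun i _ => ?_
  rw [← mul_sub]
  refine VanishesToOrder.C_mul ?_ _
  obtain ⟨k, rfl⟩ : ∃ k, m = k + 1 + 1 := ⟨m - 2, by have := (Finset.mem_Icc.1 hm).1; omega⟩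
  exact (VanishesToOrder.prod_sub_prod (k + 1) (fun _ => hg _) (fun _ => hh _)
    fun _ => hgh _).mono (by omega)

theorem vanishesToOrder_compTerms {N : ℕ} {c : (m : ℕ) → (Fin m → Fin n) → Fin n → ℂ}
    {h : Fin n → MvPolynomial (Fin n) ℂ} (hh : ∀ i, VanishesToOrder 1 (h i)) (j : Fin n) :
    VanishesToOrder 2 (compTerms N c h j) := by
  refine VanishesToOrder.sum fun m hm => VanishesToOrder.sum fun i _ => VanishesToOrder.C_mul ?_ _
  exact (VanishesToOrder.prod m fun _ => hh _).mono (Finset.mem_Icc.1 hm).1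

/-- The nonlinearity starts in degree two, so each step raises the order of agreement by one. With
the truncation at degree `N`, the iteration is stationary from step `N` on. -/
theorem vanishesToOrder_linearizationIterate_succ_sub (ω : Fin n → ℝ) (N : ℕ)
    (c : (m : ℕ) → (Fin m → Fin n) → Fin n → ℂ) (r : ℕ) (j : Fin n) :
    VanishesToOrder (r + 2)
      (linearizationIterate ω N c (r + 1) j - linearizationIterate ω N c r j) := by
  induction r generalizing j with
  | zero =>
    simp only [linearizationIterate, linearizationStep, add_sub_cancel_left]
    exact vanishesToOrder_coeffMultiplier_homologicalInverse ω N j _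
  | succ r ih =>
    rw [linearizationIterate, linearizationStep]
    nth_rewrite 2 [linearizationIterate]
    rw [linearizationStep, add_sub_add_left_eq_sub, coeffMultiplier_sub]
    exact (vanishesToOrder_compTerms_sub (vanishesToOrder_linearizationIterate ω N c (r + 1))
      (vanishesToOrder_linearizationIterate ω N c r) ih j).coeffMultiplier _

theorem coeff_linearizationStep_of_lt {ω : Fin n → ℝ} {N : ℕ} (hN : 1 ≤ N)
    {c : (m : ℕ) → (Fin m → Fin n) → Fin n → ℂ} {h : Fin n → MvPolynomial (Fin n) ℂ} {j : Fin n}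
    {α : Fin n →₀ ℕ} (hα : N < α.degree) : coeff α (linearizationStep ω N c h j) = 0 := by
  classical
  have h1 : Finsupp.single j 1 ≠ α := by
    rintro rfl
    simp at hα
    omega
  rw [linearizationStep, coeff_add, coeff_coeffMultiplier, homologicalInverse, if_neg (by omega),
    zero_mul, add_zero, coeff_X, if_neg h1]

theorem linearizationStep_linearizationIterate (ω : Fin n → ℝ) {N : ℕ} (hN : 1 ≤ N)
    (c : (m : ℕ) → (Fin m → Fin n) → Fin n → ℂ) :
    linearizationStep ω N c (linearizationIterate ω N c N) = linearizationIterate ω N c N := by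
  funext j
  ext α
  obtain ⟨r, rfl⟩ : ∃ r, N = r + 1 := ⟨N - 1, by omega⟩
  rcases lt_or_ge (r + 1) α.degree with h | h
  · rw [coeff_linearizationStep_of_lt hN h]
    rw [linearizationIterate, coeff_linearizationStep_of_lt hN h]
  · have := vanishesToOrder_linearizationIterate_succ_sub ω (r + 1) c (r + 1) j α (by omega)
    rw [coeff_sub, sub_eq_zero] at this
    exact this

/-- Every product has at least two factors. Separating the first one uses the stronger inequality
for `w'` once, and the rest is submultiplicative for `w`; a geometric series finishes. -/
theorem weightedNorm_compTerms_le {w w' : (Fin n →₀ ℕ) → ℝ} (hw : ∀ α, 0 ≤ w α)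
    (hw' : ∀ α, 0 ≤ w' α) (hmul : ∀ α β, w (α + β) ≤ w α * w β)
    (hmul' : ∀ α β, α ≠ 0 → β ≠ 0 → w' (α + β) ≤ w α * w β)
    {N : ℕ} {c : (m : ℕ) → (Fin m → Fin n) → Fin n → ℂ} {a y : ℝ} (ha : 0 ≤ a) (hy : 0 ≤ y)
    (hc : ∀ m j, ∑ i, ‖c m i j‖ ≤ a ^ m) (hay : a * y ≤ 1 / 2)
    {h : Fin n → MvPolynomial (Fin n) ℂ} (hh : ∀ i, VanishesToOrder 1 (h i))
    (hy' : ∀ i, weightedNorm w (h i) ≤ y) (j : Fin n) :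
    weightedNorm w' (compTerms N c h j) ≤ 2 * (a * y) ^ 2 := by
  have hprod : ∀ m, 2 ≤ m → ∀ i : Fin m → Fin n, weightedNorm w' (∏ k, h (i k)) ≤ y ^ m := by
    intro m hm i
    obtain ⟨k, rfl⟩ : ∃ k, m = k + 1 + 1 := ⟨m - 2, by omega⟩
    rw [Fin.prod_univ_succ, pow_succ']
    have hne : ∀ {d : ℕ} {p : MvPolynomial (Fin n) ℂ}, 1 ≤ d → VanishesToOrder d p →
        ∀ α ∈ p.support, α ≠ 0 := by
      rintro d p hd hp α hα rfl
      exact mem_support_iff.1 hα (hp 0 (by rw [map_zero]; omega))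
    refine (weightedNorm_mul_le (w₁ := w) (w₂ := w) hw' fun α hα β hβ => hmul' α β
      (hne le_rfl (hh _) α hα) (hne (by omega)
        (VanishesToOrder.prod (k + 1) fun _ => hh _) β hβ)).trans ?_
    exact mul_le_mul (hy' _) (weightedNorm_prod_le hw hmul k _ fun _ => hy' _)
      (weightedNorm_nonneg hw _) hy
  have hm : ∀ m ∈ Finset.Icc 2 N, weightedNorm w' (∑ i : Fin m → Fin n,
      C (c m i j) * ∏ k, h (i k)) ≤ (a * y) ^ m := by
    intro m hm
    refine (weightedNorm_sum_le hw' _ _).trans ?_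
    calc _ ≤ ∑ i : Fin m → Fin n, ‖c m i j‖ * y ^ m := by
          refine Finset.sum_le_sum fun i _ => (weightedNorm_C_mul_le _ _).trans ?_
          exact mul_le_mul_of_nonneg_left (hprod m (Finset.mem_Icc.1 hm).1 i) (norm_nonneg _)
      _ = (∑ i : Fin m → Fin n, ‖c m i j‖) * y ^ m := by rw [Finset.sum_mul]
      _ ≤ a ^ m * y ^ m := mul_le_mul_of_nonneg_right (hc m j) (by positivity)
      _ = (a * y) ^ m := by rw [mul_pow]
  have hz : 0 ≤ a * y := mul_nonneg ha hy
  have hgeom : ∀ K : ℕ, ∑ m ∈ Finset.range K, (a * y) ^ m ≤ 2 := by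
    intro K
    rw [geom_sum_eq (by linarith), div_le_iff_of_neg (by linarith)]
    have : 0 ≤ (a * y) ^ K := by positivity
    linarith
  calc weightedNorm w' (compTerms N c h j) ≤ ∑ m ∈ Finset.Icc 2 N, (a * y) ^ m :=
        (weightedNorm_sum_le hw' _ _).trans (Finset.sum_le_sum hm)
    _ = ∑ m ∈ Finset.range (N + 1 - 2), (a * y) ^ 2 * (a * y) ^ m := by
        rw [← Finset.Ico_add_one_right_eq_Icc, Finset.sum_Ico_eq_sum_range]
        simp only [pow_add]
    _ = (a * y) ^ 2 * ∑ m ∈ Finset.range (N + 1 - 2), (a * y) ^ m := by rw [Finset.mul_sum]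
    _ ≤ 2 * (a * y) ^ 2 := by nlinarith [hgeom (N + 1 - 2), sq_nonneg (a * y)]

/-- The inverse divisor is moved into the weight `w'`, where splitting products absorbs it. The
bound is therefore independent of `N` and of the number of steps. -/
theorem weightedNorm_linearizationIterate_le {ω : Fin n → ℝ} {w : (Fin n →₀ ℕ) → ℝ}
    (hw : ∀ α, 0 ≤ w α) (hmul : ∀ α β, w (α + β) ≤ w α * w β)
    (hmul' : ∀ α β, α ≠ 0 → β ≠ 0 → invDivisor ω (α + β) * w (α + β) ≤ w α * w β)
    {N : ℕ} {c : (m : ℕ) → (Fin m → Fin n) → Fin n → ℂ} {a y : ℝ} (ha : 0 ≤ a) (hy : 0 ≤ y)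
    (hc : ∀ m j, ∑ i, ‖c m i j‖ ≤ a ^ m) (hay : a * y ≤ 1 / 2) (hy2 : 2 * (a * y) ^ 2 ≤ y / 2)
    (hX : ∀ j, w (Finsupp.single j 1) ≤ y / 2) (r : ℕ) (j : Fin n) :
    weightedNorm w (linearizationIterate ω N c r j) ≤ y := by
  have hX' : ∀ j, weightedNorm w (X j) ≤ y / 2 := fun j => (weightedNorm_X_le j).trans (hX j)
  have hinv : ∀ α, 0 ≤ invDivisor ω α := fun α =>
    (inv_nonneg.2 (abs_nonneg _)).trans (inv_abs_divisor_le ω α j)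
  induction r generalizing j with
  | zero => exact (hX' j).trans (by linarith)
  | succ r ih =>
    rw [linearizationIterate, linearizationStep]
    refine (weightedNorm_add_le hw _ _).trans ?_
    have h1 : weightedNorm w (coeffMultiplier (homologicalInverse ω N j)
        (compTerms N c (linearizationIterate ω N c r) j)) ≤
        weightedNorm (fun α => invDivisor ω α * w α)
          (compTerms N c (linearizationIterate ω N c r) j) := by
      refine weightedNorm_coeffMultiplier_le hw (fun α => ?_) _
      refine mul_le_mul_of_nonneg_right ?_ (hw α)
      rw [homologicalInverse]
      split_ifs
      · rw [norm_inv, norm_mul, Complex.norm_I, one_mul, Complex.norm_real, Real.norm_eq_abs]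
        exact inv_abs_divisor_le ω α j
      · simpa using hinv α
    have h2 := weightedNorm_compTerms_le (N := N) hw (fun α => mul_nonneg (hinv α) (hw α)) hmul
      hmul' ha hy hc hay (vanishesToOrder_linearizationIterate ω N c r) (fun i => ih i) j
    linarith [hX' j]

/-- A polynomial map tangent to the identity of degree at most `N` that solves the linearization
equation up to degree `N`. -/
structure IsTruncatedLinearization (ω : Fin n → ℝ) (N : ℕ)
    (c : (m : ℕ) → (Fin m → Fin n) → Fin n → ℂ) (H : Fin n → MvPolynomial (Fin n) ℂ) : Prop where
  order_sub : ∀ j, VanishesToOrder 2 (H j - X j)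
  coeff_of_lt : ∀ j α, N < α.degree → coeff α (H j) = 0
  homological : ∀ j α, 2 ≤ α.degree → α.degree ≤ N →
    Complex.I * divisor ω α j * coeff α (H j) = coeff α (compTerms N c H j)

theorem isTruncatedLinearization_iterate {ω : Fin n → ℝ} (hω : NonResonant ω) {N : ℕ} (hN : 1 ≤ N)
    (c : (m : ℕ) → (Fin m → Fin n) → Fin n → ℂ) :
    IsTruncatedLinearization ω N c (linearizationIterate ω N c N) := by
  have hfix := linearizationStep_linearizationIterate ω hN c
  refine ⟨fun j => ?_, fun j α hα => ?_, fun j α hα hαN => ?_⟩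
  · rw [← hfix, linearizationStep, add_sub_cancel_left]
    exact vanishesToOrder_coeffMultiplier_homologicalInverse ω N j _
  · rw [← hfix, coeff_linearizationStep_of_lt hN hα]
  · classical
    have h1 : Finsupp.single j 1 ≠ α := by
      rintro rfl
      simp at hα
    conv_lhs => rw [← hfix]
    rw [linearizationStep, coeff_add, coeff_coeffMultiplier, homologicalInverse,
      if_pos ⟨hα, hαN⟩, coeff_X, if_neg h1, zero_add, ← mul_assoc, mul_inv_cancel₀, one_mul]
    refine mul_ne_zero Complex.I_ne_zero ?_
    exact_mod_cast hω.divisor_ne_zero hα j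

end Linearization

/-! ### Evaluation of polynomials -/

section Evaluation

open MvPolynomial Topology

variable {n : ℕ}

theorem norm_eval_le_weightedNorm {z : Fin n → ℂ} {ρ : ℝ} (hz : ‖z‖ ≤ ρ)
    (p : MvPolynomial (Fin n) ℂ) :
    ‖eval z p‖ ≤ weightedNorm (fun α => ρ ^ α.degree) p := by
  rw [eval_eq', weightedNorm]
  refine (norm_sum_le _ _).trans (Finset.sum_le_sum fun α _ => ?_)
  rw [norm_mul, norm_prod, Finsupp.degree_eq_sum, ← Finset.prod_pow_eq_pow_sum]
  refine mul_le_mul_of_nonneg_left (Finset.prod_le_prod (fun i _ => norm_nonneg _) fun i _ => ?_)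
    (norm_nonneg _)
  rw [norm_pow]
  exact pow_le_pow_left₀ (norm_nonneg _) ((norm_le_pi_norm z i).trans hz) _

theorem VanishesToOrder.isBigO_eval {d : ℕ} {p : MvPolynomial (Fin n) ℂ}
    (hp : VanishesToOrder d p) : (fun z => eval z p) =O[𝓝 0] fun z : Fin n → ℂ => ‖z‖ ^ d := by
  refine Asymptotics.IsBigO.of_bound (weightedNorm (fun _ => 1) p) ?_
  filter_upwards [Metric.closedBall_mem_nhds (0 : Fin n → ℂ) one_pos] with z hz
  rw [mem_closedBall_zero_iff] at hz
  refine (norm_eval_le_weightedNorm le_rfl p).trans ?_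
  rw [weightedNorm, weightedNorm, Finset.sum_mul]
  refine Finset.sum_le_sum fun α hα => ?_
  have hd : d ≤ α.degree := by
    by_contra h
    exact mem_support_iff.1 hα (hp α (not_le.1 h))
  rw [mul_one, norm_pow, norm_norm]
  exact mul_le_mul_of_nonneg_left (pow_le_pow_of_le_one (norm_nonneg _) hz hd) (norm_nonneg _)

theorem hasFDerivAt_eval (p : MvPolynomial (Fin n) ℂ) (z : Fin n → ℂ) :
    HasFDerivAt (fun z => eval z p)
      (∑ k, eval z (pderiv k p) • ContinuousLinearMap.proj (R := ℂ) (φ := fun _ : Fin n => ℂ) k)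
      z := by
  induction p using MvPolynomial.induction_on with
  | C a =>
    simp only [eval_C]
    refine (hasFDerivAt_const (𝕜 := ℂ) a z).congr_fderiv ?_
    ext v
    simp
  | add p q hp hq =>
    simp only [map_add]
    refine (hp.fun_add hq).congr_fderiv ?_
    ext v
    simp [add_mul, Finset.sum_add_distrib]
  | mul_X p i hp =>
    have h1 := hp.mul (hasFDerivAt_apply (𝕜 := ℂ) (F' := fun _ : Fin n => ℂ) i z)
    simp only [map_mul, eval_X]
    refine h1.congr_fderiv ?_
    ext v
    simp only [Derivation.leibniz, pderiv_X, smul_eq_mul, map_add, map_mul, eval_X,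
      add_apply, smul_apply, sum_apply,
      ContinuousLinearMap.proj_apply, add_mul, Finset.sum_add_distrib]
    congr 1
    · rw [Finset.sum_eq_single i]
      · simp
      · intro b _ hb
        simp [hb.symm]
      · simp
    · rw [Finset.mul_sum]
      exact Finset.sum_congr rfl fun k _ => by ring

theorem sum_mul_eval_pderiv (ν : Fin n → ℂ) (p : MvPolynomial (Fin n) ℂ) (z : Fin n → ℂ) :
    ∑ k, eval z (pderiv k p) * (ν k * z k) =
      eval z (coeffMultiplier (fun α => ∑ k, (α k : ℂ) * ν k) p) := by
  conv_lhs => rw [p.as_sum]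
  simp only [coeffMultiplier, map_sum, Finset.sum_mul]
  rw [Finset.sum_comm]
  refine Finset.sum_congr rfl fun α _ => ?_
  have h1 : ∀ k, eval z (pderiv k (monomial α (coeff α p))) * (ν k * z k) =
      (α k * ν k) * eval z (monomial α (coeff α p)) := by
    intro k
    have h2 := congrArg (eval z) (X_mul_pderiv_monomial (i := k) (m := α) (r := coeff α p))
    rw [map_mul, eval_X, map_nsmul, nsmul_eq_mul] at h2
    linear_combination ν k * h2
  rw [Finset.sum_congr rfl fun k _ => h1 k]
  simp only [eval_monomial]
  exact Finset.sum_congr rfl fun k _ => by ring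

end Evaluation

/-! ### The truncated normal form -/

section NormalForm

open MvPolynomial Topology

variable {n : ℕ}

/-- The linear vector field `z ↦ (i ω_j z_j)_j`. -/
noncomputable def linearField (ω : Fin n → ℝ) : (Fin n → ℂ) →L[ℂ] (Fin n → ℂ) :=
  ContinuousLinearMap.pi fun j => (Complex.I * (ω j : ℂ)) • ContinuousLinearMap.proj j

@[simp]
theorem linearField_apply (ω : Fin n → ℝ) (z : Fin n → ℂ) (j : Fin n) :
    linearField ω z j = Complex.I * ω j * z j := rfl

/-- The polynomial map with components `H`. -/
noncomputable def polyMap (H : Fin n → MvPolynomial (Fin n) ℂ) (z : Fin n → ℂ) : Fin n → ℂ :=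
  fun j => eval z (H j)

theorem analyticAt_polyMap (H : Fin n → MvPolynomial (Fin n) ℂ) (z : Fin n → ℂ) :
    AnalyticAt ℂ (polyMap H) z :=
  AnalyticAt.pi fun j => AnalyticOnNhd.eval_mvPolynomial (H j) z (Set.mem_univ z)

theorem fderiv_polyMap_linearField (H : Fin n → MvPolynomial (Fin n) ℂ) (ω : Fin n → ℝ)
    (z : Fin n → ℂ) (j : Fin n) : fderiv ℂ (polyMap H) z (linearField ω z) j =
      eval z (coeffMultiplier (fun α => ∑ k, (α k : ℂ) * (Complex.I * ω k)) (H j)) := by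
  rw [(hasFDerivAt_pi.2 fun j => hasFDerivAt_eval (H j) z : HasFDerivAt (polyMap H) _ z).fderiv,
    ← sum_mul_eval_pderiv]
  simp [mul_assoc]

/-- The coefficients of the homogeneous terms of a power series in coordinates. -/
noncomputable def seriesCoeff (p : FormalMultilinearSeries ℂ (Fin n → ℂ) (Fin n → ℂ)) (m : ℕ)
    (i : Fin m → Fin n) (j : Fin n) : ℂ := p m (fun k => Pi.single (i k) 1) j

theorem series_apply_eq_sum (p : FormalMultilinearSeries ℂ (Fin n → ℂ) (Fin n → ℂ)) (m : ℕ)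
    (v : Fin n → ℂ) (j : Fin n) :
    p m (fun _ => v) j = ∑ i : Fin m → Fin n, seriesCoeff p m i j * ∏ k, v (i k) := by
  have hv : v = ∑ i, v i • (Pi.single i 1 : Fin n → ℂ) := by
    ext a
    simp [Finset.sum_apply, Pi.single_apply]
  conv_lhs => rw [hv]
  rw [ContinuousMultilinearMap.map_sum]
  simp only [ContinuousMultilinearMap.map_smul_univ, Finset.sum_apply, Pi.smul_apply, smul_eq_mul,
    seriesCoeff]
  exact Finset.sum_congr rfl fun i _ => mul_comm _ _

theorem exists_sum_norm_seriesCoeff_le {p : FormalMultilinearSeries ℂ (Fin n → ℂ) (Fin n → ℂ)}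
    (hp : 0 < p.radius) (h0 : ∀ v, p 0 v = 0) :
    ∃ a : ℝ, 1 ≤ a ∧ ∀ m j, ∑ i, ‖seriesCoeff p m i j‖ ≤ a ^ m := by
  obtain ⟨r, hr0, hr⟩ := ENNReal.lt_iff_exists_nnreal_btwn.1 hp
  have hr0' : 0 < r := by exact_mod_cast hr0
  obtain ⟨C, hC, hb⟩ := p.norm_le_div_pow_of_pos_of_lt_radius hr0' hr
  have hrR : (0 : ℝ) < r := hr0'
  -- The `n ^ m` index tuples put `n` into the base, and for `m ≥ 1` the prefactor `C` fits into the
  -- `m`-th power; degree `0` has no term.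
  set a : ℝ := 1 + (1 + C) * (n / r) with ha
  have hnr : (0 : ℝ) ≤ n / r := by positivity
  refine ⟨a, by rw [ha]; nlinarith, fun m j => ?_⟩
  rcases Nat.eq_zero_or_pos m with rfl | hm
  · simp [seriesCoeff, h0]
  · have h1 : ∀ i : Fin m → Fin n, ‖seriesCoeff p m i j‖ ≤ C / r ^ m := by
      intro i
      refine (norm_le_pi_norm _ j).trans ?_
      refine ((p m).le_opNorm _).trans ?_
      have : ∏ k, ‖(Pi.single (i k) 1 : Fin n → ℂ)‖ ≤ 1 := by
        refine Finset.prod_le_one (fun _ _ => norm_nonneg _) fun k _ => ?_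
        rw [Pi.norm_single]
        simp
      calc ‖p m‖ * ∏ k, ‖(Pi.single (i k) 1 : Fin n → ℂ)‖ ≤ ‖p m‖ * 1 := by gcongr
        _ ≤ _ := by rw [mul_one]; exact hb m
    calc ∑ i, ‖seriesCoeff p m i j‖ ≤ ∑ _i : Fin m → Fin n, C / (r : ℝ) ^ m :=
          Finset.sum_le_sum fun i _ => h1 i
      _ = C * (n / r) ^ m := by
          simp [Finset.card_univ, div_pow]
          ring
      _ ≤ (1 + C) ^ m * (n / r) ^ m := by
          gcongr
          calc C ≤ 1 + C := by linarith
            _ ≤ (1 + C) ^ m := le_self_pow₀ (by linarith) (by omega)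
      _ = ((1 + C) * (n / r)) ^ m := by rw [mul_pow]
      _ ≤ a ^ m := by
          gcongr
          rw [ha]
          linarith

theorem partialSum_apply_eq {p : FormalMultilinearSeries ℂ (Fin n → ℂ) (Fin n → ℂ)}
    (h0 : ∀ v, p 0 v = 0) (h1 : ∀ v, p 1 v = 0) {N : ℕ}
    (H : Fin n → MvPolynomial (Fin n) ℂ) (z : Fin n → ℂ) (j : Fin n) :
    p.partialSum (N + 1) (polyMap H z) j = eval z (compTerms N (seriesCoeff p) H j) := by
  have hsub : Finset.Icc 2 N ⊆ Finset.range (N + 1) := by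
    intro m hm
    have := (Finset.mem_Icc.1 hm).2
    simp only [Finset.mem_range]
    omega
  rw [FormalMultilinearSeries.partialSum, ← Finset.sum_subset hsub, compTerms, Finset.sum_apply,
    map_sum]
  · refine Finset.sum_congr rfl fun m _ => ?_
    rw [series_apply_eq_sum, map_sum]
    refine Finset.sum_congr rfl fun i _ => ?_
    simp [polyMap, map_prod]
  · intro m hm hm'
    have h2 : m = 0 ∨ m = 1 := by
      simp only [Finset.mem_range, Finset.mem_Icc] at hm hm'
      omega
    rcases h2 with rfl | rfl
    · exact h0 _
    · exact h1 _

/-- In degrees `2` to `N` this is the homological equation. Below that `H j` agrees with `X j`,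
whose divisor is zero. -/
theorem IsTruncatedLinearization.vanishesToOrder_remainder {ω : Fin n → ℝ} {N : ℕ}
    {c : (m : ℕ) → (Fin m → Fin n) → Fin n → ℂ} {H : Fin n → MvPolynomial (Fin n) ℂ}
    (hH : IsTruncatedLinearization ω N c H) (hH1 : ∀ j, VanishesToOrder 1 (H j)) (j : Fin n) :
    VanishesToOrder (N + 1) (compTerms N c H j -
      coeffMultiplier (fun α => Complex.I * divisor ω α j) (H j)) := by
  classical
  intro α hα
  rw [coeff_sub, coeff_coeffMultiplier]
  rcases lt_or_ge α.degree 2 with h | h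
  · rw [vanishesToOrder_compTerms hH1 j α h, zero_sub, neg_eq_zero]
    have h1 := hH.order_sub j α h
    rw [coeff_sub, sub_eq_zero] at h1
    rw [h1, coeff_X]
    split_ifs with hα'
    · subst hα'
      have : divisor ω (Finsupp.single j 1) j = 0 := by
        rw [divisor, Finset.sum_eq_single j] <;> simp +contextual [eq_comm]
      simp [this]
    · simp
  · rw [hH.homological j α h (by omega), sub_self]

theorem isLittleO_normalForm_remainder {ω : Fin n → ℝ} {N : ℕ}
    {F f : (Fin n → ℂ) → (Fin n → ℂ)}
    (hFf : ∀ᶠ z in 𝓝 0, F z = linearField ω z + f z)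
    {p : FormalMultilinearSeries ℂ (Fin n → ℂ) (Fin n → ℂ)} (hp : HasFPowerSeriesAt f p 0)
    (h0 : ∀ v, p 0 v = 0) (h1 : ∀ v, p 1 v = 0) {H : Fin n → MvPolynomial (Fin n) ℂ}
    (hH : IsTruncatedLinearization ω N (seriesCoeff p) H) (hH1 : ∀ j, VanishesToOrder 1 (H j)) :
    (fun z => F (polyMap H z) - fderiv ℂ (polyMap H) z (linearField ω z)) =o[𝓝 0]
      fun z => ‖z‖ ^ N := by
  have hbig : polyMap H =O[𝓝 0] fun z : Fin n → ℂ => ‖z‖ := by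
    rw [Asymptotics.isBigO_pi]
    intro j
    have := (hH1 j).isBigO_eval
    simp only [pow_one] at this
    exact this
  have hz0 : polyMap H 0 = 0 := by
    funext j
    have := hH1 j 0 (by simp)
    simpa [polyMap, constantCoeff_eq, eval_zero] using this
  have htend : Tendsto (polyMap H) (𝓝 0) (𝓝 0) := by
    have := (analyticAt_polyMap H 0).continuousAt.tendsto
    rwa [hz0] at this
  have hser : (fun z => f (polyMap H z) - p.partialSum (N + 1) (polyMap H z)) =O[𝓝 0]
      fun z : Fin n → ℂ => ‖z‖ ^ (N + 1) := by
    have h2 := (hp.isBigO_sub_partialSum_pow (N + 1)).comp_tendsto htend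
    simp only [zero_add, Function.comp_def] at h2
    exact h2.trans (hbig.norm_left.pow (N + 1))
  have hpoly : (fun z j => eval z (compTerms N (seriesCoeff p) H j -
      coeffMultiplier (fun α => Complex.I * divisor ω α j) (H j))) =O[𝓝 0]
      fun z : Fin n → ℂ => ‖z‖ ^ (N + 1) := by
    rw [Asymptotics.isBigO_pi]
    exact fun j => (hH.vanishesToOrder_remainder hH1 j).isBigO_eval
  have hpow : (fun z : Fin n → ℂ => ‖z‖ ^ (N + 1)) =o[𝓝 0] fun z : Fin n → ℂ => ‖z‖ ^ N := by
    have h3 : (fun z : Fin n → ℂ => ‖z‖) =o[𝓝 0] fun _ : Fin n → ℂ => (1 : ℝ) := by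
      rw [Asymptotics.isLittleO_one_iff]
      simpa using (continuous_norm (E := Fin n → ℂ)).tendsto 0
    simpa [pow_succ] using
      (Asymptotics.isBigO_refl (fun z : Fin n → ℂ => ‖z‖ ^ N) (𝓝 0)).mul_isLittleO h3
  refine ((hser.add hpoly).trans_isLittleO hpow).congr' ?_ EventuallyEq.rfl
  filter_upwards [htend.eventually hFf] with z hz
  rw [hz]
  funext j
  simp only [Pi.add_apply, Pi.sub_apply]
  rw [partialSum_apply_eq h0 h1, fderiv_polyMap_linearField, linearField_apply, map_sub]
  have h4 : coeffMultiplier (fun α => ∑ k, (α k : ℂ) * (Complex.I * ω k)) (H j) =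
      coeffMultiplier (fun α => Complex.I * divisor ω α j) (H j) +
        C (Complex.I * (ω j : ℂ)) * H j := by
    ext α
    rw [coeff_add, coeff_C_mul, coeff_coeffMultiplier, coeff_coeffMultiplier, divisor]
    push_cast
    rw [mul_sub, Finset.mul_sum, ← add_mul, sub_add_cancel]
    congr 1
    exact Finset.sum_congr rfl fun k _ => by ring
  rw [h4, map_add, map_mul, eval_C]
  simp only [polyMap]
  ring

end NormalForm

/-! ### Bounds for the truncated normal form -/

section NormalFormBounds

open MvPolynomial Topology

variable {n : ℕ}

theorem norm_eval_sub_X_le {w : (Fin n →₀ ℕ) → ℝ} (hw : ∀ α, 0 ≤ w α) {ρ κ y : ℝ} (hκ : 0 ≤ κ)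
    {p : MvPolynomial (Fin n) ℂ} {j : Fin n} (hp : VanishesToOrder 2 (p - X j))
    (hy : weightedNorm w p ≤ y) (h : ∀ α ∈ p.support, 2 ≤ α.degree → ρ ^ α.degree ≤ κ * w α)
    {z : Fin n → ℂ} (hz : ‖z‖ ≤ ρ) : ‖eval z (p - X j)‖ ≤ κ * y := by
  classical
  have hsupp : ∀ α ∈ (p - X j).support, 2 ≤ α.degree ∧ coeff α (p - X j) = coeff α p := by
    intro α hα
    have hdeg : 2 ≤ α.degree := by
      by_contra hlt
      exact mem_support_iff.1 hα (hp α (not_le.1 hlt))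
    refine ⟨hdeg, ?_⟩
    rw [coeff_sub, coeff_X, if_neg, sub_zero]
    rintro rfl
    simp at hdeg
  have hsub : (p - X j).support ⊆ p.support := fun α hα => by
    rw [mem_support_iff, ← (hsupp α hα).2]
    exact mem_support_iff.1 hα
  calc ‖eval z (p - X j)‖ ≤ weightedNorm (fun α => ρ ^ α.degree) (p - X j) :=
        norm_eval_le_weightedNorm hz _
    _ ≤ ∑ α ∈ (p - X j).support, κ * (‖coeff α p‖ * w α) := by
        refine Finset.sum_le_sum fun α hα => ?_
        rw [(hsupp α hα).2]
        calc _ ≤ ‖coeff α p‖ * (κ * w α) :=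
              mul_le_mul_of_nonneg_left (h α (hsub hα) (hsupp α hα).1) (norm_nonneg _)
          _ = _ := by ring
    _ ≤ ∑ α ∈ p.support, κ * (‖coeff α p‖ * w α) :=
        Finset.sum_le_sum_of_subset_of_nonneg hsub fun α _ _ => by have := hw α; positivity
    _ = κ * weightedNorm w p := by rw [weightedNorm, Finset.mul_sum]
    _ ≤ κ * y := mul_le_mul_of_nonneg_left hy hκ

/-- The factor `N ^ (-s)` in the radius beats the Gevrey growth: `(m / N) ^ (s m) ≤ (m / N) ^ s`,
and `m ^ s ≤ exp (s m)`. One factor `N ^ (-s)` survives, which makes the deviation from the identity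
proportional to the radius. -/
theorem pow_mul_rpow_le {s K t c : ℝ} (hs : 0 < s) (hK : 0 < K) (ht : 0 < t) (hc : 0 < c)
    (hBc : K * Real.exp s / t * c ≤ 1) {N m : ℕ} (hm : 2 ≤ m) (hmN : m ≤ N) :
    (c / (N : ℝ) ^ s) ^ m * (K ^ m * (m : ℝ) ^ (s * m)) / t ^ m ≤
      (K * Real.exp s / t * c) ^ 2 / (N : ℝ) ^ s := by
  have hm0 : (0 : ℝ) < m := by exact_mod_cast (by omega : 0 < m)
  have hN0 : (0 : ℝ) < N := by exact_mod_cast (by omega : 0 < N)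
  have hNs : 0 < (N : ℝ) ^ s := Real.rpow_pos_of_pos hN0 s
  have h1 : (m : ℝ) ^ (s * m) / ((N : ℝ) ^ s) ^ m ≤ Real.exp s ^ m / (N : ℝ) ^ s := by
    have e1 : ((N : ℝ) ^ s) ^ m = (N : ℝ) ^ (s * m) := by
      rw [Real.rpow_mul hN0.le, Real.rpow_natCast]
    rw [e1, ← Real.div_rpow hm0.le hN0.le]
    have hle1 : (m : ℝ) / N ≤ 1 := by
      rw [div_le_one hN0]
      exact_mod_cast hmN
    have h2 : s ≤ s * m := le_mul_of_one_le_right hs.le (by exact_mod_cast (by omega : 1 ≤ m))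
    calc ((m : ℝ) / N) ^ (s * m) ≤ ((m : ℝ) / N) ^ s :=
          Real.rpow_le_rpow_of_exponent_ge (by positivity) hle1 h2
      _ = (m : ℝ) ^ s / (N : ℝ) ^ s := Real.div_rpow hm0.le hN0.le s
      _ ≤ Real.exp s ^ m / (N : ℝ) ^ s := by
          gcongr
          rw [Real.rpow_def_of_pos hm0, ← Real.exp_nat_mul]
          refine Real.exp_le_exp.2 ?_
          have := Real.log_le_self hm0.le
          nlinarith
  calc (c / (N : ℝ) ^ s) ^ m * (K ^ m * (m : ℝ) ^ (s * m)) / t ^ m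
      = (c * K / t) ^ m * ((m : ℝ) ^ (s * m) / ((N : ℝ) ^ s) ^ m) := by
        rw [div_pow, div_pow, mul_pow]
        field_simp
    _ ≤ (c * K / t) ^ m * (Real.exp s ^ m / (N : ℝ) ^ s) := by gcongr
    _ = (K * Real.exp s / t * c) ^ m / (N : ℝ) ^ s := by
        rw [← mul_div_assoc, ← mul_pow]
        congr 2
        ring
    _ ≤ (K * Real.exp s / t * c) ^ 2 / (N : ℝ) ^ s := by
        have h3 : (K * Real.exp s / t * c) ^ m ≤ (K * Real.exp s / t * c) ^ 2 :=
          pow_le_pow_of_le_one (by positivity) hBc hm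
        gcongr

theorem exists_truncatedLinearization {ω : Fin n → ℝ} (hω : NonResonant ω) {s : ℝ} (hs : 0 < s)
    {M : (Fin n →₀ ℕ) → ℝ} (hM : IsGevreyWeight (invDivisor ω) s M)
    {c : (m : ℕ) → (Fin m → Fin n) → Fin n → ℂ} {a : ℝ} (ha : 1 ≤ a)
    (hc : ∀ m j, ∑ i, ‖c m i j‖ ≤ a ^ m) {b : ℝ} (hb : 0 < b) :
    ∃ c₀ : ℝ, 0 < c₀ ∧ c₀ ≤ b ∧ ∀ N : ℕ, 1 ≤ N → ∃ H : Fin n → MvPolynomial (Fin n) ℂ,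
      IsTruncatedLinearization ω N c H ∧ (∀ j, VanishesToOrder 1 (H j)) ∧
      ∀ z, ‖z‖ ≤ c₀ / (N : ℝ) ^ s → ‖polyMap H z - z‖ ≤ c₀ / (N : ℝ) ^ s / 8 := by
  obtain ⟨K, hK1, hgrow⟩ := hM.growth
  have hK : 0 < K := by linarith
  -- Chosen so that `2 * (a * y) ^ 2 = y / 2`: the nonlinear part uses half of the ball, the
  -- identity the other half.
  set y : ℝ := 1 / (4 * a ^ 2) with hy
  have hy0 : 0 < y := by positivity
  have hay2 : a ^ 2 * y = 1 / 4 := by rw [hy]; field_simp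
  have hay : a * y ≤ 1 / 2 := by nlinarith
  have hsq : 2 * (a * y) ^ 2 ≤ y / 2 := by
    have : 2 * (a * y) ^ 2 = 2 * (a ^ 2 * y) * y := by ring
    rw [this, hay2]
    linarith
  set D : ℝ := ∑ j : Fin n, (M (Finsupp.single j 1))⁻¹ + 1 with hD
  have hinv0 : ∀ j : Fin n, 0 ≤ (M (Finsupp.single j 1))⁻¹ := fun j => (inv_pos.2 (hM.pos _)).le
  have hD0 : 0 < D := by
    have := Finset.sum_nonneg fun j (_ : j ∈ Finset.univ) => hinv0 j
    linarith
  have hDj : ∀ j : Fin n, (M (Finsupp.single j 1))⁻¹ ≤ D := fun j => by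
    have := Finset.single_le_sum (fun j _ => hinv0 j) (Finset.mem_univ j)
    linarith
  set t : ℝ := y / 2 / D with ht
  have ht0 : 0 < t := by positivity
  set w : (Fin n →₀ ℕ) → ℝ := fun α => t ^ α.degree / M α with hw
  have hwpos : ∀ α, 0 < w α := fun α => div_pos (pow_pos ht0 _) (hM.pos α)
  have hwsplit : ∀ α β, w α * w β = t ^ (α + β).degree / (M α * M β) := by
    intro α β
    rw [hw, map_add, pow_add]
    exact div_mul_div_comm _ _ _ _
  have hmul : ∀ α β, w (α + β) ≤ w α * w β := by
    intro α β
    rw [hwsplit]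
    exact div_le_div_of_nonneg_left (by positivity) (mul_pos (hM.pos α) (hM.pos β))
      (hM.mul_le α β)
  have hmul' : ∀ α β, α ≠ 0 → β ≠ 0 → invDivisor ω (α + β) * w (α + β) ≤ w α * w β := by
    intro α β hα hβ
    have h1 := hM.divisor_mul_le α β hα hβ
    have h2 := mul_pos (hM.pos α) (hM.pos β)
    have h3 := hM.pos (α + β)
    rw [hwsplit, hw, ← mul_div_assoc, div_le_div_iff₀ h3 h2]
    calc _ = t ^ (α + β).degree * (invDivisor ω (α + β) * (M α * M β)) := by ring
      _ ≤ _ := by gcongr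
  have hX : ∀ j, w (Finsupp.single j 1) ≤ y / 2 := by
    intro j
    have h1 : w (Finsupp.single j 1) = t * (M (Finsupp.single j 1))⁻¹ := by
      simp [hw, div_eq_mul_inv]
    rw [h1, ht, div_mul_eq_mul_div, div_le_iff₀ hD0]
    have := hDj j
    gcongr
  set B : ℝ := K * Real.exp s / t with hB
  have hB0 : 0 < B := by positivity
  -- The deviation is quadratic in `c₀` and the radius linear, so a small `c₀` gives the factor `1 /
  -- 8`.
  set c₀ : ℝ := min b (min (1 / B) (1 / (8 * y * B ^ 2))) with hc₀
  have hc₀0 : 0 < c₀ := by positivity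
  have hBc : B * c₀ ≤ 1 := by
    have : c₀ ≤ 1 / B := (min_le_right _ _).trans (min_le_left _ _)
    calc B * c₀ ≤ B * (1 / B) := by gcongr
      _ = 1 := by field_simp
  have hyBc : (B * c₀) ^ 2 * y ≤ c₀ / 8 := by
    have : c₀ ≤ 1 / (8 * y * B ^ 2) := (min_le_right _ _).trans (min_le_right _ _)
    calc (B * c₀) ^ 2 * y = (B ^ 2 * y * c₀) * c₀ := by ring
      _ ≤ (B ^ 2 * y * (1 / (8 * y * B ^ 2))) * c₀ := by gcongr
      _ = c₀ / 8 := by field_simp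
  refine ⟨c₀, hc₀0, min_le_left _ _, fun N hN => ?_⟩
  have hNs : 0 < (N : ℝ) ^ s := Real.rpow_pos_of_pos (by exact_mod_cast hN) s
  have hlin := isTruncatedLinearization_iterate hω hN c
  refine ⟨linearizationIterate ω N c N, hlin, vanishesToOrder_linearizationIterate ω N c N,
    fun z hz => ?_⟩
  refine (pi_norm_le_iff_of_nonneg (by positivity)).2 fun j => ?_
  have hnorm := weightedNorm_linearizationIterate_le (ω := ω) (N := N) (fun α => (hwpos α).le)
    hmul hmul' (by linarith) hy0.le hc hay hsq hX N j
  have hkey := norm_eval_sub_X_le (κ := (B * c₀) ^ 2 / (N : ℝ) ^ s) (fun α => (hwpos α).le)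
    (by positivity) (hlin.order_sub j) hnorm ?_ hz
  · rw [map_sub, eval_X] at hkey
    refine hkey.trans ?_
    rw [div_mul_eq_mul_div, div_right_comm]
    gcongr
  · intro α hα hdeg
    have hαN : α.degree ≤ N := by
      by_contra hlt
      exact mem_support_iff.1 hα (hlin.coeff_of_lt j α (not_le.1 hlt))
    have hα0 : α ≠ 0 := by
      rintro rfl
      simp at hdeg
    have h1 := pow_mul_rpow_le hs hK ht0 hc₀0 hBc hdeg hαN
    refine le_trans ?_ (mul_le_mul_of_nonneg_right h1 (hwpos α).le)
    have h2 : (c₀ / (N : ℝ) ^ s) ^ α.degree * (K ^ α.degree * (α.degree : ℝ) ^ (s * α.degree)) /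
        t ^ α.degree * w α = (c₀ / (N : ℝ) ^ s) ^ α.degree *
          ((K ^ α.degree * (α.degree : ℝ) ^ (s * α.degree)) / M α) := by
      simp only [hw]
      field_simp
    rw [h2]
    refine le_mul_of_one_le_right (by positivity) ?_
    rw [one_le_div (hM.pos α)]
    exact hgrow α hα0

theorem exists_normalForm {ω : Fin n → ℝ} (hω : NonResonant ω) {s : ℝ} (hs : 0 < s)
    {M : (Fin n →₀ ℕ) → ℝ} (hM : IsGevreyWeight (invDivisor ω) s M)
    {F f : (Fin n → ℂ) → (Fin n → ℂ)} (hF : AnalyticAt ℂ F 0)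
    (hFf : ∀ᶠ z in 𝓝 0, F z = linearField ω z + f z) (hf0 : f 0 = 0)
    (hDf0 : HasFDerivAt f (0 : (Fin n → ℂ) →L[ℂ] (Fin n → ℂ)) 0) {b : ℝ} (hb : 0 < b) :
    ∃ c₀ : ℝ, 0 < c₀ ∧ c₀ ≤ b ∧ ∀ N : ℕ, 1 ≤ N → ∃ h : (Fin n → ℂ) → (Fin n → ℂ),
      (∀ z, AnalyticAt ℂ h z) ∧ h 0 = 0 ∧
      (∀ z, ‖z‖ ≤ c₀ / (N : ℝ) ^ s → ‖h z - z‖ ≤ c₀ / (N : ℝ) ^ s / 8) ∧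
      (fun z => F (h z) - fderiv ℂ h z (linearField ω z)) =o[𝓝 0] fun z => ‖z‖ ^ N := by
  have hfan : AnalyticAt ℂ f 0 := by
    refine (hF.sub ((linearField ω).analyticAt 0)).congr ?_
    filter_upwards [hFf] with z hz
    simp [hz]
  obtain ⟨p, hp⟩ := hfan
  have h0 : ∀ v, p 0 v = 0 := fun v => by rw [hp.coeff_zero, hf0]
  have h1 : ∀ v, p 1 v = 0 := fun v => by
    have h2 := hp.hasFDerivAt.unique hDf0
    have h3 := congrArg (fun L : (Fin n → ℂ) →L[ℂ] (Fin n → ℂ) => L (v 0)) h2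
    simp only [continuousMultilinearCurryFin1_apply] at h3
    have h4 : (Fin.snoc 0 (v 0) : Fin 1 → Fin n → ℂ) = v := by
      funext i
      fin_cases i
      rfl
    rw [h4] at h3
    exact h3
  obtain ⟨a, ha, hc⟩ := exists_sum_norm_seriesCoeff_le hp.radius_pos h0
  obtain ⟨c₀, hc₀, hc₀b, hN⟩ := exists_truncatedLinearization hω hs hM ha hc hb
  refine ⟨c₀, hc₀, hc₀b, fun N hN1 => ?_⟩
  obtain ⟨H, hH, hH1, hbound⟩ := hN N hN1
  refine ⟨polyMap H, analyticAt_polyMap H, ?_, hbound,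
    isLittleO_normalForm_remainder hFf hp h0 h1 hH hH1⟩
  funext j
  have := hH1 j 0 (by simp)
  simpa [polyMap, constantCoeff_eq, eval_zero] using this

end NormalFormBounds

/-! ### Analytic vector fields near an equilibrium -/

section Dynamics

open Topology Metric Set
open scoped NNReal

theorem AnalyticOnNhd.exists_lipschitzOnWith_of_isCompact {E G : Type*} [NormedAddCommGroup E]
    [NormedSpace ℂ E] [NormedAddCommGroup G] [NormedSpace ℂ G] [CompleteSpace G] {R : E → G}
    {K : Set E} (hR : AnalyticOnNhd ℂ R K) (hK : IsCompact K) (hconv : Convex ℝ K) :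
    ∃ C : ℝ≥0, LipschitzOnWith C R K := by
  obtain ⟨C, hC⟩ := hK.exists_bound_of_continuousOn hR.fderiv.continuousOn
  refine ⟨C.toNNReal, hconv.lipschitzOnWith_of_nnnorm_fderiv_le (𝕜 := ℂ)
    (fun x hx => (hR x hx).differentiableAt) fun x hx => ?_⟩
  exact NNReal.coe_le_coe.1 ((hC x hx).trans (Real.le_coe_toNNReal C))

/-- A solution of a time-dependent equation given by the Picard iteration does not leave the ball on
which the field is controlled. -/
theorem IsPicardLindelof.exists_hasDerivWithinAt_mem_closedBall {E : Type*} [NormedAddCommGroup E]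
    [NormedSpace ℝ E] [CompleteSpace E] {f : ℝ → E → E} {tmin tmax : ℝ} {t₀ : Icc tmin tmax}
    {x₀ : E} {a L K : ℝ≥0} (hf : IsPicardLindelof f t₀ x₀ a 0 L K) :
    ∃ α : ℝ → E, α t₀ = x₀ ∧ (∀ t, α t ∈ closedBall x₀ a) ∧
      ∀ t ∈ Icc tmin tmax, HasDerivWithinAt α (f t (α t)) (Icc tmin tmax) t := by
  obtain ⟨α, hα⟩ := ODE.FunSpace.exists_isFixedPt_next hf (mem_closedBall_self le_rfl)
  refine ⟨α.compProj, ?_, fun t => α.compProj_mem_closedBall hf.mul_max_le, fun t ht => ?_⟩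
  · rw [ODE.FunSpace.compProj_val, ← hα, ODE.FunSpace.next_apply₀]
  apply ODE.hasDerivWithinAt_picard_Icc t₀.2 hf.continuousOn_uncurry
    α.continuous_compProj.continuousOn (fun _ _ => α.compProj_mem_closedBall hf.mul_max_le)
    x₀ ht |>.congr_of_mem _ ht
  intro t' ht'
  nth_rw 1 [← hα]
  rw [ODE.FunSpace.compProj_of_mem ht', ODE.FunSpace.next_apply]

variable {n : ℕ}

/-- The flow of `linearField ω`. -/
noncomputable def linearFlow (ω : Fin n → ℝ) (t : ℝ) : (Fin n → ℂ) →L[ℂ] (Fin n → ℂ) :=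
  ContinuousLinearMap.pi fun j =>
    Complex.exp ((ω j * t : ℝ) * Complex.I) • ContinuousLinearMap.proj j

theorem linearFlow_apply (ω : Fin n → ℝ) (t : ℝ) (v : Fin n → ℂ) (j : Fin n) :
    linearFlow ω t v j = Complex.exp ((ω j * t : ℝ) * Complex.I) * v j := rfl

@[simp]
theorem norm_linearFlow (ω : Fin n → ℝ) (t : ℝ) (v : Fin n → ℂ) : ‖linearFlow ω t v‖ = ‖v‖ := by
  have h : ∀ j, ‖linearFlow ω t v j‖₊ = ‖v j‖₊ := fun j => by
    apply NNReal.eq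
    simp only [coe_nnnorm, linearFlow_apply, norm_mul, Complex.norm_exp_ofReal_mul_I, one_mul]
  simp only [Pi.norm_def, h]

@[simp]
theorem linearFlow_linearFlow_neg (ω : Fin n → ℝ) (t : ℝ) (v : Fin n → ℂ) :
    linearFlow ω t (linearFlow ω (-t) v) = v := by
  funext j
  rw [linearFlow_apply, linearFlow_apply, ← mul_assoc, ← Complex.exp_add]
  simp

@[simp]
theorem linearFlow_zero (ω : Fin n → ℝ) (v : Fin n → ℂ) : linearFlow ω 0 v = v := by
  funext j
  simp [linearFlow_apply]

theorem continuous_linearFlow_apply (ω : Fin n → ℝ) (v : Fin n → ℂ) :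
    Continuous fun t => linearFlow ω t v := by
  refine continuous_pi fun j => ?_
  simp only [linearFlow_apply]
  fun_prop

theorem hasDerivWithinAt_linearFlow_apply (ω : Fin n → ℝ) {v : ℝ → Fin n → ℂ} {v' : Fin n → ℂ}
    {J : Set ℝ} {t : ℝ} (hv : HasDerivWithinAt v v' J t) :
    HasDerivWithinAt (fun t => linearFlow ω t (v t))
      (linearField ω (linearFlow ω t (v t)) + linearFlow ω t v') J t := by
  refine hasDerivWithinAt_pi.2 fun j => ?_
  have h1 : HasDerivWithinAt (fun t : ℝ => Complex.exp ((ω j * t : ℝ) * Complex.I))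
      (Complex.exp ((ω j * t : ℝ) * Complex.I) * (ω j * Complex.I)) J t := by
    have h2 : HasDerivAt (fun t : ℝ => ((ω j * t : ℝ) : ℂ) * Complex.I) (ω j * Complex.I) t := by
      have := ((hasDerivAt_id t).const_mul (ω j)).ofReal_comp.mul_const Complex.I
      simpa using this
    exact h2.cexp.hasDerivWithinAt
  have h3 := h1.mul (hasDerivWithinAt_pi.1 hv j)
  refine h3.congr_deriv ?_
  simp only [Pi.add_apply, linearField_apply, linearFlow_apply]
  ring

theorem unitPolydisk_eq_ball : unitPolydisk n = ball 0 1 := by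
  ext z
  rw [mem_ball_zero_iff, pi_norm_lt_iff one_pos]
  rfl

/-- By compactness of the time interval both solutions stay in a common closed ball inside the
polydisk, where `F` is Lipschitz. -/
theorem IsSolutionOn.eqOn {F : (Fin n → ℂ) → (Fin n → ℂ)} (hF : AnalyticOnNhd ℂ F (unitPolydisk n))
    {z₀ : Fin n → ℂ} {T : ℝ} (hT : 0 < T) {y z : ℝ → Fin n → ℂ}
    (hy : IsSolutionOn F z₀ (Icc (-T) T) y) (hz : IsSolutionOn F z₀ (Icc (-T) T) z) :
    EqOn y z (Icc (-T) T) := by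
  rw [unitPolydisk_eq_ball] at hF
  have hcont : ∀ {x : ℝ → Fin n → ℂ}, IsSolutionOn F z₀ (Icc (-T) T) x →
      ContinuousOn x (Icc (-T) T) := fun hx t ht => (hx.2 t ht).2.continuousWithinAt
  have hbound : ∀ {x : ℝ → Fin n → ℂ}, IsSolutionOn F z₀ (Icc (-T) T) x →
      ∃ ρ < 1, ∀ t ∈ Icc (-T) T, ‖x t‖ ≤ ρ := fun {x} hx => by
    obtain ⟨t, ht, hmax⟩ := isCompact_Icc.exists_isMaxOn (nonempty_Icc.2 (by linarith : -T ≤ T))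
      (hcont hx).norm
    refine ⟨‖x t‖, ?_, fun u hu => hmax hu⟩
    have := (hx.2 t ht).1
    rwa [unitPolydisk_eq_ball, mem_ball_zero_iff] at this
  have hderiv : ∀ {x : ℝ → Fin n → ℂ}, IsSolutionOn F z₀ (Icc (-T) T) x →
      ∀ t ∈ Ioo (-T) T, HasDerivAt x (F (x t)) t := fun hx t ht =>
    (hx.2 t (Ioo_subset_Icc_self ht)).2.hasDerivAt (Icc_mem_nhds ht.1 ht.2)
  obtain ⟨ρ₁, hρ₁, h₁⟩ := hbound hy
  obtain ⟨ρ₂, hρ₂, h₂⟩ := hbound hz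
  have hF' := hF.mono (closedBall_subset_ball (max_lt hρ₁ hρ₂))
  obtain ⟨K, hK⟩ := hF'.exists_lipschitzOnWith_of_isCompact
    (isCompact_closedBall _ _) (convex_closedBall _ _)
  exact ODE_solution_unique_of_mem_Icc (v := fun _ => F)
    (s := fun _ => closedBall 0 (max ρ₁ ρ₂)) (t₀ := 0) (fun _ _ => hK)
    ⟨by linarith, hT⟩ (hcont hy) (hderiv hy)
    (fun t ht => mem_closedBall_zero_iff.2 ((h₁ t (Ioo_subset_Icc_self ht)).trans (le_max_left _ _)))
    (hcont hz) (hderiv hz)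
    (fun t ht => mem_closedBall_zero_iff.2 ((h₂ t (Ioo_subset_Icc_self ht)).trans (le_max_right _ _)))
    (hy.1.trans hz.1.symm)

end Dynamics

/-! ### Flow near the equilibrium in normal form coordinates -/

section NearIdentity

open Topology Metric Set
open scoped NNReal

variable {E : Type*} [NormedAddCommGroup E] [NormedSpace ℂ E] {h : E → E} {ρ : ℝ}

theorem norm_fderiv_sub_id_le (hd : Differentiable ℂ h) (hρ : 0 < ρ)
    (hh : ∀ z, ‖z‖ ≤ ρ → ‖h z - z‖ ≤ ρ / 8) {z : E} (hz : ‖z‖ ≤ ρ / 2) :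
    ‖fderiv ℂ h z - ContinuousLinearMap.id ℂ E‖ ≤ 1 / 2 := by
  have h1 : fderiv ℂ h z - ContinuousLinearMap.id ℂ E = fderiv ℂ (fun w => h w - w) z := by
    rw [fderiv_fun_sub (hd z) differentiableAt_fun_id, fderiv_fun_id]
  -- On the ball of radius `ρ / 2` about `z`, `h - id` varies by at most `ρ / 8 + ρ / 8`; the
  -- derivative bound is the ratio of the radii.
  have h2 := Complex.norm_fderiv_le_div_of_mapsTo_ball (f := fun w => h w - w) (c := z)
    (R₁ := ρ / 2) (R₂ := ρ / 4) (hd.sub differentiable_id).differentiableOn ?_ (by positivity)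
  · rw [h1]
    refine h2.trans_eq ?_
    field_simp
    norm_num
  · intro w hw
    rw [mem_ball_iff_norm] at hw
    rw [mem_closedBall_iff_norm]
    have h3 : ‖w‖ ≤ ρ := by
      have := norm_add_le (w - z) z
      rw [sub_add_cancel] at this
      linarith
    have := norm_sub_le (h w - w) (h z - z)
    have := hh w h3
    have := hh z (by linarith)
    linarith

theorem lipschitzOnWith_sub_id (hd : Differentiable ℂ h) (hρ : 0 < ρ)
    (hh : ∀ z, ‖z‖ ≤ ρ → ‖h z - z‖ ≤ ρ / 8) :
    LipschitzOnWith (1 / 2) (fun z => h z - z) (closedBall 0 (ρ / 2)) := by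
  refine (convex_closedBall _ _).lipschitzOnWith_of_nnnorm_fderiv_le (𝕜 := ℂ)
    (fun z _ => (hd z).sub differentiableAt_fun_id) fun z hz => ?_
  rw [fderiv_fun_sub (hd z) differentiableAt_fun_id, fderiv_fun_id]
  exact NNReal.coe_le_coe.1 (norm_fderiv_sub_id_le hd hρ hh (mem_closedBall_zero_iff.1 hz))

theorem norm_le_two_mul_of_near_id (hd : Differentiable ℂ h) (h0 : h 0 = 0) (hρ : 0 < ρ)
    (hh : ∀ z, ‖z‖ ≤ ρ → ‖h z - z‖ ≤ ρ / 8) {z : E} (hz : ‖z‖ ≤ ρ / 2) : ‖h z‖ ≤ 2 * ‖z‖ := by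
  have h1 := (lipschitzOnWith_sub_id hd hρ hh).dist_le_mul z (mem_closedBall_zero_iff.2 hz) 0
    (mem_closedBall_self (by positivity))
  simp only [dist_eq_norm, h0, sub_zero] at h1
  have h2 := norm_add_le (h z - z) z
  rw [sub_add_cancel] at h2
  have h3 : (((1 / 2 : ℝ≥0)) : ℝ) = 1 / 2 := by norm_num
  rw [h3] at h1
  have := norm_nonneg z
  linarith

theorem exists_preimage_of_near_id [CompleteSpace E] (hd : Differentiable ℂ h) (h0 : h 0 = 0)
    (hρ : 0 < ρ) (hh : ∀ z, ‖z‖ ≤ ρ → ‖h z - z‖ ≤ ρ / 8) {z : E} (hz : 2 * ‖z‖ ≤ ρ / 2) :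
    ∃ v, ‖v‖ ≤ 2 * ‖z‖ ∧ h v = z := by
  have happ : ApproximatesLinearOn h (ContinuousLinearMap.id ℂ E) (closedBall 0 (ρ / 2)) (1 / 2) :=
    fun x hx y hy => by
      have := (lipschitzOnWith_sub_id hd hρ hh).norm_sub_le hx hy
      have heq : h x - h y - ContinuousLinearMap.id ℂ E (x - y) = h x - x - (h y - y) := by
        rw [ContinuousLinearMap.id_apply]
        abel
      rwa [heq]
  have hsurj := happ.surjOn_closedBall_of_nonlinearRightInverse
    (⟨id, 1, fun _ => by simp, fun _ => rfl⟩ :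
      (ContinuousLinearMap.id ℂ E).NonlinearRightInverse) (ε := 2 * ‖z‖) (b := 0) (by positivity)
    (closedBall_subset_closedBall hz)
  obtain ⟨v, hv, hvz⟩ := hsurj (a := z) (by
    rw [h0, mem_closedBall_zero_iff]
    norm_num
    linarith)
  exact ⟨v, mem_closedBall_zero_iff.1 hv, hvz⟩

theorem isUnit_and_norm_inverse_le [CompleteSpace E] {D : E →L[ℂ] E}
    (hD : ‖D - ContinuousLinearMap.id ℂ E‖ ≤ 1 / 2) :
    IsUnit D ∧ (∀ w, D (Ring.inverse D w) = w) ∧ ∀ w, ‖Ring.inverse D w‖ ≤ 2 * ‖w‖ := by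
  have hu : IsUnit D := by
    have := isUnit_one_sub_of_norm_lt_one (x := ContinuousLinearMap.id ℂ E - D)
      (by rw [norm_sub_rev]; linarith)
    have h1 : (1 : E →L[ℂ] E) - (ContinuousLinearMap.id ℂ E - D) = D := sub_sub_cancel _ _
    rwa [h1] at this
  have hinv : ∀ w, D (Ring.inverse D w) = w := fun w =>
    congrArg (fun L : E →L[ℂ] E => L w) (Ring.mul_inverse_cancel D hu)
  refine ⟨hu, hinv, fun w => ?_⟩
  have h2 := (D - ContinuousLinearMap.id ℂ E).le_of_opNorm_le hD (Ring.inverse D w)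
  have h3 : (D - ContinuousLinearMap.id ℂ E) (Ring.inverse D w) = w - Ring.inverse D w := by
    rw [sub_apply, hinv, ContinuousLinearMap.id_apply]
  rw [h3] at h2
  have h4 := norm_sub_norm_le (Ring.inverse D w) w
  rw [norm_sub_rev] at h4
  linarith

end NearIdentity

/-! ### Long-time solutions obtained from a normal form with small remainder. -/

section LongTimeFlow

open Topology Metric Set
open scoped NNReal

theorem AnalyticAt.continuousLinearMap_apply {E G H : Type*} [NormedAddCommGroup E] [NormedSpace ℂ E]
    [NormedAddCommGroup G] [NormedSpace ℂ G] [NormedAddCommGroup H] [NormedSpace ℂ H]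
    {D : E → G →L[ℂ] H} {v : E → G} {z : E} (hD : AnalyticAt ℂ D z) (hv : AnalyticAt ℂ v z) :
    AnalyticAt ℂ (fun z => D z (v z)) z :=
  ((ContinuousLinearMap.id ℂ (G →L[ℂ] H)).analyticAt_bilinear (D z, v z)).comp₂ hD hv

variable {n : ℕ}

/-- Perturbing the linear flow by an analytic field that is small near the origin: a solution
starting at `v₀` moves away from the linear orbit by at most `δ` over times `|t| ≤ T`. -/
theorem exists_solution_linearField_add {ω : Fin n → ℝ} {R : (Fin n → ℂ) → (Fin n → ℂ)}
    {δ σ L T : ℝ} (hδ : 0 ≤ δ) (hL : 0 ≤ L) (hR : AnalyticOnNhd ℂ R (closedBall 0 (σ + δ)))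
    (hRL : ∀ z, ‖z‖ ≤ σ + δ → ‖R z‖ ≤ L) (hT : 0 ≤ T) (hLT : L * T ≤ δ) {v₀ : Fin n → ℂ}
    (hv₀ : ‖v₀‖ ≤ σ) :
    ∃ u : ℝ → Fin n → ℂ, u 0 = v₀ ∧ ∀ t ∈ Icc (-T) T, ‖u t‖ ≤ σ + δ ∧
      HasDerivWithinAt u (linearField ω (u t) + R (u t)) (Icc (-T) T) t := by
  obtain ⟨K, hK⟩ := hR.exists_lipschitzOnWith_of_isCompact
    (isCompact_closedBall _ _) (convex_closedBall _ _)
  have hball : ∀ {v}, v ∈ closedBall v₀ δ → ∀ t, linearFlow ω t v ∈ closedBall 0 (σ + δ) := by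
    intro v hv t
    rw [mem_closedBall_iff_norm] at hv
    rw [mem_closedBall_zero_iff, norm_linearFlow]
    have := norm_add_le (v - v₀) v₀
    rw [sub_add_cancel] at this
    linarith
  -- In the frame moving with the linear flow only the small field `R` remains. As the flow is
  -- isometric, its bound and Lipschitz constant are unchanged for all times.
  have hPL : IsPicardLindelof (fun t v => linearFlow ω (-t) (R (linearFlow ω t v)))
      (⟨0, by simpa using hT⟩ : Icc (-T) T) v₀ ⟨δ, hδ⟩ 0 ⟨L, hL⟩ K := by
    refine ⟨fun t _ => ?_, fun v hv => ?_, fun t _ v hv => ?_, ?_⟩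
    · refine LipschitzOnWith.of_dist_le_mul fun x hx y hy => ?_
      rw [dist_eq_norm, ← map_sub, norm_linearFlow, ← dist_eq_norm]
      refine (hK.dist_le_mul _ (hball hx t) _ (hball hy t)).trans_eq ?_
      rw [dist_eq_norm, ← map_sub, norm_linearFlow, ← dist_eq_norm]
    · refine Continuous.continuousOn (continuous_pi fun j => ?_)
      simp only [linearFlow_apply]
      refine Continuous.mul (by fun_prop) ((continuous_apply j).comp ?_)
      exact hR.continuousOn.comp_continuous (continuous_linearFlow_apply ω v) (hball hv)
    · rw [norm_linearFlow]
      exact hRL _ (mem_closedBall_zero_iff.1 (hball hv t))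
    · have hmax : max (T - 0) (0 - -T) = T := by simp
      change L * max (T - 0) (0 - -T) ≤ δ - 0
      rwa [hmax, sub_zero]
  obtain ⟨v, hv0, hvmem, hvd⟩ := hPL.exists_hasDerivWithinAt_mem_closedBall
  refine ⟨fun t => linearFlow ω t (v t), ?_, fun t ht => ⟨?_, ?_⟩⟩
  · exact (linearFlow_zero ω _).trans hv0
  · exact mem_closedBall_zero_iff.1 (hball (hvmem t) t)
  · have := hasDerivWithinAt_linearFlow_apply ω (hvd t ht)
    rwa [linearFlow_linearFlow_neg] at this

/-- In the coordinates `z = h u` the equation is the linear one plus `(Dh)⁻¹` applied to the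
remainder. The initial point has norm at most `2 * ‖z₀‖`, the drift adds at most `‖z₀‖`, and `h` at
most doubles norms; hence the factor `6`. -/
theorem exists_solution_of_normalForm {ω : Fin n → ℝ} {F h : (Fin n → ℂ) → (Fin n → ℂ)} {ρ C : ℝ}
    {N : ℕ} (hF : AnalyticOnNhd ℂ F (unitPolydisk n)) (hF0 : F 0 = 0)
    (hC : ∀ z, ‖z‖ ≤ 1 / 2 → ‖F z‖ ≤ C) (hρ : 0 < ρ) (hρ1 : ρ ≤ 1 / 2)
    (han : ∀ z, AnalyticAt ℂ h z) (h0 : h 0 = 0)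
    (hh : ∀ z, ‖z‖ ≤ ρ → ‖h z - z‖ ≤ ρ / 8)
    (hrem : (fun z => F (h z) - fderiv ℂ h z (linearField ω z)) =o[𝓝 0] fun z => ‖z‖ ^ N)
    {z₀ : Fin n → ℂ} (hz₀ : 6 * Real.exp 1 * ‖z₀‖ ≤ ρ) {T : ℝ} (hT : 0 ≤ T)
    (hT' : 2 * (C + ‖linearField ω‖) * Real.exp (-(N + 1)) * T ≤ ‖z₀‖) :
    ∃ z, IsSolutionOn F z₀ (Icc (-T) T) z ∧ ∀ t ∈ Icc (-T) T, ‖z t‖ ≤ 6 * ‖z₀‖ := by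
  have hd : Differentiable ℂ h := fun z => (han z).differentiableAt
  have he : 2 ≤ Real.exp 1 := by linarith [Real.add_one_le_exp 1]
  have hz3 : 3 * ‖z₀‖ ≤ ρ / 4 := by nlinarith [norm_nonneg z₀]
  have hC0 : 0 ≤ C := (norm_nonneg _).trans (hC 0 (by simp))
  set D := fun z => fderiv ℂ h z with hDdef
  set Rem := fun z => F (h z) - D z (linearField ω z) with hRem
  have hDid : ∀ z, ‖z‖ ≤ ρ / 2 → ‖D z - ContinuousLinearMap.id ℂ (Fin n → ℂ)‖ ≤ 1 / 2 :=
    fun z hz => norm_fderiv_sub_id_le hd hρ hh hz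
  have hh2 : ∀ z, ‖z‖ ≤ ρ / 2 → ‖h z‖ ≤ 2 * ‖z‖ :=
    fun z hz => norm_le_two_mul_of_near_id hd h0 hρ hh hz
  have hDan : ∀ z, AnalyticAt ℂ D z := fun z => (han z).fderiv
  have hRan : ∀ z, ‖z‖ ≤ ρ / 2 → AnalyticAt ℂ Rem z := fun z hz => by
    have h1 : h z ∈ unitPolydisk n := by
      rw [unitPolydisk_eq_ball, mem_ball_zero_iff]
      linarith [hh2 z hz]
    exact ((hF _ h1).comp (han z)).sub ((hDan z).continuousLinearMap_apply ((linearField ω).analyticAt z))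
  have hRem0 : Rem 0 = 0 := by simp [hRem, h0, hF0]
  have hRembd : ∀ z, ‖z‖ ≤ ρ / 2 → ‖Rem z‖ ≤ C + ‖linearField ω‖ := fun z hz => by
    have h1 : ‖F (h z)‖ ≤ C := hC _ (by linarith [hh2 z hz])
    have h2 : ‖D z (linearField ω z)‖ ≤ ‖linearField ω‖ := by
      have h3 : ‖D z‖ ≤ 2 := by
        have h4 := norm_add_le (D z - ContinuousLinearMap.id ℂ (Fin n → ℂ))
          (ContinuousLinearMap.id ℂ (Fin n → ℂ))
        rw [sub_add_cancel] at h4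
        linarith [hDid z hz, ContinuousLinearMap.norm_id_le (𝕜 := ℂ) (E := Fin n → ℂ)]
      have h5 := (linearField ω).le_opNorm z
      have h6 := (D z).le_of_opNorm_le h3 (linearField ω z)
      have h7 : ‖linearField ω‖ * ‖z‖ ≤ ‖linearField ω‖ * (1 / 2) := by
        gcongr
        linarith
      linarith
    exact (norm_sub_le _ _).trans (add_le_add h1 h2)
  have hRemsmall : ∀ z, ‖z‖ ≤ 3 * ‖z₀‖ →
      ‖Rem z‖ ≤ (C + ‖linearField ω‖) * Real.exp (-(N + 1)) := fun z hz => by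
    -- Higher-order Schwarz lemma on the ball of radius `ρ / 2`. Since `6 * exp 1 * ‖z₀‖ ≤ ρ`,
    -- points of norm at most `3 * ‖z₀‖` gain a factor `exp (-1)` for each of the `N + 1` orders.
    have h1 := Complex.dist_le_mul_div_pow_of_mapsTo_ball_of_isLittleO (f := Rem) (c := 0) (z := z)
      (R₁ := ρ / 2) (R₂ := C + ‖linearField ω‖) (n := N)
      (fun w hw => (hRan w (mem_ball_zero_iff.1 hw).le).differentiableAt.differentiableWithinAt)
      (fun w hw => by
        rw [hRem0, mem_closedBall_zero_iff]
        exact hRembd w (mem_ball_zero_iff.1 hw).le)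
      (by simpa [hRem0] using hrem)
      (by rw [mem_ball_zero_iff]; linarith)
    rw [hRem0, dist_zero_right, dist_zero_right] at h1
    refine h1.trans ?_
    have h2 : ‖z‖ / (ρ / 2) ≤ Real.exp (-1) := by
      rw [div_le_iff₀ (by positivity), Real.exp_neg, inv_mul_eq_div, le_div_iff₀ (Real.exp_pos _)]
      nlinarith
    have h3 : Real.exp (-(N + 1)) = Real.exp (-1) ^ (N + 1) := by
      rw [← Real.exp_nat_mul]
      congr 1
      push_cast
      ring
    rw [h3]
    gcongr
  obtain ⟨v₀, hv₀, hv₀z⟩ := exists_preimage_of_near_id hd h0 hρ hh (z := z₀) (by linarith)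
  have hsum : 2 * ‖z₀‖ + ‖z₀‖ = 3 * ‖z₀‖ := by ring
  obtain ⟨u, hu0, hu⟩ := exists_solution_linearField_add (ω := ω)
    (R := fun z => Ring.inverse (D z) (Rem z)) (δ := ‖z₀‖) (σ := 2 * ‖z₀‖)
    (L := 2 * (C + ‖linearField ω‖) * Real.exp (-(N + 1))) (T := T) (norm_nonneg _)
    (by positivity)
    (fun z hz => by
      rw [mem_closedBall_zero_iff, hsum] at hz
      obtain ⟨hunit, -, -⟩ := isUnit_and_norm_inverse_le (hDid z (by linarith))
      obtain ⟨U, hU⟩ := hunit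
      have h1 : AnalyticAt ℂ Ring.inverse (D z) := hU ▸ analyticAt_inverse U
      exact (h1.comp (hDan z)).continuousLinearMap_apply (hRan z (by linarith)))
    (fun z hz => by
      rw [hsum] at hz
      refine ((isUnit_and_norm_inverse_le (hDid z (by linarith))).2.2 (Rem z)).trans ?_
      linarith [hRemsmall z hz])
    hT hT' hv₀
  refine ⟨fun t => h (u t), ⟨(congrArg h hu0).trans hv₀z, fun t ht => ?_⟩, fun t ht => ?_⟩
  · obtain ⟨h1, h2⟩ := hu t ht
    rw [hsum] at h1
    have h3 : ‖u t‖ ≤ ρ / 2 := by linarith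
    refine ⟨?_, ?_⟩
    · rw [unitPolydisk_eq_ball, mem_ball_zero_iff]
      linarith [hh2 _ h3]
    · have h4 := ((hd (u t)).hasFDerivAt.restrictScalars ℝ).comp_hasDerivWithinAt t h2
      refine h4.congr_deriv ?_
      have h5 := (isUnit_and_norm_inverse_le (hDid _ h3)).2.1 (Rem (u t))
      change D (u t) (_ + _) = _
      rw [map_add, h5]
      simp [hRem]
  · obtain ⟨h1, -⟩ := hu t ht
    rw [hsum] at h1
    linarith [hh2 (u t) (by linarith)]

end LongTimeFlow

/-! ### Choice of the truncation order and the exponential stability time. -/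

section EffectiveStability

open Topology Metric Set

variable {n : ℕ}

/-- The drift is allowed to be only of size `‖z₀‖`, a power of `1 / Y`. Half of the exponent is
given up to absorb that power. -/
theorem rpow_le_mul_exp_half {s Y : ℝ} (hs : 0 < s) (hY : 0 ≤ Y) :
    Y ^ s ≤ (2 * s) ^ s * Real.exp (Y / 2) := by
  have h1 : Y / (2 * s) ≤ Real.exp (Y / (2 * s)) := by linarith [Real.add_one_le_exp (Y / (2 * s))]
  have h2 : Real.exp (Y / (2 * s)) ^ s = Real.exp (Y / 2) := by
    rw [← Real.exp_mul]
    congr 1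
    field_simp
  calc Y ^ s = (2 * s * (Y / (2 * s))) ^ s := by rw [mul_div_cancel₀ _ (by positivity)]
    _ = (2 * s) ^ s * (Y / (2 * s)) ^ s := Real.mul_rpow (by positivity) (by positivity)
    _ ≤ (2 * s) ^ s * Real.exp (Y / (2 * s)) ^ s := by gcongr
    _ = _ := by rw [h2]

theorem exists_longTime_solution {ω : Fin n → ℝ} (hω : NonResonant ω) {s : ℝ} (hs : 0 < s)
    {M : (Fin n →₀ ℕ) → ℝ} (hM : IsGevreyWeight (invDivisor ω) s M)
    {F f : (Fin n → ℂ) → (Fin n → ℂ)} (hF : AnalyticOnNhd ℂ F (unitPolydisk n))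
    (hFf : ∀ z ∈ unitPolydisk n, F z = linearField ω z + f z) (hf0 : f 0 = 0)
    (hDf0 : HasFDerivAt f (0 : (Fin n → ℂ) →L[ℂ] (Fin n → ℂ)) 0) :
    ∃ κ a : ℝ, 0 < κ ∧ 0 < a ∧ ∀ z₀ : Fin n → ℂ, 0 < ‖z₀‖ → ‖z₀‖ ≤ κ →
      ∀ T : ℝ, T = a * Real.exp ((κ / ‖z₀‖) ^ (1 / s) / 2) →
        ∃ z, IsSolutionOn F z₀ (Icc (-T) T) z ∧ ∀ t ∈ Icc (-T) T, ‖z t‖ ≤ 6 * ‖z₀‖ := by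
  have h0mem : (0 : Fin n → ℂ) ∈ unitPolydisk n := by simp [unitPolydisk_eq_ball]
  have hopen : unitPolydisk n ∈ 𝓝 (0 : Fin n → ℂ) := by
    rw [unitPolydisk_eq_ball]
    exact ball_mem_nhds _ one_pos
  have hF0 : F 0 = 0 := by rw [hFf 0 h0mem, map_zero, hf0, add_zero]
  obtain ⟨C, hC⟩ := (isCompact_closedBall (0 : Fin n → ℂ) (1 / 2)).exists_bound_of_continuousOn
    (hF.continuousOn.mono (by
      rw [unitPolydisk_eq_ball]
      exact closedBall_subset_ball (by norm_num)))
  have hC0 : 0 ≤ C := (norm_nonneg _).trans (hC 0 (by simp))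
  obtain ⟨c₀, hc₀, hc₀1, hN⟩ := exists_normalForm hω hs hM (hF 0 h0mem)
    (eventually_of_mem hopen hFf) hf0 hDf0 (b := 1 / 2) (by norm_num)
  -- Makes `6 * exp 1 * ‖z₀‖ ≤ c₀ / N ^ s` equivalent to `N ^ s ≤ κ / ‖z₀‖`; `N` is the largest
  -- integer allowed by this.
  set κ : ℝ := c₀ / (6 * Real.exp 1) with hκ
  have hκ0 : 0 < κ := by positivity
  set Q : ℝ := 2 * (C + 1 + ‖linearField ω‖) with hQ
  have hQ0 : 0 < Q := by positivity
  refine ⟨κ, κ / (Q * (2 * s) ^ s), hκ0, by positivity, fun z₀ hz₀ hz₀κ T hT => ?_⟩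
  set X : ℝ := κ / ‖z₀‖ with hX
  have hX1 : 1 ≤ X := (one_le_div hz₀).2 hz₀κ
  set Y : ℝ := X ^ (1 / s) with hY
  have hY1 : 1 ≤ Y := Real.one_le_rpow hX1 (by positivity)
  have hYs : Y ^ s = X := by
    rw [hY, ← Real.rpow_mul (by positivity), one_div_mul_cancel hs.ne', Real.rpow_one]
  set N : ℕ := ⌊Y⌋₊ with hNdef
  have hN1 : 1 ≤ N := Nat.one_le_floor_iff Y |>.2 hY1
  have hNpos : (0 : ℝ) < N := by exact_mod_cast hN1
  have hNs : (N : ℝ) ^ s ≤ X := by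
    rw [← hYs]
    exact Real.rpow_le_rpow hNpos.le (Nat.floor_le (by positivity)) hs.le
  have hNs0 : 0 < (N : ℝ) ^ s := Real.rpow_pos_of_pos hNpos s
  obtain ⟨h, han, h0, hh, hrem⟩ := hN N hN1
  have hT0 : 0 ≤ T := by rw [hT]; positivity
  refine exists_solution_of_normalForm (C := C + 1) (N := N) hF hF0
    (fun z hz => (hC z (mem_closedBall_zero_iff.2 hz)).trans (by linarith)) (by positivity)
    ?_ han h0 hh hrem ?_ hT0 ?_
  · refine (div_le_self hc₀.le ?_).trans hc₀1
    exact Real.one_le_rpow (by exact_mod_cast hN1) hs.le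
  · calc 6 * Real.exp 1 * ‖z₀‖ = c₀ / X := by
          rw [hX, hκ]
          field_simp
      _ ≤ c₀ / (N : ℝ) ^ s := by gcongr
  · have h1 : Real.exp (-((N : ℝ) + 1)) ≤ Real.exp (-Y) := by
      gcongr
      exact (Nat.lt_floor_add_one Y).le
    have h2 : Real.exp (-Y) * Real.exp (Y / 2) * Real.exp (Y / 2) = 1 := by
      rw [← Real.exp_add, ← Real.exp_add, ← Real.exp_zero]
      congr 1
      ring
    have h3 := rpow_le_mul_exp_half hs (zero_le_one.trans hY1)
    rw [hYs, hX, div_le_iff₀ hz₀] at h3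
    calc Q * Real.exp (-(N + 1)) * T ≤ Q * Real.exp (-Y) * T := by gcongr
      _ = κ * (Real.exp (-Y) * Real.exp (Y / 2)) / (2 * s) ^ s := by
          rw [hT]
          field_simp
      _ ≤ ((2 * s) ^ s * Real.exp (Y / 2) * ‖z₀‖) * (Real.exp (-Y) * Real.exp (Y / 2)) /
            (2 * s) ^ s := by gcongr
      _ = (Real.exp (-Y) * Real.exp (Y / 2) * Real.exp (Y / 2)) * ‖z₀‖ := by field_simp
      _ = ‖z₀‖ := by rw [h2, one_mul]

end EffectiveStability

/-- `‖·‖` on `Fin n → ℂ` is the maximum norm. -/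
theorem theorem1p3 (n : ℕ) (hn : 2 ≤ n) (ω : Fin n → ℝ) (s : ℝ) (hs : 0 < s)
    (F f : (Fin n → ℂ) → (Fin n → ℂ))
    (hF : AnalyticOnNhd ℂ F (unitPolydisk n))
    (hFf : ∀ z ∈ unitPolydisk n,
      F z = (Matrix.diagonal fun j => Complex.I * (ω j : ℂ)).mulVec z + f z)
    (hf0 : f 0 = 0)
    (hDf0 : HasFDerivAt f (0 : (Fin n → ℂ) →L[ℂ] (Fin n → ℂ)) 0)
    (hres : NonResonant ω)
    (hB : BrunoS ω s ∨ ∃ h : n = 2,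
      BrunoSContFract (-ω (Fin.cast h.symm 0) / ω (Fin.cast h.symm 1)) s) :
    ∃ r₀ : ℝ, 0 < r₀ ∧ ∀ r : ℝ, 0 < r → r < 1 → r < r₀ →
      ∃ A B C : ℝ, 0 < A ∧ 0 < B ∧ 0 < C ∧
        ∀ z₀ : Fin n → ℂ, 0 < ‖z₀‖ → ‖z₀‖ < r / 2 →
          ∀ T : ℝ, T = A⁻¹ * Real.exp (B * (r / ‖z₀‖) ^ (1 / s)) →
            ∃ z : ℝ → Fin n → ℂ,
              IsSolutionOn F z₀ (Set.Icc (-T) T) z ∧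
              (∀ t ∈ Set.Icc (-T) T, ‖z t‖ ≤ C * r) ∧
              ∀ y : ℝ → Fin n → ℂ, IsSolutionOn F z₀ (Set.Icc (-T) T) y →
                Set.EqOn y z (Set.Icc (-T) T) := by
  have : NeZero n := ⟨by omega⟩
  obtain ⟨M, hM⟩ : ∃ M, IsGevreyWeight (invDivisor ω) s M := by
    rcases hB with hB | ⟨h, hcf⟩
    · exact hB.exists_isGevreyWeight hs hres
    · subst h
      exact BrunoSContFract.exists_isGevreyWeight hs hres hcf
  have hFf' : ∀ z ∈ unitPolydisk n, F z = linearField ω z + f z := fun z hz => by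
    rw [hFf z hz]
    congr 1
    funext j
    rw [Matrix.mulVec_diagonal, linearField_apply]
  obtain ⟨κ, a, hκ, ha, hsol⟩ := exists_longTime_solution hres hs hM hF hFf' hf0 hDf0
  -- The exponent is rescaled from `κ / ‖z₀‖` to `r / ‖z₀‖`, and `6 * ‖z₀‖ ≤ 3 * r` since `‖z₀‖ < r
  -- / 2`.
  refine ⟨κ, hκ, fun r hr _ hrκ => ⟨a⁻¹, (κ / r) ^ (1 / s) / 2, 3, by positivity, by positivity,
    by norm_num, fun z₀ hz₀ hz₀r T hT => ?_⟩⟩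
  have hT' : T = a * Real.exp ((κ / ‖z₀‖) ^ (1 / s) / 2) := by
    rw [hT, inv_inv, div_mul_eq_mul_div, ← Real.mul_rpow (by positivity) (by positivity),
      div_mul_div_cancel₀ hr.ne']
  obtain ⟨z, hz, hbound⟩ := hsol z₀ hz₀ (by linarith) T hT'
  have hT0 : 0 < T := by rw [hT']; positivity
  exact ⟨z, hz, fun t ht => (hbound t ht).trans (by linarith), fun y hy => hy.eqOn hF hT0 hz⟩
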